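/- **Setting.** Let $\Omega\subset\mathbb R^d$, $\Sigma\subset\mathbb R$, $\Theta\subset S^{d-1}$ be compact, let $\mathcal H_\Theta$ be a Borel probability measure with support $\Theta$, and let $\emptyset\ne\mathcal T\subset\Sigma$ be finite. $\mathcal M_+(X)$ denotes the nonnegative finite Radon measures on $X$, with total variation norm $\|\cdot\|_{\mathcal M}$, and $F_\#\nu$ denotes a push-forward. Put $\Lambda=\{(x,v)\in\mathbb R^d\times\mathbb R^d: x+tv\in\Omega\ \forall t\in\Sigma\}$ and $\Gamma=\{(\theta\cdot x,\theta\cdot v):(x,v)\in\Lambda,\theta\in\Theta\}\subset\mathbb R^2$. Let $R_\theta$ be the push-forward under $x\mapsto\theta\cdot x$ and $\mathrm{mv}_t$ the push-forward under $(x,v)\mapsto x+tv$ (on $\mathbb R^2$). For $t\in\mathcal T$ let $\mathrm{Ob}_t:\mathcal M(\Omega)\to H$ ($H$ a Hilbert space) be the dual of a bounded linear operator $\mathrm{Ob}_t^*:H\to C(\Omega)$. For $\alpha\ge0$ and $f\in H^{\mathcal T}$ consider * the product-topology model: minimize $\|\gamma_{\hat\theta}\|_{\mathcal M}+\frac1{2\alpha}\sum_{t\in\mathcal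 T}\|\mathrm{Ob}_tu_t-f_t\|_H^2$ over $u\in\mathcal M_+(\Omega)^\Sigma$, $\gamma\in\mathcal M_+(\Gamma)^\Theta$ subject to $\mathrm{mv}_t\gamma_\theta=R_\theta u_t$ for all $t\in\Sigma$, $\theta\in\Theta$, where $\hat\theta\in\Theta$ is fixed but arbitrary; * the mixed model: minimize $\|\gamma\|_{\mathcal M}+\frac1{2\alpha}\sum_{t\in\mathcal T}\|\mathrm{Ob}_tu_t-f_t\|_H^2$ over $u\in\mathcal M_+(\Omega)^\Sigma$, $\gamma\in\mathcal M_+(\Theta\times\Gamma)$ subject to $[(\theta,x,v)\mapsto(\theta,x+tv)]_\#\gamma=\mathcal H_\Theta\otimes_\theta R_\theta u_t$ for all $t\in\Sigma$. A family $(\gamma_\theta)_{\theta\in\Theta}$ in $\mathcal M_+(\Gamma)$ is called a family of slices of $\gamma$ if $\gamma=\mathcal H_\Theta\otimes_\theta\gamma_\theta$. For $\alpha=0$ the data term is read as the constraint $\mathrm{Ob}_tu_t=f_t$ for all $t\in\mathcal T$. **Ground truth.** Let $\lambda^\dagger=\sum_{i=1}^Nm_i\delta_{(x_i,v_i)}\in\mathcal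 M_+(\Lambda)$ with $m_i>0$ and distinct $(x_i,v_i)$, and put $u_t^\dagger=[(x,v)\mapsto x+tv]_\#\lambda^\dagger$, $\gamma_\theta^\dagger=[(x,v)\mapsto(\theta\cdot x,\theta\cdot v)]_\#\lambda^\dagger$, $f_t^\dagger=\mathrm{Ob}_tu_t^\dagger$. For data $f^\delta\in H^{\mathcal T}$ let $\delta=\frac12\sum_{t\in\mathcal T}\|f^\delta_t-f^\dagger_t\|_H^2$. In what follows $(u,\gamma)$ is any solution of one of the two models with $f=f^\delta$, $\alpha=\sqrt\delta$. **Unbalanced Wasserstein divergence.** $W_{R}(\nu_1,\nu_2)=\inf_{\nu\in\mathcal M_+(\mathbb R^n)}\big(W_2^2(\nu,\nu_2)+\frac12R^2\|\nu_1-\nu\|_{\mathcal M}\big)$ for $\nu_1,\nu_2\in\mathcal M_+(\mathbb R^n)$, where $W_2^2$ is the squared Wasserstein-2 distance ($\infty$ for unequal masses). **Reconstructible.** A discrete measure $\nu=\sum_{i=1}^nm_i\delta_{y_i}\in\mathcal M_+(\Omega)$ ($m_i>0$, $y_i$ distinct) is reconstructible via $\mathrm{Ob}_t$ if there are $\kappa,\mu,R>0$,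 $R$ smaller than the minimum distance of the $y_i$, such that for each $s\in\{-1,1\}^n$ there are $v^\dagger,v^s\in H^*$ with $-\mathrm{Ob}_t^*v^\dagger\in\partial\|\cdot\|_{\mathcal M}(\nu)$, $-\mathrm{Ob}_t^*v^s\in\partial\|\cdot\|_{\mathcal M}(\sum_is_i\delta_{y_i})$, $-\mathrm{Ob}_t^*v^\dagger(x)\le1-\kappa\min\{R,\mathrm{dist}(x,\{y_1,\dots,y_n\})\}^2$ for all $x\in\Omega$, and $\mathrm{Ob}_t^*v^s(y_i)\,\mathrm{Ob}_t^*v^s(x)\ge1-\mu\,\mathrm{dist}(x,y_i)^2$ for all $i$ and $x\in\Omega$ with $\mathrm{dist}(x,y_i)<R$. Here $w\in\partial\|\cdot\|_{\mathcal M}(\sum_ic_i\delta_{y_i})$ (all $c_i\neq0$) means $|w|\le1$ and $w(y_i)=\operatorname{sgn}c_i$. **Coincidences and ghosts.** Write $x_i(t)=x_i+tv_i$. Let $\theta\in\Theta$, $\mathcal T'\subset\Sigma$, $\Delta\ge0$. $\gamma_\theta^\dagger$ has a *coincidence* w.r.t. $\mathcal T'$ if $\theta\cdot x_i(t)=\theta\cdot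 x_j(t)$ for some $i\ne j$, $t\in\mathcal T'$; a *ghost particle* is a point $(y,w)\in\mathbb R^2$, different from all $(\theta\cdot x_i,\theta\cdot v_i)$, such that for each $t\in\mathcal T'$ there is $i$ with $y+tw=\theta\cdot x_i(t)$. $\gamma_\theta^\dagger$ has a *$\Delta$-coincidence* if $|\theta\cdot x_i(t)-\theta\cdot x_j(t)|\le\Delta$ for some $i\neq j$, $t\in\mathcal T'$; it has a *$\Delta$-ghost particle* if there are $(y,w)\in\mathbb R^2$ and a nonconstant map $t\mapsto i_t$ on $\mathcal T'$ with $|y+tw-\theta\cdot x_{i_t}(t)|\le\Delta$ for all $t\in\mathcal T'$. For $\Theta'\subset\Theta$, $u_t^\dagger$ has a *$\Delta$-coincidence* w.r.t. $\Theta'$ if $|\theta\cdot(x_i(t)-x_j(t))|\le\Delta$ for some $i\ne j$, $\theta\in\Theta'$; it has a *$\Delta$-ghost particle* w.r.t. $\Theta'$ if there are $x\in\mathbb R^d$ and a nonconstant map $\theta\mapsto i_\theta$ on $\Theta'$ with $|\theta\cdot(x-x_{i_\theta}(t))|\le\Delta$ for all $\theta\in\Theta'$. **Theorem.** (0) If $(u,\gamma)$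 solves the mixed model (for any $f$, $\alpha$), then $\gamma$ has a family of slices. In (1) and (2), for the mixed model, statements about $\gamma_\theta$ hold for every family of slices. Let $\emptyset\neq\mathcal T'\subset\mathcal T$ be such that $u_t^\dagger$ is reconstructible via $\mathrm{Ob}_t$ for all $t\in\mathcal T'$. (1) Let $\overline\Theta\subset\Theta$ be compact such that $\gamma_\theta^\dagger$ has no coincidence and no ghost particle w.r.t. $\mathcal T'$ for any $\theta\in\overline\Theta$. Let $\overline\Sigma\subset\Sigma$ be compact such that for all $t\in\overline\Sigma$: $\theta\cdot x_i(t)\ne\theta\cdot x_j(t)$ for all $i\neq j$, $\theta\in\overline\Theta$, and $\operatorname{supp}u_t^\dagger=\{x_1(t),\dots,x_N(t)\}$ is the only finite set in $\mathbb R^d$ with the same projections onto all directions $\theta\in\overline\Theta$. Then there are $R,C>0$, not depending on $f^\delta$, $\hat\theta$ or the solution, such that for every $f^\delta$ and every solution $(u,\gamma)$ of either model with $f=f^\delta$, $\alpha=\sqrt\delta$: $W_R(u_t,u_t^\dagger)\le C\sqrt\delta$ for all $t\in\overline\Sigma$, and $W_R(\gamma_\theta,\gamma_\theta^\dagger)\le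 C\sqrt\delta$ for all $\theta\in\overline\Theta$ ($\mathcal H_\Theta$-almost all $\theta\in\overline\Theta$ for the mixed model). (2) There are $R,C_1>0$ (depending on $\mathcal T'$ but not on $\Theta'$) and, for each $\Theta'\subset\Theta$, a $C_2>0$ (depending on $\Theta'$ but not on $\mathcal T'$), none depending on $f^\delta$, $\hat\theta$ or the solution, such that for every $f^\delta$ and every solution $(u,\gamma)$ of either model with $f=f^\delta$, $\alpha=\sqrt\delta$: (i) $W_R(u_t,u_t^\dagger)\le C_1\sqrt\delta$ for all $t\in\mathcal T'$. (ii) If $|\mathcal T'|\ge2$, then for all $\theta\in\Theta$ ($\mathcal H_\Theta$-almost all $\theta\in\Theta$ for the mixed model) and all $\Delta_\theta\ge0$ such that $\gamma_\theta^\dagger$ has no $\Delta_\theta$-coincidence or $\Delta_\theta$-ghost particle w.r.t. $\mathcal T'$: $W_{R_\theta}(\gamma_\theta,\gamma_\theta^\dagger)\le\frac{C_1}{R_\theta^2}\sqrt\delta$, where $R_\theta=\min\{R,\Delta_\theta/3\}/\sqrt{1+\max_{t\in\mathcal T'}t^2}$. (iii) If $|\mathcal T'|\ge2$, $\Theta'\subset\Theta$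 spans $\mathbb R^d$, and $\Delta_\theta$ is as in (ii) for every $\theta\in\Theta'$, then for all $t\in\Sigma$ and all $\Delta_t\in[0,\inf_{\theta\in\Theta'}\Delta_\theta]$ such that $u_t^\dagger$ has no $\Delta_t$-coincidence or $\Delta_t$-ghost particle w.r.t. $\Theta'$: $W_{R_t}(u_t,u_t^\dagger)\le C_1C_2\big(t^2+\frac1{R_t^4}\big)\sqrt\delta$, where $R_t=\min\{R,\Delta_t/(3\sqrt{1+t^2})\}$. (For $\Delta_\theta=0$ or $\Delta_t=0$ the left-hand side vanishes and nothing is claimed.) -/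

import Mathlib

open MeasureTheory TopologicalSpace
open scoped NNReal ENNReal InnerProductSpace

namespace ParticleTracking

noncomputable section

/-! ### Measures, product measures, optimal transport

`FiniteMeasure X` plays the role of the set of nonnegative finite Radon measures on `X`
(every space `X` below is a sigma-compact metric space, on which finite Borel measures are Radon),
and `FiniteMeasure.mass` is the total variation norm of such a measure. -/

/-- `IsFiberProduct ω g ρ` says `ρ = ω ⊗_y g_y`: for every Borel set `A` the map `y ↦ g_y(A)` is
`ω`-measurable, and `ρ (B × A) = ∫_B g_y(A) dω(y)`.  Read from right to left, the family `g`
consists of the slices (the disintegration) of `ρ` with respect to `ω`. -/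
def IsFiberProduct {Y Z : Type*} [MeasurableSpace Y] [MeasurableSpace Z]
    (ω : Measure Y) (g : Y → FiniteMeasure Z) (ρ : FiniteMeasure (Y × Z)) : Prop :=
  ∀ A : Set Z, MeasurableSet A →
    AEMeasurable (fun y => (g y : Measure Z) A) ω ∧
    ∀ B : Set Y, MeasurableSet B →
      (ρ : Measure (Y × Z)) (B ×ˢ A) = ∫⁻ y in B, (g y : Measure Z) A ∂ω

/-- Zero extension of a measure on a subset to the ambient space. -/
def zeroExt {X : Type*} [MeasurableSpace X] {p : X → Prop} (μ : FiniteMeasure (Subtype p)) :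
    FiniteMeasure X :=
  μ.map Subtype.val

/-- The total variation norm of the signed measure `μ - ν`. -/
def tvDist {X : Type*} [MeasurableSpace X] (μ ν : FiniteMeasure X) : ℝ≥0∞ :=
  ((μ : Measure X).toSignedMeasure - (ν : Measure X).toSignedMeasure).totalVariation Set.univ

/-- The squared Wasserstein-2 distance (infinite if there is no coupling, that is, for
measures of different mass). -/
def sqWasserstein {X : Type*} [PseudoEMetricSpace X] [MeasurableSpace X]
    (μ ν : FiniteMeasure X) : ℝ≥0∞ :=
  ⨅ (π : FiniteMeasure (X × X)) (_ : π.map Prod.fst = μ) (_ : π.map Prod.snd = ν),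
    ∫⁻ q, edist q.1 q.2 ^ 2 ∂(π : Measure (X × X))

/-- The unbalanced Wasserstein-2 divergence
`inf_ν  W_2²(ν, ν₂) + (1/2) R² ‖ν₁ - ν‖`. -/
def unbalancedWasserstein {X : Type*} [PseudoEMetricSpace X] [MeasurableSpace X]
    (R : ℝ) (ν₁ ν₂ : FiniteMeasure X) : ℝ≥0∞ :=
  ⨅ ν : FiniteMeasure X, sqWasserstein ν ν₂ + ENNReal.ofReal (R ^ 2 / 2) * tvDist ν₁ ν

/-! ### Coincidences and ghost particles

A particle configuration in `F` is given by its positions `x i` and velocities `v i`. -/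

section Configurations

variable {F ι : Type*} [NormedAddCommGroup F] [NormedSpace ℝ F]

/-- Two distinct particles are at the same place at some time in `T`. -/
def HasCoincidence (x v : ι → F) (T : Set ℝ) : Prop :=
  ∃ t ∈ T, ∃ i j, i ≠ j ∧ x i + t • v i = x j + t • v j

/-- There is a ghost particle: a nonexistent particle `(y, w)` that is, at each time in `T`, at
the place of some particle. -/
def HasGhost (x v : ι → F) (T : Set ℝ) : Prop :=
  ∃ y w : F, (∀ i, (y, w) ≠ (x i, v i)) ∧ ∀ t ∈ T, ∃ i, y + t • w = x i + t • v i

/-- Two distinct particles come `Δ`-close at some time in `T`. -/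
def HasDeltaCoincidence (Δ : ℝ) (x v : ι → F) (T : Set ℝ) : Prop :=
  ∃ t ∈ T, ∃ i j, i ≠ j ∧ dist (x j + t • v j) (x i + t • v i) ≤ Δ

/-- There is a `Δ`-ghost particle `(y, w)`: at each time `t ∈ T` it is `Δ`-close to some particle
`i t`, where `i t` is not the same for all `t ∈ T`. -/
def HasDeltaGhost (Δ : ℝ) (x v : ι → F) (T : Set ℝ) : Prop :=
  ∃ (y w : F) (i : ℝ → ι), (∃ t ∈ T, ∃ t' ∈ T, i t ≠ i t') ∧
    ∀ t ∈ T, dist (y + t • w) (x (i t) + t • v (i t)) ≤ Δ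

end Configurations

section Directions

variable {F ι : Type*} [NormedAddCommGroup F] [InnerProductSpace ℝ F]

/-- Two distinct particles (at places `x i`) seem `Δ`-close in some projection `θ ∈ D`. -/
def HasDirDeltaCoincidence (Δ : ℝ) (x : ι → F) (D : Set F) : Prop :=
  ∃ θ ∈ D, ∃ i j, i ≠ j ∧ dist (⟪θ, x j⟫_ℝ) (⟪θ, x i⟫_ℝ) ≤ Δ

/-- There is a `Δ`-ghost particle `y` with respect to the directions in `D`: in each projection
`θ ∈ D` it is `Δ`-close to some particle `i θ`, where `i θ` is not the same for all `θ ∈ D`. -/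
def HasDirDeltaGhost (Δ : ℝ) (x : ι → F) (D : Set F) : Prop :=
  ∃ (y : F) (i : F → ι), (∃ θ ∈ D, ∃ θ' ∈ D, i θ ≠ i θ') ∧
    ∀ θ ∈ D, dist (⟪θ, y⟫_ℝ) (⟪θ, x (i θ)⟫_ℝ) ≤ Δ

/-- The finite set `A` is uniquely determined by its projections in the directions `D`. -/
def IsDeterminedByProjections (A : Set F) (D : Set F) : Prop :=
  ∀ B : Set F, B.Finite → (∀ θ ∈ D, (fun y => ⟪θ, y⟫_ℝ) '' B = (fun y => ⟪θ, y⟫_ℝ) '' A) → B = A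

end Directions

/-! ### Observation operators and reconstructible measures -/

section Observation

variable {X H : Type*} [TopologicalSpace X] [CompactSpace X] [MeasurableSpace X]
  [BorelSpace X] [NormedAddCommGroup H] [InnerProductSpace ℝ H]

/-- The functional `w ↦ ∫ (A w) dμ` on `H`, for a bounded operator `A : H → C(X)`. -/
def obsFunctional (A : H →L[ℝ] C(X, ℝ)) (μ : FiniteMeasure X) : StrongDual ℝ H :=
  LinearMap.mkContinuous
    { toFun := fun w => ∫ y, A w y ∂(μ : Measure X)
      map_add' := fun w w' => by
        have hint : ∀ h : C(X, ℝ), Integrable h (μ : Measure X) := fun h =>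
          BoundedContinuousFunction.integrable (μ : Measure X)
            (BoundedContinuousFunction.mkOfCompact h)
        simp only [map_add, ContinuousMap.add_apply]
        exact integral_add (hint _) (hint _)
      map_smul' := fun c w => by
        simp only [map_smul, ContinuousMap.smul_apply, RingHom.id_apply]
        exact integral_smul c _ }
    (‖A‖ * (μ : Measure X).real Set.univ)
    (fun w => by
      have h := norm_integral_le_of_norm_le_const (μ := (μ : Measure X)) (f := fun y => A w y)
        (C := ‖A‖ * ‖w‖)
        (Filter.Eventually.of_forall fun y => ((A w).norm_coe_le_norm y).trans (A.le_opNorm w))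
      calc ‖∫ y, A w y ∂(μ : Measure X)‖ ≤ ‖A‖ * ‖w‖ * (μ : Measure X).real Set.univ := h
        _ = ‖A‖ * (μ : Measure X).real Set.univ * ‖w‖ := by ring)

/-- The observation operator `Ob` with pre-adjoint `A = Ob^* : H → C(X)`: the observation `Ob μ`
is the element of the Hilbert space `H` with `⟪Ob μ, w⟫ = ∫ (A w) dμ` for all `w`. -/
def observe [CompleteSpace H] (A : H →L[ℝ] C(X, ℝ)) (μ : FiniteMeasure X) : H :=
  (InnerProductSpace.toDual ℝ H).symm (obsFunctional A μ)

/-- The Dirac measure. -/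
def diracMass {Y : Type*} [MeasurableSpace Y] (y : Y) : FiniteMeasure Y :=
  ⟨Measure.dirac y, inferInstance⟩

/-- `w ∈ ∂‖·‖` at the discrete signed measure `∑ i, c i • δ_{x i}` (with distinct `x i` and nonzero
`c i`): `|w| ≤ 1` everywhere, and `w (x i) = sgn (c i)`. -/
def IsTVSubgradient {n : ℕ} (c : Fin n → ℝ) (x : Fin n → X) (w : C(X, ℝ)) : Prop :=
  (∀ y, |w y| ≤ 1) ∧ ∀ i, w (x i) = Real.sign (c i)

end Observation

/-- The measure `ν` is reconstructible from measurements via the observation operator with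
pre-adjoint `A` (the source condition).  Here `ν = ∑ i, m i • δ_{x i}` is written with distinct
`x i` and positive masses, and the dual variables `v, vs ∈ H^*` are identified with elements
of `H`. -/
def IsReconstructible {X H : Type*} [MetricSpace X] [CompactSpace X] [MeasurableSpace X]
    [NormedAddCommGroup H] [InnerProductSpace ℝ H]
    (A : H →L[ℝ] C(X, ℝ)) (ν : FiniteMeasure X) : Prop :=
  ∃ (n : ℕ) (m : Fin n → ℝ≥0) (x : Fin n → X),
    (∀ i, 0 < m i) ∧ Function.Injective x ∧ ν = ∑ i, m i • diracMass (x i) ∧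
    ∃ κ μ R : ℝ, 0 < κ ∧ 0 < μ ∧ 0 < R ∧ (∀ i j, i ≠ j → R < dist (x i) (x j)) ∧
      ∀ s : Fin n → ℝ, (∀ i, s i = -1 ∨ s i = 1) →
        ∃ v vs : H,
          IsTVSubgradient (fun i => (m i : ℝ)) x (-(A v)) ∧
          IsTVSubgradient s x (-(A vs)) ∧
          (∀ y, -(A v y) ≤ 1 - κ * min R (Metric.infDist y (Set.range x)) ^ 2) ∧
          (∀ i, ∀ y ∈ Metric.ball (x i) R, A vs (x i) * A vs y ≥ 1 - μ * dist y (x i) ^ 2)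

/-! ### The setting and the two dimension-reduced models -/

/-- The data of the tracking problem: the compact domain `Ω`, the compact set `Sig` of times,
the compact set `Θ` of directions, the finite nonempty set `times` of observation times, a
probability measure `HΘ` with support `Θ`, and for every observation time `t`
the pre-adjoint `obsAdj t : H → C(Ω)` of the observation operator (its values at
other times are never used). -/
structure Setting (d : ℕ) (H : Type*) [NormedAddCommGroup H] [InnerProductSpace ℝ H] where
  Ω : Compacts (EuclideanSpace ℝ (Fin d))
  Sig : Compacts ℝ
  Θ : Compacts (EuclideanSpace ℝ (Fin d))
  norm_direction : ∀ θ ∈ Θ, ‖θ‖ = 1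
  times : Finset Sig
  times_nonempty : times.Nonempty
  HΘ : Measure Θ
  isProbabilityMeasure : IsProbabilityMeasure HΘ
  isOpenPosMeasure : HΘ.IsOpenPosMeasure
  obsAdj : Sig → H →L[ℝ] C(Ω, ℝ)

section Models

variable {d : ℕ} {H : Type*} [NormedAddCommGroup H] [InnerProductSpace ℝ H]

namespace Setting

/-- `Λ`: the pairs `(x, v)` of position and velocity that stay in `Ω` at all times in `Sig`. -/
def Lam (S : Setting d H) : Set (EuclideanSpace ℝ (Fin d) × EuclideanSpace ℝ (Fin d)) :=
  {q | ∀ t ∈ S.Sig, q.1 + t • q.2 ∈ S.Ω}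

/-- `Γ`: the projected position-velocity pairs, in the Euclidean plane. -/
def Gam (S : Setting d H) : Set (EuclideanSpace ℝ (Fin 2)) :=
  {z | ∃ q ∈ S.Lam, ∃ θ ∈ S.Θ, z = !₂[⟪θ, q.1⟫_ℝ, ⟪θ, q.2⟫_ℝ]}

/-- The Radon transform `R_θ` (push-forward under `x ↦ θ · x`). -/
def radon (S : Setting d H) (θ : S.Θ) (μ : FiniteMeasure S.Ω) : FiniteMeasure ℝ :=
  μ.map fun x => ⟪(θ : EuclideanSpace ℝ (Fin d)), (x : EuclideanSpace ℝ (Fin d))⟫_ℝ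

/-- The move operator `mv_t` (push-forward under `(x, v) ↦ x + t v`) in dimension one. -/
def move (S : Setting d H) (t : S.Sig) (μ : FiniteMeasure S.Gam) : FiniteMeasure ℝ :=
  μ.map fun z => z.1 0 + (t : ℝ) * z.1 1

/-- The anglewise move operator (push-forward under `(θ, x, v) ↦ (θ, x + t v)`). -/
def angleMove (S : Setting d H) (t : S.Sig) (μ : FiniteMeasure (S.Θ × S.Gam)) :
    FiniteMeasure (S.Θ × ℝ) :=
  μ.map fun z => (z.1, z.2.1 0 + (t : ℝ) * z.2.1 1)

/-- The data term `∑_{t ∈ times} ‖Ob_t u_t - f_t‖²`. -/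
def dataTerm [CompleteSpace H] (S : Setting d H) (f : S.Sig → H)
    (u : S.Sig → FiniteMeasure S.Ω) : ℝ :=
  ∑ t ∈ S.times, ‖observe (S.obsAdj t) (u t) - f t‖ ^ 2

/-- `mass + (1 / (2 α)) * data`.  For `α = 0` the factor is `∞`, with `∞ * 0 = 0`, so that the data
term becomes a constraint. -/
def energy (α mass data : ℝ) : ℝ≥0∞ :=
  ENNReal.ofReal mass + (2 * ENNReal.ofReal α)⁻¹ * ENNReal.ofReal data

/-- Admissible pairs of the product topology model: `mv_t γ_θ = R_θ u_t` for all `t`, `θ`. -/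
def ProductAdmissible (S : Setting d H) (u : S.Sig → FiniteMeasure S.Ω)
    (γ : S.Θ → FiniteMeasure S.Gam) : Prop :=
  ∀ t θ, S.move t (γ θ) = S.radon θ (u t)

/-- `(u, γ)` solves the product topology model with parameter `α` and data `f`, where the mass
of `γ_{θ₀}` is the regularizer. -/
def IsProductSolution [CompleteSpace H] (S : Setting d H) (α : ℝ) (f : S.Sig → H) (θ₀ : S.Θ)
    (u : S.Sig → FiniteMeasure S.Ω) (γ : S.Θ → FiniteMeasure S.Gam) : Prop :=
  S.ProductAdmissible u γ ∧
  ∀ u' γ', S.ProductAdmissible u' γ' →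
    energy α (γ θ₀).mass (S.dataTerm f u) ≤ energy α (γ' θ₀).mass (S.dataTerm f u')

/-- Admissible pairs of the mixed model: the anglewise move of `γ` is the Radon
transform `HΘ ⊗_θ R_θ u_t` of `u_t`, for all `t`. -/
def MixedAdmissible (S : Setting d H) (u : S.Sig → FiniteMeasure S.Ω)
    (γ : FiniteMeasure (S.Θ × S.Gam)) : Prop :=
  ∀ t, IsFiberProduct S.HΘ (fun θ => S.radon θ (u t)) (S.angleMove t γ)

/-- `(u, γ)` solves the mixed model with parameter `α` and data `f`. -/
def IsMixedSolution [CompleteSpace H] (S : Setting d H) (α : ℝ) (f : S.Sig → H)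
    (u : S.Sig → FiniteMeasure S.Ω) (γ : FiniteMeasure (S.Θ × S.Gam)) : Prop :=
  S.MixedAdmissible u γ ∧
  ∀ u' γ', S.MixedAdmissible u' γ' →
    energy α γ.mass (S.dataTerm f u) ≤ energy α γ'.mass (S.dataTerm f u')

end Setting

/-! ### The ground truth -/

/-- The ground truth `λ = ∑ i, m i • δ_{(x i, v i)}` on `Λ`, with positive masses and distinct
particles `(x i, v i)`. -/
structure GroundTruth (S : Setting d H) where
  N : ℕ
  m : Fin N → ℝ≥0
  particle : Fin N → S.Lam
  m_pos : ∀ i, 0 < m i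
  particle_injective : Function.Injective particle

namespace GroundTruth

variable {S : Setting d H} (G : GroundTruth S)

/-- The ground truth as a measure on `Λ`. -/
def lam : FiniteMeasure S.Lam := ∑ i, G.m i • diracMass (G.particle i)

/-- Initial position of particle `i`. -/
def pos (i : Fin G.N) : EuclideanSpace ℝ (Fin d) := (G.particle i).1.1

/-- Velocity of particle `i`. -/
def vel (i : Fin G.N) : EuclideanSpace ℝ (Fin d) := (G.particle i).1.2

/-- Location of particle `i` at time `t`. -/
def loc (t : ℝ) (i : Fin G.N) : EuclideanSpace ℝ (Fin d) := G.pos i + t • G.vel i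

/-- One-dimensional position of particle `i` in the projection `θ`. -/
def projPos (θ : S.Θ) (i : Fin G.N) : ℝ := ⟪(θ : EuclideanSpace ℝ (Fin d)), G.pos i⟫_ℝ

/-- One-dimensional velocity of particle `i` in the projection `θ`. -/
def projVel (θ : S.Θ) (i : Fin G.N) : ℝ := ⟪(θ : EuclideanSpace ℝ (Fin d)), G.vel i⟫_ℝ

/-- The ground truth snapshot at time `t`: push-forward under `(x, v) ↦ x + t v`. -/
def snapshot (t : S.Sig) : FiniteMeasure S.Ω :=
  G.lam.map fun q => ⟨q.1.1 + (t : ℝ) • q.1.2, q.2 t t.2⟩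

/-- The ground truth position-velocity projection: push-forward under
`(x, v) ↦ (θ · x, θ · v)`. -/
def projection (θ : S.Θ) : FiniteMeasure S.Gam :=
  G.lam.map fun q => ⟨!₂[⟪(θ : EuclideanSpace ℝ (Fin d)), q.1.1⟫_ℝ,
    ⟪(θ : EuclideanSpace ℝ (Fin d)), q.1.2⟫_ℝ], q.1, q.2, θ, θ.2, rfl⟩

/-- The noise strength `(1/2) ∑_{t ∈ times} ‖f_t - f†_t‖²`, `f†_t = Ob_t u†_t`. -/
def noise [CompleteSpace H] (f : S.Sig → H) : ℝ :=
  (1 / 2) * ∑ t ∈ S.times, ‖f t - observe (S.obsAdj t) (G.snapshot t)‖ ^ 2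

/-- Error of a reconstructed snapshot at time `t`. -/
def snapshotError (R : ℝ) (u : S.Sig → FiniteMeasure S.Ω) (t : S.Sig) : ℝ≥0∞ :=
  unbalancedWasserstein R (zeroExt (u t)) (zeroExt (G.snapshot t))

/-- Error of a reconstructed position-velocity projection in direction `θ`. -/
def projectionError (R : ℝ) (γ : S.Θ → FiniteMeasure S.Gam) (θ : S.Θ) : ℝ≥0∞ :=
  unbalancedWasserstein R (zeroExt (γ θ)) (zeroExt (G.projection θ))

/-- The projected configuration in direction `θ` contains no `Δ`-coincidence and no `Δ`-ghost
particle with respect to the times `T`. -/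
def TimeSeparated (T : Finset S.Sig) (θ : S.Θ) (Δ : ℝ) : Prop :=
  ¬ HasDeltaCoincidence Δ (G.projPos θ) (G.projVel θ) (Subtype.val '' (T : Set S.Sig)) ∧
  ¬ HasDeltaGhost Δ (G.projPos θ) (G.projVel θ) (Subtype.val '' (T : Set S.Sig))

/-- The snapshot at time `t` contains no `Δ`-coincidence and no `Δ`-ghost particle with respect to
the directions `D`. -/
def DirSeparated (D : Set S.Θ) (t : S.Sig) (Δ : ℝ) : Prop :=
  ¬ HasDirDeltaCoincidence Δ (G.loc t) (Subtype.val '' D) ∧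
  ¬ HasDirDeltaGhost Δ (G.loc t) (Subtype.val '' D)

end GroundTruth

/-- `R_θ = min {R, Δ / 3} / √(1 + max_{t ∈ T} t²)`. -/
def radiusTheta {S : Setting d H} (T : Finset S.Sig) (hT : T.Nonempty) (R Δ : ℝ) : ℝ :=
  min R (Δ / 3) / √(1 + T.sup' hT fun t => (t : ℝ) ^ 2)

/-- `R_t = min {R, Δ / (3 √(1 + t²))}`. -/
def radiusTime (R Δ t : ℝ) : ℝ :=
  min R (Δ / (3 * √(1 + t ^ 2)))

end Models

end

end ParticleTracking

open ParticleTracking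

/-! The ground truth is admissible in both models, and with `α = √δ =: ε` its energy exceeds its
mass by only `ε`. Push-forwards preserve mass, so every snapshot `u t` has the same mass as `γ` (or
as `γ θ`). Comparison with the ground truth therefore makes each `u t` a near minimizer of a static
problem: its mass is at most that of the ground truth plus `ε - q`, while the data misfit is at most
`2 ε q` (`IsNearOptimal`). From here on the two models differ only in how slices are obtained.

All estimates are expressed by one notion, `IsConcentrated`: the measure sits on disjoint cells, one
per particle, with correct masses up to `b`, with transport cost `a` to the particles, and with mass
at most `b` outside the cells. It bounds the unbalanced Wasserstein divergence by `a` plus a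
multiple of `R ^ 2 * b` (`unbalancedWasserstein_le_of_isConcentrated`). For a scalar observable it
depends only on the law of that observable, so it passes through the identity `mv_t γ_θ = R_θ u_t`
in either direction.

Three passages do the work. (a) At a reconstructible observation time the dual certificates give
concentration of order `ε` (`IsReconstructible.exists_isConcentrated`): quadratic growth of `1 +
Ob^* v` controls transport cost and stray mass, and the sign certificates control the mass of each
cell. (b) A slice is observed through `y + t w` for the observation times `t`. Up to small mass,
each point lies near some particle at every time; in the absence of ghosts it is the same particle
throughout, and two times determine position and velocity (`exists_projection_isConcentrated`). (c)
The same argument, with directions in place of times, returns from slices to a snapshot at any time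
(`exists_snapshot_bound_of_projections`). There finitely many directions must suffice: a basis, and
for each assignment of particles to the basis one direction refuting the ghosts with that
assignment.

The mass error in (b) and (c) grows like the inverse square of the cell radius, but the divergence
weights it with the square of a radius that is no larger up to a constant. The bounds thus come out
without negative powers of the radii; those in the quantitative statement are a weakening for radii
at most one. The qualitative statement follows because absence of coincidences and ghosts on compact
sets is uniform (`exists_uniform_timeSeparated`, `exists_uniform_dirSeparated`). In the mixed model,
slices match the snapshots only almost everywhere; weak compactness and the full support of `HΘ`
supply a matching measure in every direction, which (c) needs because the prescribed directions may
form a null set. -/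

namespace ParticleTracking

/-! ### Upper bounds for the unbalanced Wasserstein divergence -/

section Divergence

variable {X : Type*} [MeasurableSpace X]

theorem tvDist_add_add_le (α μ ν : FiniteMeasure X) :
    tvDist (α + μ) (α + ν) ≤ (μ : Measure X) Set.univ + (ν : Measure X) Set.univ := by
  have h : ((α + μ : FiniteMeasure X) : Measure X).toSignedMeasure
      - ((α + ν : FiniteMeasure X) : Measure X).toSignedMeasure
      = (μ : Measure X).toSignedMeasure - (ν : Measure X).toSignedMeasure := by
    have h1 : ((α + μ : FiniteMeasure X) : Measure X).toSignedMeasure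
        = (α : Measure X).toSignedMeasure + (μ : Measure X).toSignedMeasure :=
      Measure.toSignedMeasure_add _ _
    have h2 : ((α + ν : FiniteMeasure X) : Measure X).toSignedMeasure
        = (α : Measure X).toSignedMeasure + (ν : Measure X).toSignedMeasure :=
      Measure.toSignedMeasure_add _ _
    rw [h1, h2]; abel
  unfold tvDist
  rw [h, SignedMeasure.totalVariation_eq_variation]
  refine (VectorMeasure.variation_sub_le (μ := (μ : Measure X).toSignedMeasure)
    (ν := (ν : Measure X).toSignedMeasure) Set.univ).trans ?_
  simp

/-- `μ` is, up to a transport cost `a` and mass errors `b`, concentrated on disjoint sets `A i`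
that carry the masses `m i`; here `D i x` is the cost of moving `x ∈ A i` to the `i`-th target. -/
structure IsConcentrated {ι : Type*} [Fintype ι] (μ : Measure X) (m : ι → ℝ≥0)
    (D : ι → X → ℝ≥0∞) (A : ι → Set X) (a b : ℝ≥0∞) : Prop where
  measurableSet : ∀ i, MeasurableSet (A i)
  disjoint : Pairwise (Function.onFun Disjoint A)
  sum_lintegral_le : ∑ i, ∫⁻ x in A i, D i x ∂μ ≤ a
  compl_le : μ (⋃ i, A i)ᶜ ≤ b
  le_mass_add : ∀ i, μ (A i) ≤ m i + b
  mass_le_add : ∀ i, (m i : ℝ≥0∞) ≤ μ (A i) + b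

variable [PseudoEMetricSpace X]

/-- Changing mass is free for `R = 0`, so the target itself is an intermediate measure of cost zero.
This settles the degenerate separation `Δ = 0`, in which the radii vanish. -/
theorem unbalancedWasserstein_zero_left {μ ν : FiniteMeasure X} :
    unbalancedWasserstein 0 μ ν = 0 := by
  refine le_antisymm ((iInf_le _ ν).trans ?_) bot_le
  simp only [ne_eq, OfNat.ofNat_ne_zero, not_false_eq_true, zero_pow, zero_div,
    ENNReal.ofReal_zero, zero_mul, add_zero]
  have hm : Measurable fun x : X => (x, x) := measurable_id.prodMk measurable_id
  refine (iInf_le_of_le (ν.map fun x => (x, x)) (iInf_le_of_le ?_ (iInf_le_of_le ?_ ?_)))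
  · apply Subtype.ext
    change ((ν : Measure X).map _).map _ = _
    rw [Measure.map_map measurable_fst hm]; exact Measure.map_id
  · apply Subtype.ext
    change ((ν : Measure X).map _).map _ = _
    rw [Measure.map_map measurable_snd hm]; exact Measure.map_id
  -- Only an inequality is used: nothing relates the metric to the σ-algebra, so the cost need not
  -- be measurable.
  · refine (lintegral_map_le _ _).trans ?_
    simp

/-- In each cell as much mass as the target can take is transported to it; excess is deleted and a
deficit is created on the spot. In one cell only one of the two occurs, so a cell costs mass at most
`b`, and the complement of the cells costs another `b`. -/
theorem unbalancedWasserstein_le_of_isConcentrated {ι : Type*} [Fintype ι] {μ : FiniteMeasure X}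
    {m : ι → ℝ≥0} {y : ι → X} {A : ι → Set X} {a b : ℝ≥0∞} (R : ℝ)
    (h : IsConcentrated (μ : Measure X) m (fun i x => edist x (y i) ^ 2) A a b) :
    unbalancedWasserstein R μ (∑ i, m i • diracMass (y i)) ≤
      a + ENNReal.ofReal (R ^ 2 / 2) * ((Fintype.card ι + 1) * b) := by
  classical
  -- The fraction of the mass of cell `i` that is kept; division by zero gives `0` for a null cell.
  let c : ι → ℝ≥0 := fun i => min 1 (m i / μ (A i))
  have hc1 : ∀ i, c i ≤ 1 := fun i => min_le_left _ _
  have hcm : ∀ i, c i * μ (A i) ≤ m i := fun i => by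
    by_cases h0 : μ (A i) = 0
    · simp [h0]
    · calc c i * μ (A i) ≤ m i / μ (A i) * μ (A i) := by gcongr; exact min_le_right _ _
        _ = m i := div_mul_cancel₀ _ h0
  let e : ι → ℝ≥0 := fun i => m i - c i * μ (A i)
  have hce : ∀ i, c i * μ (A i) + e i = m i := fun i => add_tsub_cancel_of_le (hcm i)
  have hμA : ∀ i, (μ (A i) : ℝ≥0∞) = (μ : Measure X) (A i) := fun i => by simp
  have herr : ∀ i, (((1 - c i) * μ (A i) + e i : ℝ≥0) : ℝ≥0∞) ≤ b := fun i => by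
    have h1 := h.le_mass_add i
    have h2 := h.mass_le_add i
    rw [← hμA] at h1 h2
    by_cases h0 : μ (A i) = 0
    · simp only [h0] at h2
      simpa [e, h0] using h2
    rcases le_total (m i) (μ (A i)) with hle | hle
    · have hc : c i = m i / μ (A i) :=
        min_eq_right (div_le_one_of_le₀ hle zero_le)
      have h3 : c i * μ (A i) = m i := by rw [hc]; exact div_mul_cancel₀ _ h0
      have h4 : (1 - c i) * μ (A i) + e i = μ (A i) - m i := by
        simp [e, tsub_mul, h3]
      rw [h4, ENNReal.coe_sub]
      exact tsub_le_iff_left.2 h1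
    · have hc : c i = 1 :=
        min_eq_left ((one_le_div₀ (pos_iff_ne_zero.2 h0)).2 hle)
      have h4 : (1 - c i) * μ (A i) + e i = m i - μ (A i) := by
        simp [e, hc]
      rw [h4, ENNReal.coe_sub]
      exact tsub_le_iff_left.2 h2
  -- `P` is transported, `Q` fills the deficits at the targets and `P'` is discarded. The
  -- intermediate measure is `P + Q`, and comparing it with `μ = P + P'` cancels `P`.
  let P : FiniteMeasure X := ∑ i, c i • μ.restrict (A i)
  let Q : FiniteMeasure X := ∑ i, e i • diracMass (y i)
  let P' : FiniteMeasure X := (∑ i, (1 - c i) • μ.restrict (A i)) + μ.restrict (⋃ i, A i)ᶜ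
  have hsplit : μ = P + P' := by
    have hU : MeasurableSet (⋃ i, A i) := MeasurableSet.iUnion h.measurableSet
    have h1 : P + P' = (∑ i, μ.restrict (A i)) + μ.restrict (⋃ i, A i)ᶜ := by
      simp only [P, P']
      rw [← add_assoc, ← Finset.sum_add_distrib]
      congr 1
      refine Finset.sum_congr rfl fun i _ => ?_
      rw [← add_smul, add_tsub_cancel_of_le (hc1 i), one_smul]
    rw [h1]
    apply Subtype.ext
    change (μ : Measure X) = _
    have h2 : ((∑ i, μ.restrict (A i) + μ.restrict (⋃ i, A i)ᶜ : FiniteMeasure X) : Measure X)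
        = (μ : Measure X).restrict (⋃ i, A i) + (μ : Measure X).restrict (⋃ i, A i)ᶜ := by
      rw [FiniteMeasure.toMeasure_add, FiniteMeasure.toMeasure_sum,
        Measure.restrict_iUnion h.disjoint h.measurableSet, Measure.sum_fintype]
      rfl
    exact (h2.trans (Measure.restrict_add_restrict_compl hU)).symm
  have hcost : sqWasserstein (P + Q) (∑ i, m i • diracMass (y i)) ≤ a := by
    let π : FiniteMeasure (X × X) := (∑ i, c i • (μ.restrict (A i)).map fun x => (x, y i))
      + ∑ i, e i • diracMass (y i, y i)
    have hm : ∀ i, Measurable fun x : X => (x, y i) := fun i =>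
      measurable_id.prodMk measurable_const
    have hfst : π.map Prod.fst = P + Q := by
      have h1 := map_add (FiniteMeasure.mapHom (measurable_fst (α := X) (β := X)))
        (∑ i, c i • (μ.restrict (A i)).map fun x => (x, y i)) (∑ i, e i • diracMass (y i, y i))
      simp only [map_sum, map_smul] at h1
      refine h1.trans ?_
      simp only [P, Q]
      congr 1
      · refine Finset.sum_congr rfl fun i _ => ?_
        congr 1
        apply Subtype.ext
        change (((μ.restrict (A i) : FiniteMeasure X) : Measure X).map _).map _ = _
        rw [Measure.map_map measurable_fst (hm i)]
        exact Measure.map_id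
      · refine Finset.sum_congr rfl fun i _ => ?_
        congr 1
        apply Subtype.ext
        exact Measure.map_dirac' measurable_fst _
    have hsnd : π.map Prod.snd = ∑ i, m i • diracMass (y i) := by
      have h1 := map_add (FiniteMeasure.mapHom (measurable_snd (α := X) (β := X)))
        (∑ i, c i • (μ.restrict (A i)).map fun x => (x, y i)) (∑ i, e i • diracMass (y i, y i))
      simp only [map_sum, map_smul] at h1
      refine h1.trans ?_
      rw [← Finset.sum_add_distrib]
      refine Finset.sum_congr rfl fun i _ => ?_
      have h2 : FiniteMeasure.mapHom (measurable_snd (α := X) (β := X))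
          ((μ.restrict (A i)).map fun x => (x, y i)) = μ (A i) • diracMass (y i) := by
        apply Subtype.ext
        change (((μ.restrict (A i) : FiniteMeasure X) : Measure X).map _).map _ = _
        rw [Measure.map_map measurable_snd (hm i)]
        change Measure.map (fun _ => y i) _ = (μ (A i)) • Measure.dirac (y i)
        rw [Measure.map_const]
        simp [ENNReal.smul_def]
      have h3 : FiniteMeasure.mapHom (measurable_snd (α := X) (β := X))
          (diracMass (y i, y i)) = diracMass (y i) := by
        apply Subtype.ext
        exact Measure.map_dirac' measurable_snd _
      rw [h2, h3, smul_smul, ← add_smul, hce]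
    refine iInf_le_of_le π (iInf_le_of_le hfst (iInf_le_of_le hsnd ?_))
    have hπ : (π : Measure (X × X)) =
        (∑ i, c i • ((μ : Measure X).restrict (A i)).map fun x => (x, y i))
          + ∑ i, e i • Measure.dirac (y i, y i) := by
      simp only [π]
      rw [FiniteMeasure.toMeasure_add, FiniteMeasure.toMeasure_sum, FiniteMeasure.toMeasure_sum]
      rfl
    rw [hπ, lintegral_add_measure, lintegral_finsetSum_measure, lintegral_finsetSum_measure]
    have h0 : ∀ i, ∫⁻ q, edist q.1 q.2 ^ 2 ∂(e i • Measure.dirac (y i, y i)) = 0 := fun i => by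
      have : ∫⁻ q, edist q.1 q.2 ^ 2 ∂(Measure.dirac (y i, y i)) ≤ 0 := by
        have hd : Measure.dirac (y i, y i) = (Measure.dirac (y i)).map fun x => (x, x) :=
          (Measure.map_dirac' (measurable_id.prodMk measurable_id) _).symm
        rw [hd]
        refine (lintegral_map_le _ _).trans ?_
        simp
      rw [lintegral_smul_measure, le_antisymm this bot_le, smul_zero]
    simp only [h0, Finset.sum_const_zero, add_zero]
    refine (Finset.sum_le_sum fun i _ => ?_).trans h.sum_lintegral_le
    rw [lintegral_smul_measure]
    calc c i • ∫⁻ q, edist q.1 q.2 ^ 2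
          ∂(((μ : Measure X).restrict (A i)).map fun x => (x, y i))
        ≤ c i • ∫⁻ x in A i, edist x (y i) ^ 2 ∂(μ : Measure X) := by
          gcongr; exact lintegral_map_le _ _
      _ ≤ (1 : ℝ≥0) • ∫⁻ x in A i, edist x (y i) ^ 2 ∂(μ : Measure X) := by
          gcongr; exact hc1 i
      _ = _ := one_smul _ _
  refine (iInf_le _ (P + Q)).trans (add_le_add hcost ?_)
  gcongr
  rw [show tvDist μ (P + Q) = tvDist (P + P') (P + Q) by rw [← hsplit]]
  refine (tvDist_add_add_le P P' Q).trans ?_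
  have hP' : (P' : Measure X) Set.univ =
      ∑ i, (((1 - c i) * μ (A i) : ℝ≥0) : ℝ≥0∞) + (μ : Measure X) (⋃ i, A i)ᶜ := by
    simp only [P']
    rw [FiniteMeasure.toMeasure_add, FiniteMeasure.toMeasure_sum, Measure.add_apply,
      Measure.finsetSum_apply]
    congr 1
    · refine Finset.sum_congr rfl fun i _ => ?_
      rw [FiniteMeasure.toMeasure_smul, ENNReal.coe_mul, hμA]
      simp [FiniteMeasure.restrict_measure_eq, ENNReal.smul_def]
    · simp [FiniteMeasure.restrict_measure_eq]
  have hQ : (Q : Measure X) Set.univ = ∑ i, (e i : ℝ≥0∞) := by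
    simp only [Q]
    rw [FiniteMeasure.toMeasure_sum, Measure.finsetSum_apply]
    refine Finset.sum_congr rfl fun i _ => ?_
    change (e i • Measure.dirac (y i)) Set.univ = _
    rw [Measure.smul_apply, Measure.dirac_apply_of_mem (Set.mem_univ _), ENNReal.smul_def,
      smul_eq_mul, mul_one]
  rw [hP', hQ, add_right_comm, ← Finset.sum_add_distrib, add_mul, one_mul]
  refine add_le_add ?_ h.compl_le
  calc ∑ i, ((((1 - c i) * μ (A i) : ℝ≥0) : ℝ≥0∞) + e i) ≤ ∑ _i : ι, b :=
        Finset.sum_le_sum fun i _ => by rw [← ENNReal.coe_add]; exact herr i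
    _ = Fintype.card ι * b := by simp

end Divergence


/-! ### Transformations of concentrated measures -/

namespace IsConcentrated

variable {X Y ι : Type*} [MeasurableSpace X] [MeasurableSpace Y] [Fintype ι]
  {m : ι → ℝ≥0} {A : ι → Set X} {a b : ℝ≥0∞}

theorem mono {μ : Measure X} {D : ι → X → ℝ≥0∞} (h : IsConcentrated μ m D A a b) {a' b' : ℝ≥0∞}
    (ha : a ≤ a') (hb : b ≤ b') : IsConcentrated μ m D A a' b' where
  measurableSet := h.measurableSet
  disjoint := h.disjoint
  sum_lintegral_le := h.sum_lintegral_le.trans ha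
  compl_le := h.compl_le.trans hb
  le_mass_add i := (h.le_mass_add i).trans (by gcongr)
  mass_le_add i := (h.mass_le_add i).trans (by gcongr)

theorem of_le_mul {μ : Measure X} {D D' : ι → X → ℝ≥0∞} (h : IsConcentrated μ m D A a b)
    {L : ℝ≥0∞} (hL : L ≠ ∞) (hD : ∀ i x, D' i x ≤ L * D i x) :
    IsConcentrated μ m D' A (L * a) b where
  measurableSet := h.measurableSet
  disjoint := h.disjoint
  sum_lintegral_le := by
    calc ∑ i, ∫⁻ x in A i, D' i x ∂μ ≤ ∑ i, L * ∫⁻ x in A i, D i x ∂μ := by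
          refine Finset.sum_le_sum fun i _ => ?_
          rw [← lintegral_const_mul' _ _ hL]
          exact lintegral_mono fun x => hD i x
      _ = L * ∑ i, ∫⁻ x in A i, D i x ∂μ := by rw [Finset.mul_sum]
      _ ≤ L * a := by gcongr; exact h.sum_lintegral_le
  compl_le := h.compl_le
  le_mass_add := h.le_mass_add
  mass_le_add := h.mass_le_add

/-- The equivalence, rather than one implication, is what moves concentration from one space to
another through a common law on the real line. -/
theorem map_iff {μ : Measure X} {f : X → Y} (hf : Measurable f) {D : ι → Y → ℝ≥0∞}
    (hD : ∀ i, Measurable (D i)) {B : ι → Set Y} (hB : ∀ i, MeasurableSet (B i))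
    (hdisj : Pairwise (Function.onFun Disjoint B)) :
    IsConcentrated (μ.map f) m D B a b ↔
      IsConcentrated μ m (fun i x => D i (f x)) (fun i => f ⁻¹' B i) a b := by
  have h1 : ∀ i, ∫⁻ y in B i, D i y ∂(μ.map f) = ∫⁻ x in f ⁻¹' B i, D i (f x) ∂μ := fun i =>
    setLIntegral_map (hB i) (hD i) hf
  have h2 : ∀ i, μ.map f (B i) = μ (f ⁻¹' B i) := fun i => Measure.map_apply hf (hB i)
  have h3 : μ.map f (⋃ i, B i)ᶜ = μ (⋃ i, f ⁻¹' B i)ᶜ := by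
    rw [Measure.map_apply hf (MeasurableSet.iUnion hB).compl, Set.preimage_compl,
      Set.preimage_iUnion]
  constructor
  · intro h
    refine ⟨fun i => hf (hB i), fun i j hij => (hdisj hij).preimage f, ?_, ?_, ?_, ?_⟩
    · simpa only [h1] using h.sum_lintegral_le
    · simpa only [h3] using h.compl_le
    · simpa only [h2] using h.le_mass_add
    · simpa only [h2] using h.mass_le_add
  · intro h
    refine ⟨hB, hdisj, ?_, ?_, ?_, ?_⟩
    · simpa only [h1] using h.sum_lintegral_le
    · simpa only [h3] using h.compl_le
    · simpa only [h2] using h.le_mass_add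
    · simpa only [h2] using h.mass_le_add

end IsConcentrated

theorem pairwise_disjoint_abs_sub_le {X ι : Type*} (φ : X → ℝ) {p : ι → ℝ} {ρ : ℝ}
    (hp : ∀ i j, i ≠ j → 2 * ρ < |p i - p j|) :
    Pairwise (Function.onFun Disjoint fun i => {x | |φ x - p i| ≤ ρ}) := by
  intro i j hij
  refine Set.disjoint_left.2 fun x hi hj => ?_
  have h1 : |φ x - p i| ≤ ρ := hi
  have h2 : |φ x - p j| ≤ ρ := hj
  have h3 := hp i j hij
  have h4 : |p i - p j| ≤ |φ x - p i| + |φ x - p j| := by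
    rw [abs_sub_comm (φ x) (p i)]
    exact abs_sub_le _ _ _
  linarith

/-! ### Concentration measured by scalar observables -/

section Observables

variable {X ι : Type*} [MeasurableSpace X] [Fintype ι]

/-- The squared distance of the observed value `φ x` to `p`. -/
noncomputable def sqDist (φ : X → ℝ) (p : ℝ) (x : X) : ℝ≥0∞ := ENNReal.ofReal ((φ x - p) ^ 2)

theorem measurable_sqDist {φ : X → ℝ} (hφ : Measurable φ) (p : ℝ) : Measurable (sqDist φ p) := by
  unfold sqDist; fun_prop

/-- Concentration with respect to an observable `φ` on arbitrary sets implies concentration on the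
sets `|φ - p i| ≤ ρ`. -/
theorem IsConcentrated.recenter {μ : Measure X} {m : ι → ℝ≥0} {φ : X → ℝ} (hφ : Measurable φ)
    {p : ι → ℝ} {A : ι → Set X} {a b : ℝ≥0∞}
    (h : IsConcentrated μ m (fun i => sqDist φ (p i)) A a b) {ρ : ℝ} (hρ : 0 < ρ)
    (hp : ∀ i j, i ≠ j → 2 * ρ < |p i - p j|) :
    IsConcentrated μ m (fun i => sqDist φ (p i)) (fun i => {x | |φ x - p i| ≤ ρ})
      (a + ENNReal.ofReal (ρ ^ 2) * b) (2 * b + a / ENNReal.ofReal (ρ ^ 2)) := by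
  classical
  have hBm : ∀ i, MeasurableSet {x | |φ x - p i| ≤ ρ} := fun i =>
    measurableSet_le (by fun_prop) measurable_const
  have hdisj := pairwise_disjoint_abs_sub_le φ hp
  have hU : MeasurableSet (⋃ i, A i) := MeasurableSet.iUnion h.measurableSet
  have hQ : ∀ i, Measurable (sqDist φ (p i)) := fun i => measurable_sqDist hφ _
  have hρ2 : ENNReal.ofReal (ρ ^ 2) ≠ 0 := by simpa using hρ.ne'
  -- The cost density for the old cells. A point of an old cell that disagrees with its new cell
  -- lies farther than `ρ` from its old target, so `G ≥ ρ ^ 2` there and Markov's inequality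
  -- applies.
  let G : X → ℝ≥0∞ := fun x => ∑ j, (A j).indicator (sqDist φ (p j)) x
  have hG : Measurable G :=
    Finset.measurable_sum _ fun j _ => (hQ j).indicator (h.measurableSet j)
  have hGle : ∫⁻ x, G x ∂μ ≤ a := by
    simp only [G]
    rw [lintegral_finsetSum _ fun j _ => (hQ j).indicator (h.measurableSet j)]
    refine le_trans (Finset.sum_le_sum fun j _ => ?_) h.sum_lintegral_le
    rw [lintegral_indicator (h.measurableSet j)]
  have hGj : ∀ {j x}, x ∈ A j → sqDist φ (p j) x ≤ G x := fun {j x} hx => by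
    have := Finset.single_le_sum (f := fun j => (A j).indicator (sqDist φ (p j)) x)
      (fun i _ => zero_le) (Finset.mem_univ j)
    simpa [Set.indicator_of_mem hx] using this
  have hlarge : ∀ {j x}, x ∉ {x | |φ x - p j| ≤ ρ} → ENNReal.ofReal (ρ ^ 2) ≤ sqDist φ (p j) x :=
    fun {j x} hx => by
      have hx' : ρ < |φ x - p j| := not_le.1 hx
      refine ENNReal.ofReal_le_ofReal ?_
      rw [← sq_abs (φ x - p j)]
      gcongr
  let F : Set X := {x | ENNReal.ofReal (ρ ^ 2) ≤ G x}
  have hF : μ F ≤ a / ENNReal.ofReal (ρ ^ 2) :=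
    (meas_ge_le_lintegral_div hG.aemeasurable hρ2 ENNReal.ofReal_ne_top).trans (by gcongr)
  have hE : μ ((⋃ i, A i)ᶜ ∪ F) ≤ b + a / ENNReal.ofReal (ρ ^ 2) :=
    (measure_union_le _ _).trans (add_le_add h.compl_le hF)
  have hBA : ∀ i, {x | |φ x - p i| ≤ ρ} ⊆ A i ∪ ((⋃ i, A i)ᶜ ∪ F) := fun i x hx => by
    by_cases hxU : x ∈ ⋃ i, A i
    · obtain ⟨j, hj⟩ := Set.mem_iUnion.1 hxU
      by_cases hij : i = j
      · subst hij; exact Or.inl hj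
      · exact Or.inr (Or.inr ((hlarge fun hx' =>
          (Set.disjoint_left.1 (hdisj hij) hx hx').elim).trans (hGj hj)))
    · exact Or.inr (Or.inl hxU)
  have hAB : ∀ i, A i ⊆ {x | |φ x - p i| ≤ ρ} ∪ ((⋃ i, A i)ᶜ ∪ F) := fun i x hx => by
    by_cases hxB : x ∈ {x | |φ x - p i| ≤ ρ}
    · exact Or.inl hxB
    · exact Or.inr (Or.inr ((hlarge hxB).trans (hGj hx)))
  refine ⟨hBm, hdisj, ?_, ?_, ?_, ?_⟩
  · have hsum : ∑ i, ∫⁻ x in {x | |φ x - p i| ≤ ρ}, sqDist φ (p i) x ∂μ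
        = ∫⁻ x, ∑ i, ({x | |φ x - p i| ≤ ρ}).indicator (sqDist φ (p i)) x ∂μ := by
      rw [lintegral_finsetSum _ fun j _ => (hQ j).indicator (hBm j)]
      exact Finset.sum_congr rfl fun i _ => (lintegral_indicator (hBm i) _).symm
    rw [hsum]
    calc ∫⁻ x, ∑ i, ({x | |φ x - p i| ≤ ρ}).indicator (sqDist φ (p i)) x ∂μ
        ≤ ∫⁻ x, (G x + (⋃ i, A i)ᶜ.indicator (fun _ => ENNReal.ofReal (ρ ^ 2)) x) ∂μ := by
          refine lintegral_mono fun x => ?_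
          by_cases hx : ∃ i, x ∈ {x | |φ x - p i| ≤ ρ}
          · obtain ⟨i, hi⟩ := hx
            rw [Finset.sum_eq_single i (fun j _ hji => Set.indicator_of_notMem
              (fun hj => Set.disjoint_left.1 (hdisj hji) hj hi) _) (by simp),
              Set.indicator_of_mem hi]
            have hsmall : sqDist φ (p i) x ≤ ENNReal.ofReal (ρ ^ 2) := by
              refine ENNReal.ofReal_le_ofReal ?_
              rw [← sq_abs (φ x - p i)]
              have : |φ x - p i| ≤ ρ := hi
              gcongr
            by_cases hxU : x ∈ ⋃ i, A i
            · obtain ⟨j, hj⟩ := Set.mem_iUnion.1 hxU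
              refine le_trans ?_ ((hGj hj).trans le_self_add)
              by_cases hij : i = j
              · rw [hij]
              · exact hsmall.trans (hlarge fun hx' => Set.disjoint_left.1 (hdisj hij) hi hx')
            · rw [Set.indicator_of_mem (show x ∈ (⋃ i, A i)ᶜ from hxU)]
              exact hsmall.trans le_add_self
          · rw [Finset.sum_eq_zero fun i _ => Set.indicator_of_notMem
              (fun hi => hx ⟨i, hi⟩) _]
            exact zero_le
      _ = ∫⁻ x, G x ∂μ + ENNReal.ofReal (ρ ^ 2) * μ (⋃ i, A i)ᶜ := by
          rw [lintegral_add_left hG, lintegral_indicator_const hU.compl]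
      _ ≤ _ := by gcongr; exact h.compl_le
  · refine le_trans (measure_mono (t := (⋃ i, A i)ᶜ ∪ F) fun x hx => ?_)
      (hE.trans (by gcongr; rw [two_mul]; exact le_self_add))
    by_contra hcon
    simp only [Set.mem_union, not_or] at hcon
    obtain ⟨j, hj⟩ := Set.mem_iUnion.1 (not_not.1 hcon.1)
    rcases hAB j hj with hj' | hj'
    · exact hx (Set.mem_iUnion.2 ⟨j, hj'⟩)
    · exact hj'.elim (fun hh => hcon.1 hh) (fun hh => hcon.2 hh)
  · intro i
    calc μ {x | |φ x - p i| ≤ ρ} ≤ μ (A i) + μ ((⋃ i, A i)ᶜ ∪ F) :=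
          (measure_mono (hBA i)).trans (measure_union_le _ _)
      _ ≤ (m i + b) + (b + a / ENNReal.ofReal (ρ ^ 2)) := add_le_add (h.le_mass_add i) hE
      _ = _ := by ring
  · intro i
    calc (m i : ℝ≥0∞) ≤ μ (A i) + b := h.mass_le_add i
      _ ≤ (μ {x | |φ x - p i| ≤ ρ} + μ ((⋃ i, A i)ᶜ ∪ F)) + b := by
          gcongr; exact (measure_mono (hAB i)).trans (measure_union_le _ _)
      _ ≤ (μ {x | |φ x - p i| ≤ ρ} + (b + a / ENNReal.ofReal (ρ ^ 2))) + b := by gcongr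
      _ = _ := by ring

theorem IsConcentrated.recenter_ofReal {μ : Measure X} {m : ι → ℝ≥0} {φ : X → ℝ}
    (hφ : Measurable φ) {p : ι → ℝ} {D : ι → X → ℝ≥0∞} {A : ι → Set X} {a b L : ℝ} (ha : 0 ≤ a)
    (hb : 0 ≤ b) (hL : 0 ≤ L)
    (h : IsConcentrated μ m D A (ENNReal.ofReal a) (ENNReal.ofReal b))
    (hD : ∀ i x, sqDist φ (p i) x ≤ ENNReal.ofReal L * D i x) {ρ : ℝ} (hρ : 0 < ρ)
    (hp : ∀ i j, i ≠ j → 2 * ρ < |p i - p j|) {a' b' : ℝ} (ha' : L * a + ρ ^ 2 * b ≤ a')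
    (hb' : 2 * b + L * a / ρ ^ 2 ≤ b') :
    IsConcentrated μ m (fun i => sqDist φ (p i)) (fun i => {x | |φ x - p i| ≤ ρ})
      (ENNReal.ofReal a') (ENNReal.ofReal b') := by
  refine ((h.of_le_mul ENNReal.ofReal_ne_top hD).recenter hφ hρ hp).mono ?_ ?_
  · rw [← ENNReal.ofReal_mul hL, ← ENNReal.ofReal_mul (by positivity),
      ← ENNReal.ofReal_add (by positivity) (by positivity)]
    exact ENNReal.ofReal_le_ofReal ha'
  · have h2 : (2 : ℝ≥0∞) = ENNReal.ofReal 2 := by simp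
    rw [← ENNReal.ofReal_mul hL, ← ENNReal.ofReal_div_of_pos (by positivity), h2,
      ← ENNReal.ofReal_mul (by norm_num), ← ENNReal.ofReal_add (by positivity) (by positivity)]
    exact ENNReal.ofReal_le_ofReal hb'

/-- Concentration with respect to an observable only depends on its distribution. -/
theorem IsConcentrated.of_map_eq {Y : Type*} [MeasurableSpace Y] {μ : Measure X} {ν : Measure Y}
    {m : ι → ℝ≥0} {φ : X → ℝ} {ψ : Y → ℝ} (hφ : Measurable φ) (hψ : Measurable ψ)
    (hμν : μ.map φ = ν.map ψ) {p : ι → ℝ} {ρ : ℝ} (hp : ∀ i j, i ≠ j → 2 * ρ < |p i - p j|)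
    {a b : ℝ≥0∞}
    (h : IsConcentrated μ m (fun i => sqDist φ (p i)) (fun i => {x | |φ x - p i| ≤ ρ}) a b) :
    IsConcentrated ν m (fun i => sqDist ψ (p i)) (fun i => {x | |ψ x - p i| ≤ ρ}) a b := by
  have hm : ∀ i, MeasurableSet {s : ℝ | |id s - p i| ≤ ρ} := fun i =>
    measurableSet_le (by fun_prop) measurable_const
  have hd := pairwise_disjoint_abs_sub_le (id : ℝ → ℝ) hp
  have h1 : IsConcentrated (μ.map φ) m (fun i => sqDist id (p i))
      (fun i => {s : ℝ | |id s - p i| ≤ ρ}) a b :=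
    (IsConcentrated.map_iff hφ (fun i => measurable_sqDist measurable_id _) hm hd).2 h
  rw [hμν] at h1
  exact (IsConcentrated.map_iff hψ (fun i => measurable_sqDist measurable_id _) hm hd).1 h1

/-- Concentration with respect to finitely many observables which jointly determine the target
implies concentration with respect to these jointly. -/
theorem IsConcentrated.of_observables {κ : Type*} [Fintype κ] [Nonempty κ] {μ : Measure X}
    {m : ι → ℝ≥0} {φ : κ → X → ℝ} {p : κ → ι → ℝ} {ρ : ℝ} {a b : ℝ≥0∞}
    (h : ∀ k, IsConcentrated μ m (fun i => sqDist (φ k) (p k i))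
      (fun i => {x | |φ k x - p k i| ≤ ρ}) a b)
    (hφ : ∀ k, Measurable (φ k))
    (hcomb : ∀ (x : X) (i : κ → ι), (∀ k, |φ k x - p k (i k)| ≤ ρ) → ∃ j, ∀ k, i k = j)
    {D : ι → X → ℝ≥0∞} {c : ℝ≥0∞} (hc : c ≠ ∞)
    (hD : ∀ i x, D i x ≤ c * ∑ k, sqDist (φ k) (p k i) x) :
    IsConcentrated μ m D (fun i => ⋂ k, {x | |φ k x - p k i| ≤ ρ})
      (c * Fintype.card κ * a) ((Fintype.card κ + 1) * b) := by
  classical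
  let B : κ → ι → Set X := fun k i => {x | |φ k x - p k i| ≤ ρ}
  have hsub : ∀ k i, (⋂ k, B k i) ⊆ B k i := fun k i => Set.iInter_subset _ k
  have hE : μ (⋃ k, (⋃ i, B k i)ᶜ) ≤ Fintype.card κ * b := by
    refine (measure_iUnion_fintype_le _ _).trans ?_
    calc ∑ k, μ (⋃ i, B k i)ᶜ ≤ ∑ _k : κ, b := Finset.sum_le_sum fun k _ => (h k).compl_le
      _ = _ := by simp
  -- Outside all exceptional sets every observable assigns an index to the point, and `hcomb` makes
  -- these indices agree.
  have hcov : ∀ x, x ∉ ⋃ k, (⋃ i, B k i)ᶜ → ∃ j, ∀ k, x ∈ B k j := fun x hx => by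
    simp only [Set.mem_iUnion, Set.mem_compl_iff, not_exists, not_forall, not_not] at hx
    choose i hi using hx
    obtain ⟨j, hj⟩ := hcomb x i hi
    exact ⟨j, fun k => by rw [← hj k]; exact hi k⟩
  let k₀ : κ := Classical.arbitrary κ
  have hcard : (Fintype.card κ : ℝ≥0∞) * b ≤ (Fintype.card κ + 1) * b := by
    gcongr; exact le_self_add
  refine ⟨fun i => MeasurableSet.iInter fun k => (h k).measurableSet i,
    fun i j hij => ((h k₀).disjoint hij).mono (hsub k₀ i) (hsub k₀ j), ?_, ?_, ?_, ?_⟩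
  · calc ∑ i, ∫⁻ x in ⋂ k, B k i, D i x ∂μ
        ≤ ∑ i, c * ∑ k, ∫⁻ x in B k i, sqDist (φ k) (p k i) x ∂μ := by
          refine Finset.sum_le_sum fun i _ => ?_
          refine (lintegral_mono fun x => hD i x).trans ?_
          rw [lintegral_const_mul' _ _ hc,
            lintegral_finsetSum _ fun k _ => measurable_sqDist (hφ k) _]
          gcongr with k
          exact hsub k i
      _ = c * ∑ k, ∑ i, ∫⁻ x in B k i, sqDist (φ k) (p k i) x ∂μ := by
          rw [← Finset.mul_sum, Finset.sum_comm]
      _ ≤ c * ∑ _k : κ, a := by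
          gcongr with k
          exact (h k).sum_lintegral_le
      _ = _ := by simp [mul_assoc]
  · refine (measure_mono (t := ⋃ k, (⋃ i, B k i)ᶜ) fun x hx => ?_).trans (hE.trans hcard)
    by_contra hcon
    obtain ⟨j, hj⟩ := hcov x hcon
    exact hx (Set.mem_iUnion.2 ⟨j, Set.mem_iInter.2 hj⟩)
  · intro i
    calc μ (⋂ k, B k i) ≤ μ (B k₀ i) := measure_mono (hsub k₀ i)
      _ ≤ m i + b := (h k₀).le_mass_add i
      _ ≤ _ := by gcongr; rw [add_mul, one_mul]; exact le_add_self
  · intro i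
    have hBi : B k₀ i ⊆ (⋂ k, B k i) ∪ ⋃ k, (⋃ i, B k i)ᶜ := fun x hx => by
      by_cases hx' : x ∈ ⋃ k, (⋃ i, B k i)ᶜ
      · exact Or.inr hx'
      · obtain ⟨j, hj⟩ := hcov x hx'
        have hij : i = j := by
          by_contra hij
          exact Set.disjoint_left.1 ((h k₀).disjoint hij) hx (hj k₀)
        subst hij
        exact Or.inl (Set.mem_iInter.2 hj)
    calc (m i : ℝ≥0∞) ≤ μ (B k₀ i) + b := (h k₀).mass_le_add i
      _ ≤ (μ (⋂ k, B k i) + Fintype.card κ * b) + b := by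
          gcongr
          exact (measure_mono hBi).trans ((measure_union_le _ _).trans (by gcongr))
      _ = _ := by ring

end Observables

theorem unbalancedWasserstein_zeroExt_le {X ι : Type*} [PseudoEMetricSpace X] [MeasurableSpace X]
    [OpensMeasurableSpace X] [Fintype ι] {p : X → Prop} (hp : MeasurableSet {x | p x})
    {μ : FiniteMeasure (Subtype p)} {m : ι → ℝ≥0} {y : ι → X} {A : ι → Set (Subtype p)} {a b : ℝ}
    (ha : 0 ≤ a) (hb : 0 ≤ b)
    (h : IsConcentrated (μ : Measure (Subtype p)) m (fun i x => edist (x : X) (y i) ^ 2) A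
      (ENNReal.ofReal a) (ENNReal.ofReal b)) (R : ℝ) :
    unbalancedWasserstein R (zeroExt μ) (∑ i, m i • diracMass (y i)) ≤
      ENNReal.ofReal (a + R ^ 2 / 2 * ((Fintype.card ι + 1) * b)) := by
  have hpre : (fun i => Subtype.val ⁻¹' (Subtype.val '' A i)) = A :=
    funext fun i => Set.preimage_image_eq _ Subtype.val_injective
  have hz : IsConcentrated (zeroExt μ : Measure X) m (fun i x => edist x (y i) ^ 2)
      (fun i => Subtype.val '' A i) (ENNReal.ofReal a) (ENNReal.ofReal b) := by
    refine (IsConcentrated.map_iff measurable_subtype_coe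
      (fun i => (measurable_edist_left (x := y i)).pow_const 2)
      (fun i => hp.subtype_image (h.measurableSet i)) fun i j hij =>
        (Set.disjoint_image_iff Subtype.val_injective).2 (h.disjoint hij)).2 ?_
    exact (congrArg (fun B => IsConcentrated (μ : Measure (Subtype p)) m
      (fun i x => edist (x : X) (y i) ^ 2) B _ _) hpre).mpr h
  refine (unbalancedWasserstein_le_of_isConcentrated R hz).trans (le_of_eq ?_)
  rw [ENNReal.ofReal_add ha (by positivity), ENNReal.ofReal_mul (by positivity),
    ENNReal.ofReal_mul (by positivity), ENNReal.ofReal_add (by positivity) (by norm_num)]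
  simp


/-! ### Reconstruction from a single snapshot -/

theorem integral_sum_smul_diracMass {X ι : Type*} [TopologicalSpace X] [CompactSpace X]
    [MeasurableSpace X] [BorelSpace X] [Fintype ι]
    (m : ι → ℝ≥0) (x : ι → X) (g : C(X, ℝ)) :
    ∫ y, g y ∂((∑ i, m i • diracMass (x i) : FiniteMeasure X) : Measure X) =
      ∑ i, (m i : ℝ) * g (x i) := by
  have h : ((∑ i, m i • diracMass (x i) : FiniteMeasure X) : Measure X) =
      ∑ i, m i • Measure.dirac (x i) := by
    rw [FiniteMeasure.toMeasure_sum]; rfl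
  have hg : ∀ i, Integrable g (Measure.dirac (x i)) := fun i =>
    BoundedContinuousFunction.integrable _ (BoundedContinuousFunction.mkOfCompact g)
  rw [h, integral_finsetSum_measure fun i _ => (hg i).smul_measure_nnreal]
  refine Finset.sum_congr rfl fun i _ => ?_
  rw [integral_smul_nnreal_measure,
    integral_dirac' _ _ g.continuous.stronglyMeasurable]
  rfl

theorem inner_observe {X H : Type*} [TopologicalSpace X] [CompactSpace X] [MeasurableSpace X]
    [BorelSpace X] [NormedAddCommGroup H] [InnerProductSpace ℝ H] [CompleteSpace H]
    (A : H →L[ℝ] C(X, ℝ)) (μ : FiniteMeasure X) (w : H) :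
    ⟪observe A μ, w⟫_ℝ = ∫ y, A w y ∂(μ : Measure X) := by
  unfold observe
  rw [InnerProductSpace.toDual_symm_apply]
  rfl

section Certificate

variable {X H : Type*} [MetricSpace X] [CompactSpace X] [MeasurableSpace X]
  [BorelSpace X] [NormedAddCommGroup H] [InnerProductSpace ℝ H] [CompleteSpace H]

theorem integrable_continuousMap (μ : FiniteMeasure X) (g : C(X, ℝ)) :
    Integrable g (μ : Measure X) :=
  BoundedContinuousFunction.integrable _ (BoundedContinuousFunction.mkOfCompact g)

/-- The Bregman distance estimate: an almost minimizer `u` is almost calibrated by the dual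
certificate `v` of the discrete measure `∑ i, m i • δ_{x i}`. -/
theorem integral_one_add_le_of_certificate {n : ℕ} {m : Fin n → ℝ≥0} {x : Fin n → X}
    {A : H →L[ℝ] C(X, ℝ)} {v f : H} {u ν : FiniteMeasure X} (hν : ν = ∑ i, m i • diracMass (x i))
    (hv : ∀ i, A v (x i) = -1) {ε q : ℝ} (hε : 0 ≤ ε) (hq : 0 ≤ q)
    (hf : ‖f - observe A ν‖ ^ 2 ≤ 2 * ε ^ 2) (hu : ‖observe A u - f‖ ^ 2 ≤ 2 * ε * q)
    (hmass : (u.mass : ℝ) + q ≤ ν.mass + ε) :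
    ∫ y, (1 + A v y) ∂(u : Measure X) + q / 2 ≤ ε * (1 + ‖v‖) ^ 2 := by
  have hint : ∀ μ : FiniteMeasure X,
      ∫ y, (1 + A v y) ∂(μ : Measure X) = μ.mass + ⟪observe A μ, v⟫_ℝ := fun μ => by
    rw [integral_add (integrable_const _) (integrable_continuousMap μ _), inner_observe]
    simp [FiniteMeasure.mass]
  have h0 : (ν.mass : ℝ) + ⟪observe A ν, v⟫_ℝ = 0 := by
    rw [← hint ν, hν]
    have := integral_sum_smul_diracMass m x (1 + A v)
    simp only [ContinuousMap.add_apply, ContinuousMap.one_apply] at this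
    rw [this]
    exact Finset.sum_eq_zero fun i _ => by rw [hv i]; ring
  have hsplit : ⟪observe A u, v⟫_ℝ = ⟪observe A ν, v⟫_ℝ + ⟪observe A u - f, v⟫_ℝ
      + ⟪f - observe A ν, v⟫_ℝ := by
    simp only [inner_sub_left]; ring
  have h1 : ⟪observe A u - f, v⟫_ℝ ≤ ‖observe A u - f‖ * ‖v‖ := real_inner_le_norm _ _
  have h2 : ⟪f - observe A ν, v⟫_ℝ ≤ ‖f - observe A ν‖ * ‖v‖ := real_inner_le_norm _ _
  -- The factor `√2` is enlarged to `2` so that the terms add up to the square `(1 + ‖v‖) ^ 2`.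
  have h3 : ‖f - observe A ν‖ ≤ 2 * ε := by
    refine abs_le_of_sq_le_sq' ?_ (by positivity) |>.2
    nlinarith
  -- Young's inequality: the share `q / 2` is absorbed by the gain `-q` in the mass inequality, and
  -- the other half of `q` survives in the conclusion.
  have h4 : ‖observe A u - f‖ * ‖v‖ ≤ ε * ‖v‖ ^ 2 + q / 2 := by
    refine abs_le_of_sq_le_sq' ?_ (by positivity) |>.2
    rw [mul_pow]
    calc ‖observe A u - f‖ ^ 2 * ‖v‖ ^ 2 ≤ 2 * ε * q * ‖v‖ ^ 2 := by gcongr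
      _ ≤ (ε * ‖v‖ ^ 2 + q / 2) ^ 2 := by nlinarith [sq_nonneg (ε * ‖v‖ ^ 2 - q / 2)]
  have h5 : ‖f - observe A ν‖ * ‖v‖ ≤ 2 * ε * ‖v‖ := by gcongr
  rw [hint u, hsplit]
  nlinarith

-- The nonnegative function `W = 1 + Ob^* v` has integral `O(ε)` against `u`. It dominates the
-- squared distance near the points and a positive constant away from them, which controls transport
-- cost and stray mass. Masses are compared by testing with a certificate `-Ob^* vs` close to `±1`
-- on each ball, the signs being those of the mass errors, so that the errors add up without
-- cancellation.
set_option maxHeartbeats 800000 in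
theorem IsReconstructible.exists_isConcentrated {A : H →L[ℝ] C(X, ℝ)} {ν : FiniteMeasure X}
    (h : IsReconstructible A ν) :
    ∃ (n : ℕ) (m : Fin n → ℝ≥0) (x : Fin n → X), (∀ i, 0 < m i) ∧ Function.Injective x ∧
      ν = ∑ i, m i • diracMass (x i) ∧ ∃ r C : ℝ, 0 < C ∧
      ∀ (u : FiniteMeasure X) (f : H) (ε q : ℝ), 0 ≤ ε → 0 ≤ q →
        ‖f - observe A ν‖ ^ 2 ≤ 2 * ε ^ 2 → ‖observe A u - f‖ ^ 2 ≤ 2 * ε * q →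
        (u.mass : ℝ) + q ≤ ν.mass + ε →
        IsConcentrated (u : Measure X) m (fun i y => edist y (x i) ^ 2)
          (fun i => Metric.ball (x i) r) (ENNReal.ofReal (C * ε)) (ENNReal.ofReal (C * ε)) := by
  classical
  obtain ⟨n, m, x, hm, hx, hν, κ, μ, R, hκ, hμ, hR, hsep, hcert⟩ := h
  refine ⟨n, m, x, hm, hx, hν, R / 2, ?_⟩
  let sg : (Fin n → Bool) → Fin n → ℝ := fun σ i => if σ i then 1 else -1
  have hsg : ∀ σ i, sg σ i = -1 ∨ sg σ i = 1 := fun σ i => by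
    by_cases hσ : σ i <;> simp [sg, hσ]
  choose v vs hv hvs hgrow hquad using fun σ => hcert (sg σ) (hsg σ)
  -- The sign pattern will depend on `u`; summing over all patterns makes the constants independent
  -- of it.
  let V : ℝ := ∑ σ, (‖v σ‖ + ‖vs σ‖)
  have hV : ∀ σ, ‖v σ‖ + ‖vs σ‖ ≤ V := fun σ =>
    Finset.single_le_sum (f := fun σ => ‖v σ‖ + ‖vs σ‖) (fun _ _ => by positivity)
      (Finset.mem_univ σ)
  have hV0 : 0 ≤ V := (by positivity : 0 ≤ ‖v fun _ => true‖ + ‖vs fun _ => true‖).trans (hV _)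
  let c : ℝ := (1 + V) ^ 2
  -- Both defects of a sign certificate are multiples of `W`: `μ * dist ^ 2 ≤ (μ / κ) * W` on the
  -- balls, and `1 ≤ 4 / (κ * R ^ 2) * W` off them.
  let K : ℝ := μ / κ + 4 / (κ * R ^ 2)
  refine ⟨1 + c / κ + 4 * c / (κ * R ^ 2) + V * (1 + c + 2) + K * c, by positivity, ?_⟩
  intro u f ε q hε hq hf hu hmass
  set C : ℝ := 1 + c / κ + 4 * c / (κ * R ^ 2) + V * (1 + c + 2) + K * c with hC
  clear_value C
  have hdisj : Pairwise (Function.onFun Disjoint fun i => Metric.ball (x i) (R / 2)) :=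
    fun i j hij => Metric.ball_disjoint_ball (by linarith [hsep i j hij])
  have hCε : ∀ {k : ℝ}, k ≤ C → ENNReal.ofReal (k * ε) ≤ ENNReal.ofReal (C * ε) := fun hk =>
    ENNReal.ofReal_le_ofReal (by gcongr)
  -- Without points `Metric.infDist` is `0` by default and the growth condition says nothing, but
  -- then the mass inequality alone bounds `u`.
  rcases Nat.eq_zero_or_pos n with hn | hn
  · subst hn
    have hν0 : ν = 0 := by simpa using hν
    refine ⟨fun i => i.elim0, fun i => i.elim0, by simp, ?_, fun i => i.elim0, fun i => i.elim0⟩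
    have h1 : (u.mass : ℝ) ≤ 1 * ε := by
      have : (ν.mass : ℝ) = 0 := by rw [hν0]; simp
      linarith
    have h2 : (u : Measure X) (⋃ i, Metric.ball (x i) (R / 2))ᶜ = ENNReal.ofReal u.mass := by
      simp [FiniteMeasure.ennreal_mass]
    rw [h2]
    refine (ENNReal.ofReal_le_ofReal h1).trans (hCε ?_)
    rw [hC]
    have : 0 ≤ c / κ + 4 * c / (κ * R ^ 2) + V * (1 + c + 2) + K * c := by positivity
    linarith
  have : Nonempty (Fin n) := ⟨⟨0, hn⟩⟩
  let U : Fin n → ℝ := fun i => (u : Measure X).real (Metric.ball (x i) (R / 2))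
  -- The signs of the mass errors, so that the signed errors are the absolute ones.
  let σ : Fin n → Bool := fun i => decide ((m i : ℝ) ≤ U i)
  have hσ : ∀ i, sg σ i * (U i - m i) = |U i - m i| := fun i => by
    by_cases hi : (m i : ℝ) ≤ U i
    · simp [sg, σ, hi, abs_of_nonneg (sub_nonneg.2 hi)]
    · simp [sg, σ, hi, abs_of_neg (sub_neg.2 (not_le.1 hi))]
  have hvx : ∀ i, A (v σ) (x i) = -1 := fun i => by
    have := (hv σ).2 i
    rw [Real.sign_of_pos (by exact_mod_cast hm i)] at this
    simp only [ContinuousMap.neg_apply] at this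
    linarith
  have hvV : ‖v σ‖ ≤ V := by linarith [hV σ, norm_nonneg (vs σ)]
  have hvsV : ‖vs σ‖ ≤ V := by linarith [hV σ, norm_nonneg (v σ)]
  let W : X → ℝ := fun y => 1 + A (v σ) y
  have hWi : Integrable W (u : Measure X) :=
    (integrable_const _).add (integrable_continuousMap u _)
  have hW0 : ∀ y, 0 ≤ W y := fun y => by
    have := (abs_le.1 ((hv σ).1 y)).2
    simp only [ContinuousMap.neg_apply] at this
    simp only [W]; linarith
  have hWg : ∀ y, κ * min R (Metric.infDist y (Set.range x)) ^ 2 ≤ W y := fun y => by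
    have := hgrow σ y
    simp only [W]; linarith
  have hWball : ∀ i, ∀ y ∈ Metric.ball (x i) (R / 2), κ * dist y (x i) ^ 2 ≤ W y := by
    intro i y hy
    have hy' : dist y (x i) < R / 2 := hy
    refine le_trans ?_ (hWg y)
    have : dist y (x i) ≤ min R (Metric.infDist y (Set.range x)) := by
      refine le_min (by linarith) ((Metric.le_infDist (Set.range_nonempty x)).2 ?_)
      rintro _ ⟨j, rfl⟩
      by_cases hij : i = j
      · rw [hij]
      · have := hsep i j hij
        have := dist_triangle_left (x i) (x j) y
        linarith
    gcongr
  have hWrest : ∀ y ∈ (⋃ i, Metric.ball (x i) (R / 2))ᶜ, κ * R ^ 2 / 4 ≤ W y := by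
    intro y hy
    refine le_trans ?_ (hWg y)
    have : R / 2 ≤ min R (Metric.infDist y (Set.range x)) := by
      refine le_min (by linarith) ((Metric.le_infDist (Set.range_nonempty x)).2 ?_)
      rintro _ ⟨j, rfl⟩
      by_contra hcon
      exact hy (Set.mem_iUnion.2 ⟨j, not_le.1 hcon⟩)
    calc κ * R ^ 2 / 4 = κ * (R / 2) ^ 2 := by ring
      _ ≤ _ := by gcongr
  have hc1 : (1 + ‖v σ‖) ^ 2 ≤ c := by simp only [c]; gcongr
  have hbreg := integral_one_add_le_of_certificate hν hvx hε hq hf hu hmass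
  have hWint0 : 0 ≤ ∫ y, W y ∂(u : Measure X) := integral_nonneg hW0
  have hεc : ε * (1 + ‖v σ‖) ^ 2 ≤ c * ε := by rw [mul_comm]; gcongr
  have hWint : ∫ y, W y ∂(u : Measure X) ≤ c * ε := by
    change ∫ y, W y ∂(u : Measure X) + q / 2 ≤ _ at hbreg
    linarith
  have hqc : q ≤ 2 * (c * ε) := by
    change ∫ y, W y ∂(u : Measure X) + q / 2 ≤ _ at hbreg
    linarith
  have hlW : ∫⁻ y, ENNReal.ofReal (W y) ∂(u : Measure X) ≤ ENNReal.ofReal (c * ε) := by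
    rw [← ofReal_integral_eq_lintegral_ofReal hWi (Filter.Eventually.of_forall hW0)]
    exact ENNReal.ofReal_le_ofReal hWint
  have hmasses : ∑ i, |U i - m i| ≤ (V * (1 + c + 2) + K * c) * ε := by
    let g : X → ℝ := fun y => -(A (vs σ) y)
    have hgi : Integrable g (u : Measure X) := (integrable_continuousMap u _).neg
    have hg1 : ∀ y, -1 ≤ g y := fun y => (abs_le.1 ((hvs σ).1 y)).1
    have hgx : ∀ i, g (x i) = sg σ i := fun i => by
      have := (hvs σ).2 i
      simp only [ContinuousMap.neg_apply] at this
      rw [show g (x i) = -(A (vs σ) (x i)) from rfl, this]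
      rcases hsg σ i with h | h
      · rw [h, Real.sign_of_neg (by norm_num)]
      · rw [h, Real.sign_one]
    -- For sign `+1` this uses the quadratic bound, for sign `-1` and off the balls only `g ≥ -1`.
    -- Integrated against `u` and compared with the exact identity for `ν`, it bounds the sum of the
    -- mass errors.
    have hpt : ∀ y, ∑ i, (Metric.ball (x i) (R / 2)).indicator (fun _ => sg σ i) y - K * W y
        ≤ g y := by
      intro y
      by_cases hy : y ∈ ⋃ i, Metric.ball (x i) (R / 2)
      · obtain ⟨i, hi⟩ := Set.mem_iUnion.1 hy
        rw [Finset.sum_eq_single i (fun j _ hji => Set.indicator_of_notMem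
          (fun hj => Set.disjoint_left.1 (hdisj hji) hj hi) _) (by simp),
          Set.indicator_of_mem hi]
        have h1 := hquad σ i y (Metric.ball_subset_ball (by linarith) hi)
        have h2 : sg σ i * g y ≥ 1 - μ * dist y (x i) ^ 2 := by
          rw [← hgx i]; simp only [g]; linarith
        have h3 : μ * dist y (x i) ^ 2 ≤ μ / κ * W y := by
          rw [div_mul_eq_mul_div, le_div_iff₀ hκ]
          nlinarith [hWball i y hi]
        have h4 : μ / κ * W y ≤ K * W y := by
          refine mul_le_mul_of_nonneg_right ?_ (hW0 y)
          have : 0 ≤ 4 / (κ * R ^ 2) := by positivity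
          simp only [K]; linarith
        have h5 : 0 ≤ K * W y := mul_nonneg (by positivity) (hW0 y)
        rcases hsg σ i with h | h <;> rw [h] at h2 ⊢
        · linarith [hg1 y]
        · linarith
      · rw [Finset.sum_eq_zero fun i _ => Set.indicator_of_notMem
          (fun hi => hy (Set.mem_iUnion.2 ⟨i, hi⟩)) _]
        have h1 := hWrest y hy
        have h2 : 1 ≤ 4 / (κ * R ^ 2) * W y := by
          rw [div_mul_eq_mul_div, le_div_iff₀ (by positivity)]
          linarith
        have h3 : 0 ≤ μ / κ * W y := mul_nonneg (by positivity) (hW0 y)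
        have h4 : K * W y = μ / κ * W y + 4 / (κ * R ^ 2) * W y := by simp only [K]; ring
        linarith [hg1 y]
    have hind : ∀ i, Integrable ((Metric.ball (x i) (R / 2)).indicator fun _ => sg σ i)
        (u : Measure X) := fun i =>
      (integrable_const _).indicator Metric.isOpen_ball.measurableSet
    have hlow : ∑ i, sg σ i * U i - K * ∫ y, W y ∂(u : Measure X) ≤ ∫ y, g y ∂(u : Measure X) := by
      have := integral_mono ((integrable_finsetSum Finset.univ fun i _ => hind i).sub
        (hWi.const_mul K)) hgi (fun y => by simpa [Finset.sum_apply] using hpt y)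
      refine le_trans (le_of_eq ?_) this
      simp only [Pi.sub_apply]
      rw [integral_sub (integrable_finsetSum Finset.univ fun i _ => hind i) (hWi.const_mul K),
        integral_const_mul, integral_finsetSum _ fun i _ => hind i]
      congr 1
      refine Finset.sum_congr rfl fun i _ => ?_
      rw [integral_indicator_const _ Metric.isOpen_ball.measurableSet, smul_eq_mul, mul_comm]
    have hgu : ∫ y, g y ∂(u : Measure X) = -⟪observe A u, vs σ⟫_ℝ := by
      rw [inner_observe, integral_neg]
    have hgν : ∑ i, sg σ i * m i = -⟪observe A ν, vs σ⟫_ℝ := by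
      rw [inner_observe, hν, integral_sum_smul_diracMass, ← Finset.sum_neg_distrib]
      refine Finset.sum_congr rfl fun i _ => ?_
      rw [← hgx i]; simp only [g]; ring
    have hr : ‖observe A u - f‖ ≤ (1 + c) * ε := by
      refine abs_le_of_sq_le_sq' ?_ (by positivity) |>.2
      calc ‖observe A u - f‖ ^ 2 ≤ 2 * ε * q := hu
        _ ≤ 2 * ε * (2 * (c * ε)) := by gcongr
        _ ≤ ((1 + c) * ε) ^ 2 := by nlinarith [sq_nonneg ((1 - c) * ε)]
    have hf' : ‖f - observe A ν‖ ≤ 2 * ε := by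
      refine abs_le_of_sq_le_sq' ?_ (by positivity) |>.2
      nlinarith
    have hdiff : ⟪observe A ν, vs σ⟫_ℝ - ⟪observe A u, vs σ⟫_ℝ ≤ V * (1 + c + 2) * ε := by
      have h1 : ‖observe A ν - observe A u‖ ≤ (1 + c + 2) * ε := by
        have h2 : observe A ν - observe A u
            = -((observe A u - f) + (f - observe A ν)) := by abel
        rw [h2, norm_neg]
        refine (norm_add_le _ _).trans ?_
        linarith
      rw [← inner_sub_left]
      refine (real_inner_le_norm _ _).trans ?_
      calc ‖observe A ν - observe A u‖ * ‖vs σ‖ ≤ ((1 + c + 2) * ε) * V := by gcongr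
        _ = _ := by ring
    have hKW : K * ∫ y, W y ∂(u : Measure X) ≤ K * (c * ε) := by gcongr
    have hsum : ∑ i, |U i - m i| = ∑ i, sg σ i * U i - ∑ i, sg σ i * m i := by
      rw [← Finset.sum_sub_distrib]
      exact Finset.sum_congr rfl fun i _ => by rw [← hσ i]; ring
    rw [hsum]
    linarith
  have hmass_i : ∀ i, |U i - m i| ≤ C * ε := fun i => by
    refine (Finset.single_le_sum (f := fun i => |U i - m i|) (fun _ _ => abs_nonneg _)
      (Finset.mem_univ i)).trans (hmasses.trans ?_)
    refine mul_le_mul_of_nonneg_right ?_ hε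
    have : 0 ≤ 1 + c / κ + 4 * c / (κ * R ^ 2) := by positivity
    rw [hC]; linarith
  have hU : ∀ i, (u : Measure X) (Metric.ball (x i) (R / 2)) = ENNReal.ofReal (U i) := fun i => by
    simp only [U]; rw [ofReal_measureReal]
  have hCε0 : 0 ≤ C * ε := (abs_nonneg _).trans (hmass_i (Classical.arbitrary _))
  refine ⟨fun i => Metric.isOpen_ball.measurableSet, hdisj, ?_, ?_, ?_, ?_⟩
  · calc ∑ i, ∫⁻ y in Metric.ball (x i) (R / 2), edist y (x i) ^ 2 ∂(u : Measure X)
        ≤ ∑ i, ∫⁻ y in Metric.ball (x i) (R / 2),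
            ENNReal.ofReal (1 / κ) * ENNReal.ofReal (W y) ∂(u : Measure X) := by
          refine Finset.sum_le_sum fun i _ =>
            setLIntegral_mono' Metric.isOpen_ball.measurableSet fun y hy => ?_
          rw [edist_dist, ← ENNReal.ofReal_pow dist_nonneg, ← ENNReal.ofReal_mul (by positivity)]
          refine ENNReal.ofReal_le_ofReal ?_
          rw [div_mul_eq_mul_div, le_div_iff₀ hκ]
          linarith [hWball i y hy]
      _ = ∫⁻ y in ⋃ i, Metric.ball (x i) (R / 2),
            ENNReal.ofReal (1 / κ) * ENNReal.ofReal (W y) ∂(u : Measure X) := by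
          rw [lintegral_iUnion (fun i => Metric.isOpen_ball.measurableSet) hdisj, tsum_fintype]
      _ ≤ ∫⁻ y, ENNReal.ofReal (1 / κ) * ENNReal.ofReal (W y) ∂(u : Measure X) :=
          setLIntegral_le_lintegral _ _
      _ = ENNReal.ofReal (1 / κ) * ∫⁻ y, ENNReal.ofReal (W y) ∂(u : Measure X) :=
          lintegral_const_mul' _ _ ENNReal.ofReal_ne_top
      _ ≤ ENNReal.ofReal (1 / κ) * ENNReal.ofReal (c * ε) := by gcongr
      _ = ENNReal.ofReal (c / κ * ε) := by
          rw [← ENNReal.ofReal_mul (by positivity)]; congr 1; ring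
      _ ≤ _ := hCε (by
          have : 0 ≤ 1 + 4 * c / (κ * R ^ 2) + V * (1 + c + 2) + K * c := by positivity
          rw [hC]; linarith)
  · have hk : 0 < κ * R ^ 2 / 4 := by positivity
    calc (u : Measure X) (⋃ i, Metric.ball (x i) (R / 2))ᶜ
        ≤ (u : Measure X) {y | ENNReal.ofReal (κ * R ^ 2 / 4) ≤ ENNReal.ofReal (W y)} :=
          measure_mono fun y hy => ENNReal.ofReal_le_ofReal (hWrest y hy)
      _ ≤ (∫⁻ y, ENNReal.ofReal (W y) ∂(u : Measure X)) / ENNReal.ofReal (κ * R ^ 2 / 4) :=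
          meas_ge_le_lintegral_div hWi.1.aemeasurable.ennreal_ofReal
            (ENNReal.ofReal_pos.2 hk).ne' ENNReal.ofReal_ne_top
      _ ≤ ENNReal.ofReal (c * ε) / ENNReal.ofReal (κ * R ^ 2 / 4) := by gcongr
      _ = ENNReal.ofReal (4 * c / (κ * R ^ 2) * ε) := by
          rw [← ENNReal.ofReal_div_of_pos hk]; congr 1; field_simp
      _ ≤ _ := hCε (by
          have : 0 ≤ 1 + c / κ + V * (1 + c + 2) + K * c := by positivity
          rw [hC]; linarith)
  · intro i
    rw [hU, ← ENNReal.ofReal_coe_nnreal, ← ENNReal.ofReal_add (by positivity) hCε0]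
    exact ENNReal.ofReal_le_ofReal (by linarith [(abs_le.1 (hmass_i i)).2])
  · intro i
    rw [hU, ← ENNReal.ofReal_coe_nnreal, ← ENNReal.ofReal_add measureReal_nonneg hCε0]
    exact ENNReal.ofReal_le_ofReal (by linarith [(abs_le.1 (hmass_i i)).1])

end Certificate


variable {d : ℕ} {H : Type*} [NormedAddCommGroup H] [InnerProductSpace ℝ H]

/-! ### Measurability and topology of the phase space -/

namespace Setting

variable (S : Setting d H)

instance : IsProbabilityMeasure S.HΘ := S.isProbabilityMeasure

instance : S.HΘ.IsOpenPosMeasure := S.isOpenPosMeasure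

theorem continuous_moveCoord (t : ℝ) :
    Continuous fun z : S.Gam => z.1 0 + t * z.1 1 := by
  fun_prop

theorem continuous_inner_direction (θ : S.Θ) :
    Continuous fun x : S.Ω =>
      ⟪(θ : EuclideanSpace ℝ (Fin d)), (x : EuclideanSpace ℝ (Fin d))⟫_ℝ := by
  fun_prop

/-- The projection of a position-velocity pair in direction `θ`. -/
noncomputable def project (z : S.Θ × S.Lam) : S.Gam :=
  ⟨!₂[⟪(z.1 : EuclideanSpace ℝ (Fin d)), z.2.1.1⟫_ℝ, ⟪(z.1 : EuclideanSpace ℝ (Fin d)), z.2.1.2⟫_ℝ],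
    z.2.1, z.2.2, z.1, z.1.2, rfl⟩

theorem continuous_project : Continuous S.project := by
  refine Continuous.subtype_mk ?_ _
  refine (PiLp.continuous_toLp 2 _).comp (continuous_pi fun i => ?_)
  fin_cases i
  · change Continuous fun z : S.Θ × S.Lam => ⟪(z.1 : EuclideanSpace ℝ (Fin d)), z.2.1.1⟫_ℝ
    fun_prop
  · change Continuous fun z : S.Θ × S.Lam => ⟪(z.1 : EuclideanSpace ℝ (Fin d)), z.2.1.2⟫_ℝ
    fun_prop

theorem moveCoord_project (t : ℝ) (z : S.Θ × S.Lam) :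
    (S.project z).1 0 + t * (S.project z).1 1 =
      ⟪(z.1 : EuclideanSpace ℝ (Fin d)), z.2.1.1 + t • z.2.1.2⟫_ℝ := by
  simp [project, inner_add_right, inner_smul_right]

/-- The position at time `t` of a particle in phase space. -/
def evalAt (t : S.Sig) (q : S.Lam) : S.Ω := ⟨q.1.1 + (t : ℝ) • q.1.2, q.2 t t.2⟩

theorem continuous_evalAt (t : S.Sig) : Continuous (S.evalAt t) :=
  Continuous.subtype_mk (by fun_prop) _

theorem range_project : Set.range (fun z => (S.project z).1) = S.Gam := by
  ext z
  constructor
  · rintro ⟨w, rfl⟩; exact (S.project w).2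
  · rintro ⟨q, hq, θ, hθ, rfl⟩
    exact ⟨(⟨θ, hθ⟩, ⟨q, hq⟩), rfl⟩

theorem isClosed_Lam : IsClosed S.Lam := by
  have : S.Lam = ⋂ t ∈ S.Sig, {q | q.1 + t • q.2 ∈ (S.Ω : Set (EuclideanSpace ℝ (Fin d)))} := by
    ext q; simp [Lam]
  rw [this]
  exact isClosed_biInter fun t _ => S.Ω.isCompact.isClosed.preimage (by fun_prop)

/-- With a single time in `Sig` the velocities are unbounded and `Gam` need not be compact; it is
still the continuous image of a σ-compact space. -/
theorem measurableSet_Gam : MeasurableSet S.Gam := by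
  have hL : SigmaCompactSpace S.Lam := S.isClosed_Lam.isClosedEmbedding_subtypeVal.sigmaCompactSpace
  have hΘ : CompactSpace S.Θ := isCompact_iff_compactSpace.1 S.Θ.isCompact
  have h := isSigmaCompact_range (continuous_subtype_val.comp S.continuous_project)
  obtain ⟨K, hK, hKU⟩ := h
  have h2 : S.Gam = ⋃ n, K n := by rw [hKU]; exact S.range_project.symm
  rw [h2]
  exact MeasurableSet.iUnion fun n => (hK n).measurableSet

/-- Position and velocity are a continuous function of the places in `Ω` at two distinct times. -/
theorem isCompact_Gam {t₁ t₂ : S.Sig} (h : t₁ ≠ t₂) : IsCompact S.Gam := by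
  have hne : ((t₂ : ℝ) - t₁) ≠ 0 := sub_ne_zero.2 fun h' => h (Subtype.ext h'.symm)
  have hL : IsCompact S.Lam := by
    let F : EuclideanSpace ℝ (Fin d) × EuclideanSpace ℝ (Fin d) →
        EuclideanSpace ℝ (Fin d) × EuclideanSpace ℝ (Fin d) := fun p =>
      (p.1 - (t₁ : ℝ) • ((t₂ : ℝ) - t₁)⁻¹ • (p.2 - p.1), ((t₂ : ℝ) - t₁)⁻¹ • (p.2 - p.1))
    have hF : Continuous F := by fun_prop
    refine ((S.Ω.isCompact.prod S.Ω.isCompact).image hF).of_isClosed_subset S.isClosed_Lam ?_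
    intro q hq
    refine ⟨(q.1 + (t₁ : ℝ) • q.2, q.1 + (t₂ : ℝ) • q.2), ⟨hq t₁ t₁.2, hq t₂ t₂.2⟩, ?_⟩
    have h1 : ((t₂ : ℝ) - t₁)⁻¹ • (q.1 + (t₂ : ℝ) • q.2 - (q.1 + (t₁ : ℝ) • q.2)) = q.2 := by
      rw [add_sub_add_left_eq_sub, ← sub_smul, smul_smul, inv_mul_cancel₀ hne, one_smul]
    simp only [F, h1, add_sub_cancel_right]
  have hL' : CompactSpace S.Lam := isCompact_iff_compactSpace.1 hL
  have hΘ : CompactSpace S.Θ := isCompact_iff_compactSpace.1 S.Θ.isCompact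
  rw [← S.range_project]
  exact isCompact_range (continuous_subtype_val.comp S.continuous_project)

theorem mass_move (t : S.Sig) (μ : FiniteMeasure S.Gam) : (S.move t μ).mass = μ.mass := by
  unfold move FiniteMeasure.mass
  rw [FiniteMeasure.map_apply _ (S.continuous_moveCoord t).measurable MeasurableSet.univ,
    Set.preimage_univ]

theorem mass_radon (θ : S.Θ) (μ : FiniteMeasure S.Ω) : (S.radon θ μ).mass = μ.mass := by
  unfold radon FiniteMeasure.mass
  rw [FiniteMeasure.map_apply _ (S.continuous_inner_direction θ).measurable MeasurableSet.univ,
    Set.preimage_univ]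

theorem continuous_radon (μ : FiniteMeasure S.Ω) : Continuous fun θ => S.radon θ μ := by
  rw [continuous_iff_continuousAt]
  intro θ₀
  refine FiniteMeasure.tendsto_iff_forall_integral_tendsto.2 fun h => ?_
  have hmap : ∀ θ, ∫ y, h y ∂(S.radon θ μ : Measure ℝ) =
      ∫ x, h ⟪(θ : EuclideanSpace ℝ (Fin d)), (x : EuclideanSpace ℝ (Fin d))⟫_ℝ
        ∂(μ : Measure S.Ω) := fun θ =>
    integral_map (S.continuous_inner_direction θ).measurable.aemeasurable
      h.continuous.aestronglyMeasurable
  simp only [hmap]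
  refine Continuous.tendsto (continuous_of_dominated (bound := fun _ => ‖h‖) (fun θ => ?_)
    (fun θ => Filter.Eventually.of_forall fun x => h.norm_coe_le_norm _)
    (integrable_const _) (Filter.Eventually.of_forall fun x => ?_)) θ₀
  · exact (h.continuous.comp (S.continuous_inner_direction θ)).aestronglyMeasurable
  · exact h.continuous.comp (by fun_prop)

/-! ### Slices of mixed admissible measures -/

variable {S}

theorem MixedAdmissible.apply_prod {u : S.Sig → FiniteMeasure S.Ω}
    {γ : FiniteMeasure (S.Θ × S.Gam)} (h : S.MixedAdmissible u γ) (t : S.Sig) {B : Set S.Θ}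
    (hB : MeasurableSet B) {A : Set ℝ} (hA : MeasurableSet A) :
    (γ : Measure (S.Θ × S.Gam)) (B ×ˢ ((fun z : S.Gam => z.1 0 + (t : ℝ) * z.1 1) ⁻¹' A)) =
      ∫⁻ θ in B, (S.radon θ (u t) : Measure ℝ) A ∂S.HΘ := by
  rw [← (h t A hA).2 B hB]
  unfold angleMove
  rw [FiniteMeasure.toMeasure_map, Measure.map_apply]
  · rfl
  · exact measurable_fst.prodMk ((S.continuous_moveCoord t).measurable.comp measurable_snd)
  · exact hB.prod hA

theorem MixedAdmissible.apply_prod_univ {u : S.Sig → FiniteMeasure S.Ω}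
    {γ : FiniteMeasure (S.Θ × S.Gam)} (h : S.MixedAdmissible u γ) (t : S.Sig) {B : Set S.Θ}
    (hB : MeasurableSet B) :
    (γ : Measure (S.Θ × S.Gam)) (B ×ˢ Set.univ) = (u t).mass * S.HΘ B := by
  have h1 := h.apply_prod t hB MeasurableSet.univ
  rw [Set.preimage_univ] at h1
  have h2 : ∀ θ, (S.radon θ (u t) : Measure ℝ) Set.univ = (u t).mass := fun θ => by
    rw [← FiniteMeasure.ennreal_mass, mass_radon]
  rw [h1]
  simp only [h2, setLIntegral_const]

theorem MixedAdmissible.mass_eq {u : S.Sig → FiniteMeasure S.Ω}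
    {γ : FiniteMeasure (S.Θ × S.Gam)} (h : S.MixedAdmissible u γ) (t : S.Sig) :
    γ.mass = (u t).mass := by
  have := h.apply_prod_univ t MeasurableSet.univ
  rw [Set.univ_prod_univ, measure_univ (μ := S.HΘ), mul_one, ← FiniteMeasure.ennreal_mass] at this
  exact_mod_cast this

/-- Since each `R_θ` preserves mass, the marginal of `γ` in `θ` is `HΘ` times the mass of a
snapshot. Slices are the conditional probabilities rescaled by this mass. -/
theorem MixedAdmissible.exists_isFiberProduct {u : S.Sig → FiniteMeasure S.Ω}
    {γ : FiniteMeasure (S.Θ × S.Gam)} (h : S.MixedAdmissible u γ) :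
    ∃ g : S.Θ → FiniteMeasure S.Gam, IsFiberProduct S.HΘ g γ := by
  obtain ⟨t, -⟩ := S.times_nonempty
  -- Conditional kernels require a nonempty fibre; over an empty one all slices are zero.
  rcases isEmpty_or_nonempty S.Gam with hG | hG
  · refine ⟨fun _ => 0, fun A _ => ⟨by simp, fun B _ => ?_⟩⟩
    have hA : A = ∅ := Set.eq_empty_of_isEmpty A
    simp [hA]
  have : StandardBorelSpace S.Gam := S.measurableSet_Gam.standardBorel
  have hfst : (γ : Measure (S.Θ × S.Gam)).fst = (u t).mass • S.HΘ := by
    ext B hB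
    rw [Measure.fst_apply hB, ← Set.prod_univ, h.apply_prod_univ t hB]
    simp [ENNReal.smul_def]
  let k : S.Θ → FiniteMeasure S.Gam := fun θ =>
    ⟨(γ : Measure (S.Θ × S.Gam)).condKernel θ, inferInstance⟩
  refine ⟨fun θ => (u t).mass • k θ, fun A hA => ?_⟩
  have hker : ∀ θ, (((u t).mass • k θ : FiniteMeasure S.Gam) : Measure S.Gam) A
        = (u t).mass * (γ : Measure (S.Θ × S.Gam)).condKernel θ A := fun θ => by
    rw [FiniteMeasure.toMeasure_smul, Measure.smul_apply, ENNReal.smul_def]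
    rfl
  have hm : Measurable fun θ => (γ : Measure (S.Θ × S.Gam)).condKernel θ A :=
    ProbabilityTheory.Kernel.measurable_coe _ hA
  simp only [hker]
  refine ⟨(hm.const_mul _).aemeasurable, fun B hB => ?_⟩
  conv_lhs => rw [← (γ : Measure (S.Θ × S.Gam)).disintegrate
    (γ : Measure (S.Θ × S.Gam)).condKernel]
  rw [Measure.compProd_apply_prod hB hA, hfst, Measure.restrict_smul, lintegral_smul_measure,
    lintegral_const_mul _ hm]
  rfl

/-- For a fixed Borel set both sides have equal integrals over all sets of directions, hence agree
almost everywhere. The null set depends on the Borel set, so only the countable π-system of rational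
half-lines and the total mass are tested. -/
theorem MixedAdmissible.ae_move_eq {u : S.Sig → FiniteMeasure S.Ω}
    {γ : FiniteMeasure (S.Θ × S.Gam)} (h : S.MixedAdmissible u γ)
    {g : S.Θ → FiniteMeasure S.Gam} (hg : IsFiberProduct S.HΘ g γ) (t : S.Sig) :
    ∀ᵐ θ ∂S.HΘ, S.move t (g θ) = S.radon θ (u t) := by
  have hφ := (S.continuous_moveCoord t).measurable
  have key : ∀ A : Set ℝ, MeasurableSet A → ∀ᵐ θ ∂S.HΘ,
      (S.move t (g θ) : Measure ℝ) A = (S.radon θ (u t) : Measure ℝ) A := fun A hA => by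
    have h1 : ∀ θ, (S.move t (g θ) : Measure ℝ) A =
        (g θ : Measure S.Gam) ((fun z : S.Gam => z.1 0 + (t : ℝ) * z.1 1) ⁻¹' A) := fun θ => by
      unfold move
      rw [FiniteMeasure.toMeasure_map, Measure.map_apply hφ hA]
    simp only [h1]
    refine ae_eq_of_forall_setLIntegral_eq_of_sigmaFinite₀ (hg _ (hφ hA)).1 (h t A hA).1
      fun B hB _ => ?_
    rw [← (hg _ (hφ hA)).2 B hB, h.apply_prod t hB hA]
  have h2 : ∀ᵐ θ ∂S.HΘ, ∀ q : ℚ, (S.move t (g θ) : Measure ℝ) (Set.Iic (q : ℝ)) =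
      (S.radon θ (u t) : Measure ℝ) (Set.Iic (q : ℝ)) :=
    ae_all_iff.2 fun q => key _ measurableSet_Iic
  filter_upwards [h2, key _ MeasurableSet.univ] with θ hq huniv
  refine FiniteMeasure.toMeasure_injective ?_
  refine ext_of_generate_finite _ ((BorelSpace.measurable_eq (α := ℝ)).trans
    Real.borel_eq_generateFrom_Iic_rat) Real.isPiSystem_Iic_rat ?_ huniv
  intro s hs
  obtain ⟨q, rfl⟩ := Set.mem_iUnion.1 hs
  exact hq q

/-- If there are at least two times, slices that match the snapshots at finitely many times exist
in every direction. -/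
theorem MixedAdmissible.exists_move_eq {u : S.Sig → FiniteMeasure S.Ω}
    {γ : FiniteMeasure (S.Θ × S.Gam)} (h : S.MixedAdmissible u γ) {t₁ t₂ : S.Sig} (ht : t₁ ≠ t₂)
    (T : Finset S.Sig) (θ : S.Θ) :
    ∃ μ : FiniteMeasure S.Gam, ∀ t ∈ T, S.move t μ = S.radon θ (u t) := by
  obtain ⟨g, hg⟩ := h.exists_isFiberProduct
  have hcpt : CompactSpace S.Gam := isCompact_iff_compactSpace.1 (S.isCompact_Gam ht)
  -- Measures of bounded mass on the compact `Gam` are weakly compact, so the directions admitting a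
  -- matching measure form a closed set, the projection of `Z` along `K`. It contains almost every
  -- direction and hence, `HΘ` having full support, a dense set.
  let K : Set (FiniteMeasure S.Gam) := {μ | μ.mass ≤ γ.mass}
  have hK : CompactSpace K := isCompact_iff_compactSpace.1
    (isCompact_setOfPred_finiteMeasure_le_of_compactSpace S.Gam γ.mass)
  let Z : Set (S.Θ × K) := {z | ∀ t ∈ T, S.move t z.2.1 = S.radon z.1 (u t)}
  have hZ : IsClosed Z := by
    have : Z = ⋂ t ∈ T, {z | S.move t z.2.1 = S.radon z.1 (u t)} := by ext z; simp [Z]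
    rw [this]
    refine isClosed_biInter fun t _ => isClosed_eq ?_
      ((S.continuous_radon (u t)).comp continuous_fst)
    exact (FiniteMeasure.continuous_map (S.continuous_moveCoord t)).comp
      (continuous_subtype_val.comp continuous_snd)
  have hclosed : IsClosed (Prod.fst '' Z) := isClosedMap_fst_of_compactSpace _ hZ
  -- The time `t₁` is added so that the mass bound defining `K` holds even for empty `T`.
  have hae : ∀ᵐ θ ∂S.HΘ, ∀ t ∈ insert t₁ T, S.move t (g θ) = S.radon θ (u t) :=
    (Finset.eventually_all _).2 fun t _ => h.ae_move_eq hg t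
  have hdense := Measure.dense_of_ae hae
  have hsub : {θ | ∀ t ∈ insert t₁ T, S.move t (g θ) = S.radon θ (u t)} ⊆ Prod.fst '' Z := by
    intro θ hθ
    refine ⟨(θ, ⟨g θ, ?_⟩), fun t ht => hθ t (Finset.mem_insert_of_mem ht), rfl⟩
    have := congrArg FiniteMeasure.mass (hθ t₁ (Finset.mem_insert_self _ _))
    rw [mass_move, mass_radon, ← h.mass_eq] at this
    exact this.le
  have hθ : θ ∈ Prod.fst '' Z := by
    have := (hclosed.closure_subset_iff.2 hsub) (hdense θ)
    exact this
  obtain ⟨z, hz, rfl⟩ := hθ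
  exact ⟨z.2.1, hz⟩

end Setting


namespace GroundTruth

variable {S : Setting d H} (G : GroundTruth S)

/-! ### The ground truth as a competitor -/

theorem map_finite_map {X Y Z : Type*} [MeasurableSpace X] [MeasurableSpace Y] [MeasurableSpace Z]
    (μ : FiniteMeasure X) {f : X → Y} {g : Y → Z} (hf : Measurable f) (hg : Measurable g) :
    (μ.map f).map g = μ.map (g ∘ f) :=
  FiniteMeasure.toMeasure_injective (Measure.map_map hg hf)

theorem map_sum_smul_diracMass {X Y ι : Type*} [MeasurableSpace X] [MeasurableSpace Y] [Fintype ι]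
    (m : ι → ℝ≥0) (x : ι → X) {f : X → Y} (hf : Measurable f) :
    (∑ i, m i • diracMass (x i)).map f = ∑ i, m i • diracMass (f (x i)) := by
  refine (map_sum (FiniteMeasure.mapHom hf) _ _).trans (Finset.sum_congr rfl fun i _ => ?_)
  rw [map_smul]
  congr 1
  exact FiniteMeasure.toMeasure_injective (Measure.map_dirac' hf _)

theorem measurable_project_left (θ : S.Θ) : Measurable fun q => S.project (θ, q) :=
  (S.continuous_project.comp (by fun_prop)).measurable

theorem radon_snapshot (t : S.Sig) (θ : S.Θ) : S.radon θ (G.snapshot t) =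
    G.lam.map fun q => ⟪(θ : EuclideanSpace ℝ (Fin d)), q.1.1 + (t : ℝ) • q.1.2⟫_ℝ :=
  map_finite_map _ (S.continuous_evalAt t).measurable (S.continuous_inner_direction θ).measurable

theorem productAdmissible : S.ProductAdmissible G.snapshot G.projection := by
  intro t θ
  rw [radon_snapshot]
  refine (map_finite_map _ (measurable_project_left θ)
    (S.continuous_moveCoord t).measurable).trans ?_
  congr 1
  funext q
  exact S.moveCoord_project t (θ, q)

/-- The ground truth of the mixed model. -/
noncomputable def mixedProjection : FiniteMeasure (S.Θ × S.Gam) :=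
  ⟨(S.HΘ.prod (G.lam : Measure S.Lam)).map fun z => (z.1, S.project z), inferInstance⟩

theorem mixedAdmissible : S.MixedAdmissible G.snapshot G.mixedProjection := by
  intro t A hA
  have hq : Measurable fun z : S.Θ × S.Lam =>
      ⟪(z.1 : EuclideanSpace ℝ (Fin d)), z.2.1.1 + (t : ℝ) • z.2.1.2⟫_ℝ :=
    Continuous.measurable (by fun_prop)
  have hp : Measurable fun z : S.Θ × S.Lam => (z.1, S.project z) :=
    measurable_fst.prodMk S.continuous_project.measurable
  have hm : Measurable fun z : S.Θ × S.Gam => (z.1, z.2.1 0 + (t : ℝ) * z.2.1 1) :=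
    measurable_fst.prodMk ((S.continuous_moveCoord t).measurable.comp measurable_snd)
  have hr : ∀ θ, (S.radon θ (G.snapshot t) : Measure ℝ) A =
      (G.lam : Measure S.Lam) (Prod.mk θ ⁻¹' ((fun z : S.Θ × S.Lam =>
        ⟪(z.1 : EuclideanSpace ℝ (Fin d)), z.2.1.1 + (t : ℝ) • z.2.1.2⟫_ℝ) ⁻¹' A)) := fun θ => by
    rw [radon_snapshot, FiniteMeasure.toMeasure_map, Measure.map_apply _ hA]
    · rfl
    · exact Continuous.measurable (by fun_prop)
  simp only [hr]
  refine ⟨(measurable_measure_prodMk_left (hq hA)).aemeasurable, fun B hB => ?_⟩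
  have h1 : (S.angleMove t G.mixedProjection : Measure (S.Θ × ℝ)) =
      (S.HΘ.prod (G.lam : Measure S.Lam)).map fun z => (z.1,
        ⟪(z.1 : EuclideanSpace ℝ (Fin d)), z.2.1.1 + (t : ℝ) • z.2.1.2⟫_ℝ) := by
    unfold Setting.angleMove
    rw [FiniteMeasure.toMeasure_map]
    refine (Measure.map_map hm hp).trans ?_
    congr 1
    funext z
    exact Prod.ext rfl (S.moveCoord_project t z)
  have hset : (fun z : S.Θ × S.Lam => (z.1,
        ⟪(z.1 : EuclideanSpace ℝ (Fin d)), z.2.1.1 + (t : ℝ) • z.2.1.2⟫_ℝ)) ⁻¹' (B ×ˢ A) =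
      (B ×ˢ Set.univ) ∩ (fun z : S.Θ × S.Lam =>
        ⟪(z.1 : EuclideanSpace ℝ (Fin d)), z.2.1.1 + (t : ℝ) • z.2.1.2⟫_ℝ) ⁻¹' A := by
    ext z; simp
  rw [h1, Measure.map_apply (measurable_fst.prodMk hq) (hB.prod hA), hset, Set.inter_comm,
    ← Measure.restrict_apply (hq hA), ← Measure.prod_restrict, Measure.restrict_univ,
    Measure.prod_apply (hq hA)]

theorem mass_snapshot (t : S.Sig) : (G.snapshot t).mass = G.lam.mass := by
  change (G.lam.map (S.evalAt t)) Set.univ = _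
  rw [FiniteMeasure.map_apply _ (S.continuous_evalAt t).measurable MeasurableSet.univ]
  rfl

theorem mass_projection (θ : S.Θ) : (G.projection θ).mass = G.lam.mass := by
  change (G.lam.map fun q => S.project (θ, q)) Set.univ = _
  rw [FiniteMeasure.map_apply _ (measurable_project_left θ) MeasurableSet.univ]
  rfl

theorem snapshot_eq_sum (t : S.Sig) :
    G.snapshot t = ∑ i, G.m i • diracMass (S.evalAt t (G.particle i)) :=
  map_sum_smul_diracMass _ _ (S.continuous_evalAt t).measurable

theorem zeroExt_snapshot (t : S.Sig) :
    zeroExt (G.snapshot t) = ∑ i, G.m i • diracMass (G.loc t i) := by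
  rw [snapshot_eq_sum]
  exact map_sum_smul_diracMass _ _ measurable_subtype_coe

theorem zeroExt_projection (θ : S.Θ) :
    zeroExt (G.projection θ) = ∑ i, G.m i • diracMass !₂[G.projPos θ i, G.projVel θ i] :=
  (map_finite_map _ (measurable_project_left θ) measurable_subtype_coe).trans
    (map_sum_smul_diracMass _ _ (measurable_subtype_coe.comp (measurable_project_left θ)))

variable [CompleteSpace H]

theorem noise_nonneg (f : S.Sig → H) : 0 ≤ G.noise f := by
  unfold noise; positivity

theorem dataTerm_snapshot (f : S.Sig → H) : S.dataTerm f G.snapshot = 2 * √(G.noise f) ^ 2 := by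
  rw [Real.sq_sqrt (G.noise_nonneg f)]
  unfold noise Setting.dataTerm
  rw [← mul_assoc]
  norm_num
  exact Finset.sum_congr rfl fun t _ => by rw [norm_sub_rev]

/-- The consequence of optimality used in all estimates: up to the noise level, the energy of the
snapshots `u` does not exceed the mass of the ground truth. -/
structure IsNearOptimal (f : S.Sig → H) (u : S.Sig → FiniteMeasure S.Ω) (q : ℝ) : Prop where
  nonneg : 0 ≤ q
  dataTerm_le : S.dataTerm f u ≤ 2 * √(G.noise f) * q
  mass_add_le : ∀ t, ((u t).mass : ℝ) + q ≤ G.lam.mass + √(G.noise f)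

/-- The number `q` stands for the weighted data term `data / (2 α)`. In this form `α > 0` and the
constrained case `α = 0`, where `q = 0`, have the same consequences. -/
theorem exists_of_energy_le {α mass data mass' data' : ℝ} (hα : 0 ≤ α) (hm : 0 ≤ mass)
    (hd : 0 ≤ data) (hm' : 0 ≤ mass') (hd' : data' = 2 * α ^ 2)
    (h : Setting.energy α mass data ≤ Setting.energy α mass' data') :
    ∃ q, 0 ≤ q ∧ data ≤ 2 * α * q ∧ mass + q ≤ mass' + α := by
  subst hd'
  unfold Setting.energy at h
  rcases hα.eq_or_lt with rfl | hα
  · have h0 : data = 0 := by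
      -- For `α = 0` the competitor has finite energy, whereas a nonzero data term would be
      -- multiplied by `∞`.
      by_contra hne
      have hpos : ENNReal.ofReal data ≠ 0 := (ENNReal.ofReal_pos.2 (hd.lt_of_ne' hne)).ne'
      simp [ENNReal.top_mul hpos] at h
    refine ⟨0, le_rfl, by simp [h0], ?_⟩
    simp only [h0, ENNReal.ofReal_zero, mul_zero, add_zero, ne_eq, OfNat.ofNat_ne_zero,
      not_false_eq_true, zero_pow] at h
    simpa using (ENNReal.ofReal_le_ofReal_iff hm').1 h
  · have h2 : (2 * ENNReal.ofReal α)⁻¹ = ENNReal.ofReal (2 * α)⁻¹ := by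
      rw [ENNReal.ofReal_inv_of_pos (by positivity), ENNReal.ofReal_mul (by norm_num)]
      norm_num
    rw [h2, ← ENNReal.ofReal_mul (by positivity), ← ENNReal.ofReal_mul (by positivity),
      ← ENNReal.ofReal_add hm (by positivity), ← ENNReal.ofReal_add hm' (by positivity),
      ENNReal.ofReal_le_ofReal_iff (by positivity)] at h
    refine ⟨(2 * α)⁻¹ * data, by positivity, le_of_eq (by field_simp), ?_⟩
    have : (2 * α)⁻¹ * (2 * α ^ 2) = α := by field_simp
    linarith

theorem exists_isNearOptimal_of_product {f : S.Sig → H} {θ₀ : S.Θ} {u : S.Sig → FiniteMeasure S.Ω}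
    {γ : S.Θ → FiniteMeasure S.Gam} (h : S.IsProductSolution √(G.noise f) f θ₀ u γ) :
    ∃ q, G.IsNearOptimal f u q := by
  obtain ⟨q, hq, hdata, hmass⟩ := exists_of_energy_le (Real.sqrt_nonneg _) (γ θ₀).mass.2
    (Finset.sum_nonneg fun _ _ => by positivity) (G.projection θ₀).mass.2
    (G.dataTerm_snapshot f) (h.2 _ _ G.productAdmissible)
  refine ⟨q, hq, hdata, fun t => ?_⟩
  -- All slices and snapshots have equal mass, so the choice of `θ₀` leaves no trace.
  have h1 := congrArg FiniteMeasure.mass (h.1 t θ₀)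
  rw [Setting.mass_move, Setting.mass_radon] at h1
  rw [← h1, ← G.mass_projection θ₀]
  exact hmass

theorem exists_isNearOptimal_of_mixed {f : S.Sig → H} {u : S.Sig → FiniteMeasure S.Ω}
    {γ : FiniteMeasure (S.Θ × S.Gam)} (h : S.IsMixedSolution √(G.noise f) f u γ) :
    ∃ q, G.IsNearOptimal f u q := by
  obtain ⟨q, hq, hdata, hmass⟩ := exists_of_energy_le (Real.sqrt_nonneg _) γ.mass.2
    (Finset.sum_nonneg fun _ _ => by positivity) G.mixedProjection.mass.2
    (G.dataTerm_snapshot f) (h.2 _ _ G.mixedAdmissible)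
  refine ⟨q, hq, hdata, fun t => ?_⟩
  rw [← h.1.mass_eq t, ← G.mass_snapshot t, ← G.mixedAdmissible.mass_eq t]
  exact hmass

/-! ### Snapshots at observation times -/

/-- Atoms are recovered from the values on singletons. Reconstructibility brings its own enumeration
of the atoms, which has to be matched with the labels of the particles. -/
theorem exists_equiv_of_sum_eq {X : Type*} [MeasurableSpace X] [MeasurableSingletonClass X]
    {n N : ℕ} {m : Fin n → ℝ≥0} {x : Fin n → X} {m' : Fin N → ℝ≥0} {x' : Fin N → X}
    (hm : ∀ i, 0 < m i) (hm' : ∀ i, 0 < m' i) (hx : Function.Injective x)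
    (hx' : Function.Injective x')
    (h : ∑ i, m i • diracMass (x i) = ∑ i, m' i • diracMass (x' i)) :
    ∃ e : Fin N ≃ Fin n, (∀ i, x (e i) = x' i) ∧ ∀ i, m (e i) = m' i := by
  classical
  have hval : ∀ {k : ℕ} (m : Fin k → ℝ≥0) (x : Fin k → X) (p : X),
      ((∑ i, m i • diracMass (x i) : FiniteMeasure X) : Measure X) {p} =
        ∑ i, if x i = p then (m i : ℝ≥0∞) else 0 := fun m x p => by
    rw [FiniteMeasure.toMeasure_sum, Measure.finsetSum_apply]
    refine Finset.sum_congr rfl fun i _ => ?_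
    change (m i • Measure.dirac (x i)) {p} = _
    rw [Measure.smul_apply, Measure.dirac_apply, ENNReal.smul_def]
    by_cases hp : x i = p <;> simp [hp]
  have hat : ∀ {k : ℕ} (m : Fin k → ℝ≥0) (x : Fin k → X), Function.Injective x → ∀ j,
      ((∑ i, m i • diracMass (x i) : FiniteMeasure X) : Measure X) {x j} = m j :=
    fun m x hx j => by
      rw [hval, Finset.sum_eq_single j (fun i _ hij => if_neg fun h => hij (hx h)) (by simp),
        if_pos rfl]
  have hex : ∀ {k l : ℕ} {m : Fin k → ℝ≥0} {x : Fin k → X} {m' : Fin l → ℝ≥0} {x' : Fin l → X},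
      (∀ i, 0 < m' i) → Function.Injective x' →
      ∑ i, m i • diracMass (x i) = ∑ i, m' i • diracMass (x' i) → ∀ j, ∃ i, x i = x' j :=
    fun {k l m x m' x'} hm' hx' h j => by
      by_contra hcon
      have h1 := hat m' x' hx' j
      rw [← h, hval, Finset.sum_eq_zero fun i _ => if_neg fun hi => hcon ⟨i, hi⟩] at h1
      exact (hm' j).ne (by exact_mod_cast h1)
  choose e he using hex hm' hx' h
  choose e' he' using hex hm hx h.symm
  refine ⟨⟨e, e', fun i => hx' ((he' _).trans (he i)), fun i => hx ((he _).trans (he' i))⟩, he,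
    fun i => ?_⟩
  have h1 := hat m x hx (e i)
  rw [h, he, hat m' x' hx'] at h1
  exact_mod_cast h1.symm

/-- At an observation time at which the ground truth is reconstructible, near optimal snapshots are
close to the ground truth. -/
theorem exists_snapshot_bound {t : S.Sig} (ht : t ∈ S.times)
    (hrec : IsReconstructible (S.obsAdj t) (G.snapshot t)) :
    ∃ C : ℝ, 0 < C ∧ ∀ (f : S.Sig → H) (u : S.Sig → FiniteMeasure S.Ω) (q : ℝ),
      G.IsNearOptimal f u q →
      G.snapshotError 1 u t ≤ ENNReal.ofReal (C * √(G.noise f)) ∧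
      (Function.Injective (G.loc t) → ∃ A, IsConcentrated (u t : Measure S.Ω) G.m
        (fun i y => edist (y : EuclideanSpace ℝ (Fin d)) (G.loc t i) ^ 2) A
        (ENNReal.ofReal (C * √(G.noise f))) (ENNReal.ofReal (C * √(G.noise f)))) := by
  obtain ⟨n, m, x, hm, hx, hν, r, C, hC, hbound⟩ := hrec.exists_isConcentrated
  refine ⟨C * (n + 2), by positivity, fun f u q h => ?_⟩
  set ε := √(G.noise f) with hε
  have hε0 : 0 ≤ ε := Real.sqrt_nonneg _
  have hf : ‖f t - observe (S.obsAdj t) (G.snapshot t)‖ ^ 2 ≤ 2 * ε ^ 2 := by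
    rw [hε, ← G.dataTerm_snapshot f, norm_sub_rev]
    exact Finset.single_le_sum
      (f := fun t => ‖observe (S.obsAdj t) (G.snapshot t) - f t‖ ^ 2)
      (fun _ _ => by positivity) ht
  have hu : ‖observe (S.obsAdj t) (u t) - f t‖ ^ 2 ≤ 2 * ε * q :=
    (Finset.single_le_sum (f := fun t => ‖observe (S.obsAdj t) (u t) - f t‖ ^ 2)
      (fun _ _ => by positivity) ht).trans h.dataTerm_le
  have hconc := hbound (u t) (f t) ε q hε0 h.nonneg hf hu
    (by rw [mass_snapshot]; exact h.mass_add_le t)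
  have hle : ENNReal.ofReal (C * ε) ≤ ENNReal.ofReal (C * (n + 2) * ε) := by
    refine ENNReal.ofReal_le_ofReal ?_
    have : (0 : ℝ) ≤ n := Nat.cast_nonneg n
    gcongr
    nlinarith
  constructor
  -- The targets here are the distinct atoms of the snapshot, so particles may collide at time `t`.
  -- Labels by particle are needed, and available, only for distinct positions.
  · have hz : zeroExt (G.snapshot t)
        = ∑ i, m i • diracMass (x i : EuclideanSpace ℝ (Fin d)) := by
      rw [hν]
      exact map_sum_smul_diracMass _ _ measurable_subtype_coe
    unfold snapshotError
    rw [hz]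
    refine (unbalancedWasserstein_zeroExt_le S.Ω.isCompact.measurableSet (by positivity)
      (by positivity) hconc 1).trans (ENNReal.ofReal_le_ofReal ?_)
    rw [Fintype.card_fin]
    have : 0 ≤ (n + 1) * (C * ε) := by positivity
    linarith
  · intro hinj
    have hinj' : Function.Injective fun i => S.evalAt t (G.particle i) := fun i j hij =>
      hinj (congrArg Subtype.val hij)
    obtain ⟨e, hex, hem⟩ := exists_equiv_of_sum_eq hm G.m_pos hx hinj'
      (hν.symm.trans (G.snapshot_eq_sum t))
    refine ⟨fun i => Metric.ball (x (e i)) r, IsConcentrated.mono (a := ENNReal.ofReal (C * ε))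
      (b := ENNReal.ofReal (C * ε)) ?_ hle hle⟩
    have hloc : ∀ i (y : S.Ω), edist (y : EuclideanSpace ℝ (Fin d)) (G.loc t i) =
        edist y (x (e i)) := fun i y => by rw [hex]; rfl
    simp only [hloc]
    refine ⟨fun i => hconc.measurableSet _, fun i j hij => hconc.disjoint (e.injective.ne hij),
      ?_, ?_, fun i => ?_, fun i => ?_⟩
    · rw [e.sum_comp fun i => ∫⁻ y in Metric.ball (x i) r, edist y (x i) ^ 2 ∂(u t : Measure S.Ω)]
      exact hconc.sum_lintegral_le
    · rw [e.surjective.iUnion_comp fun i => Metric.ball (x i) r]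
      exact hconc.compl_le
    · rw [← hem]; exact hconc.le_mass_add _
    · rw [← hem]; exact hconc.mass_le_add _

end GroundTruth


/-! ### Separating families of functionals -/

/-- An injective linear map on a finite-dimensional space is bounded below. The functionals will be
observation times on the phase plane, or directions on physical space. -/
theorem exists_norm_sq_le_sum_sq {E κ : Type*} [NormedAddCommGroup E] [NormedSpace ℝ E]
    [FiniteDimensional ℝ E] [Fintype κ] (f : κ → E →ₗ[ℝ] ℝ)
    (hf : ∀ x, (∀ k, f k x = 0) → x = 0) :
    ∃ c : ℝ, 0 < c ∧ ∀ x, ‖x‖ ^ 2 ≤ c * ∑ k, f k x ^ 2 := by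
  obtain ⟨K, hK, hanti⟩ := LinearMap.exists_antilipschitzWith (LinearMap.pi f) (by
    rw [LinearMap.ker_eq_bot']
    exact fun x hx => hf x fun k => congrFun hx k)
  refine ⟨(K : ℝ) ^ 2, by positivity, fun x => ?_⟩
  have h1 : ‖x‖ ≤ K * ‖LinearMap.pi f x‖ := by
    simpa using hanti.le_mul_dist x 0
  have h2 : ‖LinearMap.pi f x‖ ≤ √(∑ k, f k x ^ 2) := by
    refine (pi_norm_le_iff_of_nonneg (Real.sqrt_nonneg _)).2 fun k => ?_
    refine Real.le_sqrt_of_sq_le ?_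
    rw [LinearMap.pi_apply, Real.norm_eq_abs, sq_abs]
    exact Finset.single_le_sum (f := fun k => f k x ^ 2) (fun _ _ => sq_nonneg _)
      (Finset.mem_univ k)
  calc ‖x‖ ^ 2 ≤ (K * √(∑ k, f k x ^ 2)) ^ 2 := by
        gcongr; exact h1.trans (by gcongr)
    _ = K ^ 2 * ∑ k, f k x ^ 2 := by
        rw [mul_pow, Real.sq_sqrt (Finset.sum_nonneg fun _ _ => sq_nonneg _)]

theorem edist_sq_le_sum_sqDist {E X κ : Type*} [NormedAddCommGroup E] [NormedSpace ℝ E]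
    [Fintype κ] {f : κ → E →ₗ[ℝ] ℝ} {c : ℝ} (hc : 0 < c)
    (hf : ∀ x, ‖x‖ ^ 2 ≤ c * ∑ k, f k x ^ 2) (g : X → E) (x : X) (z : E) :
    edist (g x) z ^ 2 ≤ ENNReal.ofReal c * ∑ k, sqDist (fun x => f k (g x)) (f k z) x := by
  unfold sqDist
  rw [← ENNReal.ofReal_sum_of_nonneg fun _ _ => sq_nonneg _, ← ENNReal.ofReal_mul hc.le,
    edist_dist, ← ENNReal.ofReal_pow dist_nonneg, dist_eq_norm]
  refine ENNReal.ofReal_le_ofReal ((hf _).trans (le_of_eq ?_))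
  simp only [map_sub]

theorem ofReal_mul_card_mul (c a : ℝ) (hc : 0 ≤ c) (n : ℕ) :
    ENNReal.ofReal c * n * ENNReal.ofReal a = ENNReal.ofReal (c * n * a) := by
  rw [ENNReal.ofReal_mul (by positivity), ENNReal.ofReal_mul hc, ENNReal.ofReal_natCast]

theorem card_add_one_mul_ofReal (b : ℝ) (n : ℕ) :
    ((n : ℝ≥0∞) + 1) * ENNReal.ofReal b = ENNReal.ofReal ((n + 1) * b) := by
  rw [ENNReal.ofReal_mul (by positivity), ENNReal.ofReal_add (by positivity) (by norm_num)]
  simp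

/-- The functional `(y, w) ↦ y + t w`. -/
noncomputable def moveFunctional (t : ℝ) : EuclideanSpace ℝ (Fin 2) →ₗ[ℝ] ℝ where
  toFun z := z 0 + t * z 1
  map_add' z z' := by simp; ring
  map_smul' c z := by simp; ring

theorem eq_zero_of_moveFunctional {t₁ t₂ : ℝ} (h : t₁ ≠ t₂) {z : EuclideanSpace ℝ (Fin 2)}
    (h1 : moveFunctional t₁ z = 0) (h2 : moveFunctional t₂ z = 0) : z = 0 := by
  change z 0 + t₁ * z 1 = 0 at h1
  change z 0 + t₂ * z 1 = 0 at h2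
  have h3 : (t₁ - t₂) * z 1 = 0 := by linarith
  have h4 : z 1 = 0 := (mul_eq_zero.1 h3).resolve_left (sub_ne_zero.2 h)
  have h5 : z 0 = 0 := by rw [h4] at h1; linarith
  ext i
  fin_cases i
  · exact h5
  · exact h4

theorem sq_moveFunctional_le (t : ℝ) (z : EuclideanSpace ℝ (Fin 2)) :
    moveFunctional t z ^ 2 ≤ (1 + t ^ 2) * ‖z‖ ^ 2 := by
  rw [EuclideanSpace.norm_sq_eq, Fin.sum_univ_two, Real.norm_eq_abs, Real.norm_eq_abs, sq_abs,
    sq_abs]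
  change (z 0 + t * z 1) ^ 2 ≤ _
  nlinarith [sq_nonneg (z 1 - t * z 0)]

/-! ### Position-velocity projections from snapshots -/

namespace GroundTruth

variable {S : Setting d H} (G : GroundTruth S)

/-- Position and velocity of particle `i` in the projection `θ`. -/
noncomputable def projPhase (θ : S.Θ) (i : Fin G.N) : EuclideanSpace ℝ (Fin 2) :=
  !₂[G.projPos θ i, G.projVel θ i]

theorem moveFunctional_projPhase (t : ℝ) (θ : S.Θ) (i : Fin G.N) :
    moveFunctional t (G.projPhase θ i) = ⟪(θ : EuclideanSpace ℝ (Fin d)), G.loc t i⟫_ℝ := by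
  simp [moveFunctional, projPhase, projPos, projVel, loc, inner_add_right, inner_smul_right]

theorem projPos_add_smul (t : ℝ) (θ : S.Θ) (i : Fin G.N) :
    G.projPos θ i + t • G.projVel θ i = ⟪(θ : EuclideanSpace ℝ (Fin d)), G.loc t i⟫_ℝ := by
  simp [projPos, projVel, loc, inner_add_right, inner_smul_right]

theorem TimeSeparated.mono {G : GroundTruth S} {T : Finset S.Sig} {θ : S.Θ} {Δ Δ' : ℝ}
    (h : G.TimeSeparated T θ Δ) (hΔ : Δ' ≤ Δ) : G.TimeSeparated T θ Δ' := by
  refine ⟨fun ⟨t, ht, i, j, hij, hd⟩ => h.1 ⟨t, ht, i, j, hij, hd.trans hΔ⟩, ?_⟩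
  rintro ⟨y, w, i, hi, hd⟩
  exact h.2 ⟨y, w, i, hi, fun t ht => (hd t ht).trans hΔ⟩

theorem DirSeparated.mono {G : GroundTruth S} {D : Set S.Θ} {t : S.Sig} {Δ Δ' : ℝ}
    (h : G.DirSeparated D t Δ) (hΔ : Δ' ≤ Δ) : G.DirSeparated D t Δ' := by
  refine ⟨fun ⟨θ, hθ, i, j, hij, hd⟩ => h.1 ⟨θ, hθ, i, j, hij, hd.trans hΔ⟩, ?_⟩
  rintro ⟨y, i, hi, hd⟩
  exact h.2 ⟨y, i, hi, fun θ hθ => (hd θ hθ).trans hΔ⟩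

theorem TimeSeparated.lt_abs_sub {G : GroundTruth S} {T : Finset S.Sig} {θ : S.Θ} {Δ : ℝ}
    (h : G.TimeSeparated T θ Δ) {t : S.Sig} (ht : t ∈ T) {i j : Fin G.N} (hij : i ≠ j) :
    Δ < |moveFunctional t (G.projPhase θ i) - moveFunctional t (G.projPhase θ j)| := by
  by_contra hcon
  refine h.1 ⟨t, ⟨t, ht, rfl⟩, j, i, hij.symm, ?_⟩
  rw [projPos_add_smul, projPos_add_smul, ← moveFunctional_projPhase, ← moveFunctional_projPhase,
    Real.dist_eq]
  exact not_lt.1 hcon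

/-- Absence of ghosts in the form required by `IsConcentrated.of_observables`. -/
theorem TimeSeparated.exists_eq {G : GroundTruth S} {T : Finset S.Sig} (hT : T.Nonempty) {θ : S.Θ}
    {Δ : ℝ} (h : G.TimeSeparated T θ Δ) (z : EuclideanSpace ℝ (Fin 2)) (i : T → Fin G.N)
    (hi : ∀ t : T, |moveFunctional (t : S.Sig) z
      - moveFunctional (t : S.Sig) (G.projPhase θ (i t))| ≤ Δ) :
    ∃ j, ∀ t, i t = j := by
  classical
  obtain ⟨t₀, ht₀⟩ := hT
  refine ⟨i ⟨t₀, ht₀⟩, ?_⟩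
  by_contra hcon
  push Not at hcon
  obtain ⟨t₁, ht₁⟩ := hcon
  -- A `Δ`-ghost is defined by an index function on all of `ℝ`, so `i` is extended from `T` by an
  -- arbitrary value.
  let k : ℝ → Fin G.N := fun s =>
    if hs : ∃ t : T, ((t : S.Sig) : ℝ) = s then i hs.choose else i ⟨t₀, ht₀⟩
  have hk : ∀ t : T, k (t : S.Sig) = i t := fun t => by
    have hs : ∃ t' : T, ((t' : S.Sig) : ℝ) = (t : S.Sig) := ⟨t, rfl⟩
    have h1 : hs.choose = t := Subtype.ext (Subtype.ext hs.choose_spec)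
    simp only [k, dif_pos hs, h1]
  refine h.2 ⟨z 0, z 1, k, ⟨t₁.1, ⟨t₁.1, t₁.2, rfl⟩, t₀, ⟨t₀, ht₀, rfl⟩, ?_⟩, ?_⟩
  · rw [hk t₁, hk ⟨t₀, ht₀⟩]; exact ht₁
  · rintro _ ⟨t, ht, rfl⟩
    rw [hk ⟨t, ht⟩, projPos_add_smul, ← moveFunctional_projPhase, Real.dist_eq]
    exact hi ⟨t, ht⟩

variable [CompleteSpace H]

/-- The estimate of a position-velocity projection from snapshots at the times in `T`. -/
theorem exists_projection_isConcentrated {T : Finset S.Sig} (hT : 2 ≤ T.card) (hTS : T ⊆ S.times)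
    (hrec : ∀ t ∈ T, IsReconstructible (S.obsAdj t) (G.snapshot t)) :
    ∃ C : ℝ, 0 < C ∧ ∀ (f : S.Sig → H) (u : S.Sig → FiniteMeasure S.Ω) (q : ℝ),
      G.IsNearOptimal f u q → ∀ (θ : S.Θ) (Δ : ℝ), 0 < Δ → G.TimeSeparated T θ Δ →
      ∀ μ : FiniteMeasure S.Gam, (∀ t ∈ T, S.move t μ = S.radon θ (u t)) →
      ∃ A, IsConcentrated (μ : Measure S.Gam) G.m
        (fun i z => edist (z : EuclideanSpace ℝ (Fin 2)) (G.projPhase θ i) ^ 2) A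
        (ENNReal.ofReal (C * √(G.noise f)))
        (ENNReal.ofReal (C / min 1 (Δ / 3) ^ 2 * √(G.noise f))) := by
  classical
  obtain ⟨t₁, ht₁, t₂, ht₂, ht⟩ := Finset.one_lt_card.1 (show 1 < T.card by omega)
  have hT0 : T.Nonempty := ⟨t₁, ht₁⟩
  have hTn : Nonempty T := ⟨⟨t₁, ht₁⟩⟩
  choose C' hC' hbound using fun t : T => G.exists_snapshot_bound (hTS t.2) (hrec t t.2)
  let C₀ : ℝ := ∑ t, C' t
  have hC₀ : 0 < C₀ := Finset.sum_pos (fun t _ => hC' t) Finset.univ_nonempty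
  have hC'le : ∀ t, C' t ≤ C₀ := fun t =>
    Finset.single_le_sum (fun t _ => (hC' t).le) (Finset.mem_univ t)
  obtain ⟨c, hc, hcle⟩ := exists_norm_sq_le_sum_sq (fun t : T => moveFunctional (t : S.Sig))
    fun z hz => eq_zero_of_moveFunctional (fun h => ht (Subtype.ext h)) (hz ⟨t₁, ht₁⟩)
      (hz ⟨t₂, ht₂⟩)
  let k : ℝ := Fintype.card T
  have hk : 0 ≤ k := Nat.cast_nonneg _
  refine ⟨c * k * (2 * C₀) + (k + 1) * (3 * C₀), by positivity, ?_⟩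
  intro f u q hu θ Δ hΔ hsep μ hμ
  set ε := √(G.noise f) with hε
  have hε0 : 0 ≤ ε := Real.sqrt_nonneg _
  -- Then `2 * ρ < Δ` makes the cells of different particles disjoint, `ρ ≤ Δ` excludes ghosts, and
  -- `ρ ≤ 1` simplifies the constants.
  set ρ := min 1 (Δ / 3) with hρdef
  have hρ : 0 < ρ := lt_min one_pos (by positivity)
  have hρ1 : ρ ≤ 1 := min_le_left _ _
  have hρΔ : 3 * ρ ≤ Δ := by linarith [min_le_right 1 (Δ / 3)]
  have hp : ∀ t : T, ∀ i j, i ≠ j → 2 * ρ < |moveFunctional (t : S.Sig) (G.projPhase θ i)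
      - moveFunctional (t : S.Sig) (G.projPhase θ j)| := fun t i j hij => by
    have := hsep.lt_abs_sub t.2 hij
    linarith
  have hone : ∀ t : T, IsConcentrated (μ : Measure S.Gam) G.m
      (fun i => sqDist (fun z : S.Gam => moveFunctional (t : S.Sig) (z : EuclideanSpace ℝ (Fin 2)))
        (moveFunctional (t : S.Sig) (G.projPhase θ i)))
      (fun i => {z | |moveFunctional (t : S.Sig) (z : EuclideanSpace ℝ (Fin 2))
        - moveFunctional (t : S.Sig) (G.projPhase θ i)| ≤ ρ})
      (ENNReal.ofReal (2 * C₀ * ε)) (ENNReal.ofReal (3 * C₀ / ρ ^ 2 * ε)) := by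
    intro t
    -- Distinct projections force distinct positions, so the labelled concentration of the snapshot
    -- is available. It passes to `θ · x`, which is 1-Lipschitz, and then to `μ` through the common
    -- law.
    have hinj : Function.Injective (G.loc (t : S.Sig)) := fun i j hij => by
      by_contra hne
      have := hp t i j hne
      rw [moveFunctional_projPhase, moveFunctional_projPhase, hij, sub_self, abs_zero] at this
      linarith
    obtain ⟨A, hA⟩ := (hbound t f u q hu).2 hinj
    have hle : ENNReal.ofReal (C' t * ε) ≤ ENNReal.ofReal (C₀ * ε) :=
      ENNReal.ofReal_le_ofReal (by gcongr; exact hC'le t)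
    refine IsConcentrated.of_map_eq (S.continuous_inner_direction θ).measurable
      (S.continuous_moveCoord t).measurable
      (congrArg FiniteMeasure.toMeasure (hμ t t.2)).symm (hp t)
      (IsConcentrated.recenter_ofReal (S.continuous_inner_direction θ).measurable (by positivity)
        (by positivity) zero_le_one (hA.mono hle hle) (fun i x => ?_) hρ (hp t) ?_ ?_)
    · rw [moveFunctional_projPhase, ENNReal.ofReal_one, one_mul, sqDist, edist_dist,
        ← ENNReal.ofReal_pow dist_nonneg, ← inner_sub_right, dist_eq_norm, ← sq_abs]
      refine ENNReal.ofReal_le_ofReal ?_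
      gcongr
      refine (abs_real_inner_le_norm _ _).trans ?_
      rw [S.norm_direction θ θ.2, one_mul]
    · have : ρ ^ 2 ≤ 1 := pow_le_one₀ hρ.le hρ1
      have : ρ ^ 2 * (C₀ * ε) ≤ 1 * (C₀ * ε) := by gcongr
      linarith
    · have h1 : C₀ * ε ≤ C₀ * ε / ρ ^ 2 :=
        le_div_self (by positivity) (by positivity) (pow_le_one₀ hρ.le hρ1)
      have h2 : 3 * C₀ / ρ ^ 2 * ε = 3 * (C₀ * ε / ρ ^ 2) := by ring
      rw [h2, one_mul]
      linarith
  refine ⟨_, (IsConcentrated.of_observables hone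
    (fun t => (S.continuous_moveCoord t).measurable) ?_ (c := ENNReal.ofReal c)
    ENNReal.ofReal_ne_top (fun i z => edist_sq_le_sum_sqDist hc hcle Subtype.val z _)).mono ?_ ?_⟩
  · intro z i hi
    exact hsep.exists_eq hT0 z.1 i fun t => (hi t).trans (by linarith)
  · rw [ofReal_mul_card_mul _ _ hc.le]
    refine ENNReal.ofReal_le_ofReal ?_
    have : 0 ≤ (k + 1) * (3 * C₀) * ε := by positivity
    change c * k * _ ≤ _
    linarith
  · rw [card_add_one_mul_ofReal]
    refine ENNReal.ofReal_le_ofReal ?_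
    change (k + 1) * _ ≤ _
    calc (k + 1) * (3 * C₀ / ρ ^ 2 * ε) = (k + 1) * (3 * C₀) / ρ ^ 2 * ε := by ring
      _ ≤ _ := by
        gcongr
        have : 0 ≤ c * k * (2 * C₀) := by positivity
        linarith

end GroundTruth


/-! ### Snapshots at arbitrary times from position-velocity projections -/

namespace GroundTruth

variable {S : Setting d H} (G : GroundTruth S)

/-- The mass error `K / ρ ^ 2` is weighted by `r ^ 2 / 2` with `r ≤ ρ`, so the power of `ρ` cancels.
-/
theorem projectionError_le_of_isConcentrated {θ : S.Θ} {γ : S.Θ → FiniteMeasure S.Gam} {ρ K r : ℝ}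
    (hρ : 0 < ρ) (hK : 0 ≤ K) (hr : 0 ≤ r) (hrρ : r ≤ ρ) {A : Fin G.N → Set S.Gam}
    (h : IsConcentrated (γ θ : Measure S.Gam) G.m
      (fun i z => edist (z : EuclideanSpace ℝ (Fin 2)) (G.projPhase θ i) ^ 2) A
      (ENNReal.ofReal K) (ENNReal.ofReal (K / ρ ^ 2))) :
    G.projectionError r γ θ ≤ ENNReal.ofReal ((G.N + 2) * K) := by
  unfold projectionError
  rw [zeroExt_projection]
  refine (unbalancedWasserstein_zeroExt_le S.measurableSet_Gam hK (by positivity) h r).trans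
    (ENNReal.ofReal_le_ofReal ?_)
  rw [Fintype.card_fin]
  have h1 : r ^ 2 * (K / ρ ^ 2) ≤ K := by
    calc r ^ 2 * (K / ρ ^ 2) ≤ ρ ^ 2 * (K / ρ ^ 2) := by gcongr
      _ = K := by field_simp
  have h2 : (G.N + 1) * (r ^ 2 * (K / ρ ^ 2)) ≤ (G.N + 1) * K := by gcongr
  have h3 : 0 ≤ (G.N + 1) * (r ^ 2 * (K / ρ ^ 2)) := by positivity
  calc K + r ^ 2 / 2 * ((G.N + 1) * (K / ρ ^ 2))
      = K + (G.N + 1) * (r ^ 2 * (K / ρ ^ 2)) / 2 := by ring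
    _ ≤ _ := by linarith

/-- A finite set of directions suffices to detect ghost particles: for each assignment `τ` of
particles to the directions of a spanning set `b` one more direction refutes all ghost particles
that belong to `τ`. -/
theorem DirSeparated.exists_refuting_direction {G : GroundTruth S} {D : Set S.Θ} {t : S.Sig}
    {Δ : ℝ} (h : G.DirSeparated D t Δ) {b : Set (EuclideanSpace ℝ (Fin d))} {w : b → S.Θ}
    (hw : ∀ k, (w k : EuclideanSpace ℝ (Fin d)) = k) (hwD : ∀ k, w k ∈ D) [Nonempty b]
    {B ρ : ℝ} (hρ : 0 ≤ ρ) (hB : 0 ≤ B)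
    (hBρ : ∀ (r : ℝ) (x : EuclideanSpace ℝ (Fin d)), 0 ≤ r →
      (∀ k : b, |⟪(k : EuclideanSpace ℝ (Fin d)), x⟫_ℝ| ≤ r) → ‖x‖ ≤ B * r)
    (hρΔ : (1 + 2 * B) * ρ ≤ Δ) (τ : b → Fin G.N) :
    ∃ e ∈ D, (¬ ∃ j, ∀ k, τ k = j) → ∀ x : EuclideanSpace ℝ (Fin d),
      (∀ k : b, |⟪(k : EuclideanSpace ℝ (Fin d)), x⟫_ℝ
        - ⟪(k : EuclideanSpace ℝ (Fin d)), G.loc t (τ k)⟫_ℝ| ≤ ρ) →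
      ∀ j, ρ < |⟪(e : EuclideanSpace ℝ (Fin d)), x⟫_ℝ
        - ⟪(e : EuclideanSpace ℝ (Fin d)), G.loc t j⟫_ℝ| := by
  classical
  let k₀ : b := Classical.arbitrary b
  -- If `τ` is constant or no point realizes it, any direction will do. Otherwise one realizing
  -- point `p` is fixed; the direction refuting it will refute all others.
  by_cases hτ : (¬ ∃ j, ∀ k, τ k = j) ∧ ∃ p : EuclideanSpace ℝ (Fin d),
      ∀ k : b, |⟪(k : EuclideanSpace ℝ (Fin d)), p⟫_ℝ
        - ⟪(k : EuclideanSpace ℝ (Fin d)), G.loc t (τ k)⟫_ℝ| ≤ ρ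
  swap
  · exact ⟨w k₀, hwD k₀, fun hc x hx => (hτ ⟨hc, x, hx⟩).elim⟩
  obtain ⟨hc, p, hp⟩ := hτ
  have hρΔ' : ρ ≤ Δ := by nlinarith [mul_nonneg hB hρ]
  -- If `p` were `Δ`-close to some particle in every direction of `D`, then `τ` on `b` and these
  -- particles elsewhere would make it a `Δ`-ghost.
  have hex : ∃ e ∈ D, ∀ j, Δ < |⟪(e : EuclideanSpace ℝ (Fin d)), p⟫_ℝ
      - ⟪(e : EuclideanSpace ℝ (Fin d)), G.loc t j⟫_ℝ| := by
    by_contra hcon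
    push Not at hcon
    have : Nonempty (Fin G.N) := ⟨τ k₀⟩
    choose! J hJ using hcon
    let i : EuclideanSpace ℝ (Fin d) → Fin G.N := fun e =>
      if he : e ∈ b then τ ⟨e, he⟩ else
        if he' : e ∈ S.Θ then J ⟨e, he'⟩ else τ k₀
    have hib : ∀ k : b, i k = τ k := fun k => by simp [i]
    obtain ⟨k₁, hk₁⟩ := not_forall.1 (not_exists.1 hc (τ k₀))
    refine h.2 ⟨p, i, ⟨k₁, ⟨w k₁, hwD k₁, hw k₁⟩, k₀, ⟨w k₀, hwD k₀, hw k₀⟩, ?_⟩, ?_⟩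
    · rw [hib, hib]; exact hk₁
    · rintro _ ⟨e, he, rfl⟩
      rw [Real.dist_eq]
      by_cases heb : (e : EuclideanSpace ℝ (Fin d)) ∈ b
      · have := hp ⟨e, heb⟩
        rw [← hib ⟨e, heb⟩] at this
        exact this.trans hρΔ'
      · have : i e = J e := by simp [i, heb]
        rw [this]
        exact hJ e he
  obtain ⟨e, heD, he⟩ := hex
  refine ⟨e, heD, fun _ x hx j => ?_⟩
  -- Points realizing the same `τ` are `2 * B * ρ`-close, so `x` keeps distance more than `Δ - 2 * B
  -- * ρ ≥ ρ` from all particles in direction `e`.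
  have hxp : ‖p - x‖ ≤ B * (2 * ρ) := by
    refine hBρ _ _ (by positivity) fun k => ?_
    rw [inner_sub_right]
    have h1 := abs_sub_le ⟪(k : EuclideanSpace ℝ (Fin d)), p⟫_ℝ
      ⟪(k : EuclideanSpace ℝ (Fin d)), G.loc t (τ k)⟫_ℝ ⟪(k : EuclideanSpace ℝ (Fin d)), x⟫_ℝ
    have h2 := hx k
    rw [abs_sub_comm] at h2
    linarith [hp k]
  have h1 : |⟪(e : EuclideanSpace ℝ (Fin d)), p⟫_ℝ - ⟪(e : EuclideanSpace ℝ (Fin d)), x⟫_ℝ|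
      ≤ B * (2 * ρ) := by
    rw [← inner_sub_right]
    refine (abs_real_inner_le_norm _ _).trans ?_
    rw [S.norm_direction e e.2, one_mul]
    exact hxp
  have h2 := abs_sub_le ⟪(e : EuclideanSpace ℝ (Fin d)), p⟫_ℝ
    ⟪(e : EuclideanSpace ℝ (Fin d)), x⟫_ℝ ⟪(e : EuclideanSpace ℝ (Fin d)), G.loc t j⟫_ℝ
  have h3 := he j
  nlinarith

theorem exists_finite_spanning {D : Set S.Θ} (hD : Submodule.span ℝ (Subtype.val '' D) = ⊤) :
    ∃ (b : Set (EuclideanSpace ℝ (Fin d))) (_ : Fintype b) (w : b → S.Θ),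
      (∀ k, (w k : EuclideanSpace ℝ (Fin d)) = k) ∧ (∀ k, w k ∈ D) ∧ Nonempty b ∧
      ∃ c : ℝ, 0 < c ∧ ∀ x : EuclideanSpace ℝ (Fin d),
        ‖x‖ ^ 2 ≤ c * ∑ k : b, ⟪(k : EuclideanSpace ℝ (Fin d)), x⟫_ℝ ^ 2 := by
  obtain ⟨b, hb, hspan, hli⟩ := exists_linearIndependent ℝ
    (Subtype.val '' D : Set (EuclideanSpace ℝ (Fin d)))
  have hfin : b.Finite := hli.setFinite
  have : Fintype b := hfin.fintype
  choose w hw using fun k : b => hb k.2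
  obtain ⟨c, hc, hcle⟩ := exists_norm_sq_le_sum_sq
    (fun k : b => (innerSL ℝ (k : EuclideanSpace ℝ (Fin d))).toLinearMap) (fun x hx => by
      have hx' : ∀ y ∈ Submodule.span ℝ b, ⟪y, x⟫_ℝ = 0 := fun y hy => by
        induction hy using Submodule.span_induction with
        | mem y hy => exact hx ⟨y, hy⟩
        | zero => exact inner_zero_left _
        | add y z _ _ h1 h2 => rw [inner_add_left, h1, h2, add_zero]
        | smul a y _ h1 => rw [inner_smul_left, h1, mul_zero]
      have := hx' x (by rw [hspan, hD]; trivial)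
      exact inner_self_eq_zero.1 this)
  refine ⟨b, this, w, fun k => (hw k).2, fun k => (hw k).1, ?_, c, hc, hcle⟩
  -- With `b` empty the estimate would annihilate a unit vector, and `Θ` contains one because it
  -- carries a probability measure.
  by_contra hemp
  rw [not_nonempty_iff] at hemp
  obtain ⟨θ⟩ := S.HΘ.nonempty_of_neZero
  have := hcle θ
  rw [S.norm_direction θ θ.2] at this
  simp at this
  linarith

/-- The estimate of a snapshot from position-velocity projections in a spanning set of
directions. -/
theorem exists_snapshot_bound_of_projections {D : Set S.Θ}
    (hD : Submodule.span ℝ (Subtype.val '' D) = ⊤) :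
    ∃ C : ℝ, 0 < C ∧ ∀ (u : S.Sig → FiniteMeasure S.Ω) (t : S.Sig) (Δ K r : ℝ), 0 < Δ → 0 ≤ K →
      0 ≤ r → r ≤ radiusTime 1 Δ t → G.DirSeparated D t Δ →
      (∀ θ ∈ D, ∃ μ : FiniteMeasure S.Gam, S.move t μ = S.radon θ (u t) ∧
        ∃ A, IsConcentrated (μ : Measure S.Gam) G.m
          (fun i z => edist (z : EuclideanSpace ℝ (Fin 2)) (G.projPhase θ i) ^ 2) A
          (ENNReal.ofReal K) (ENNReal.ofReal (K / min 1 (Δ / 3) ^ 2))) →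
      G.snapshotError r u t ≤ ENNReal.ofReal (C * (1 + (t : ℝ) ^ 2) * K) := by
  classical
  obtain ⟨b, hbf, w, hw, hwD, hbn, c, hc, hcle⟩ := exists_finite_spanning hD
  let B : ℝ := √(c * Fintype.card b)
  have hB : 0 ≤ B := Real.sqrt_nonneg _
  have hBρ : ∀ (r : ℝ) (x : EuclideanSpace ℝ (Fin d)), 0 ≤ r →
      (∀ k : b, |⟪(k : EuclideanSpace ℝ (Fin d)), x⟫_ℝ| ≤ r) → ‖x‖ ≤ B * r := by
    intro r x hr hx
    refine abs_le_of_sq_le_sq' ?_ (by positivity) |>.2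
    rw [mul_pow, Real.sq_sqrt (by positivity)]
    refine (hcle x).trans ?_
    calc c * ∑ k : b, ⟪(k : EuclideanSpace ℝ (Fin d)), x⟫_ℝ ^ 2 ≤ c * ∑ _k : b, r ^ 2 := by
          gcongr ?_ * ?_
          exact Finset.sum_le_sum fun k _ => sq_le_sq' (abs_le.1 (hx k)).1 (abs_le.1 (hx k)).2
      _ = c * Fintype.card b * r ^ 2 := by simp [mul_assoc]
  -- The cell radius will be `ρ = α * (s * R)`, so that `(1 + 2 * B) * ρ = s * R ≤ Δ / 3`, as a
  -- single refuting direction per assignment requires. The factor depends on `D` alone.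
  let α : ℝ := (1 + 2 * B)⁻¹
  have hα : 0 < α := by positivity
  have hα1 : α ≤ 1 := inv_le_one_of_one_le₀ (by linarith)
  let n : ℝ := Fintype.card (b ⊕ (b → Fin G.N))
  have hn : 0 ≤ n := Nat.cast_nonneg _
  refine ⟨2 * c * n + (G.N + 1) * (n + 1) * (3 / α ^ 2) + 1, by positivity, ?_⟩
  intro u t Δ K r hΔ hK hr hrR hsep hμ
  set R := radiusTime 1 Δ t with hRdef
  set s := √(1 + (t : ℝ) ^ 2) with hs
  have hs2 : s ^ 2 = 1 + (t : ℝ) ^ 2 := Real.sq_sqrt (by positivity)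
  have hs1 : 1 ≤ s := Real.one_le_sqrt.2 (by nlinarith [sq_nonneg (t : ℝ)])
  have hs0 : 0 < s := by linarith
  have hR : 0 < R := lt_min one_pos (by positivity)
  set r₀ := min 1 (Δ / 3) with hr₀
  have hRr₀ : R ≤ r₀ := by
    refine min_le_min le_rfl ?_
    rw [← hs]
    exact div_le_div_of_nonneg_left hΔ.le (by norm_num) (by linarith)
  have hsR : s * R ≤ Δ / 3 := by
    have : R ≤ Δ / (3 * s) := min_le_right _ _
    calc s * R ≤ s * (Δ / (3 * s)) := by gcongr
      _ = Δ / 3 := by field_simp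
  let ρ : ℝ := α * (s * R)
  have hρ : 0 < ρ := by positivity
  have hρα : (1 + 2 * B) * ρ = s * R := by
    simp only [ρ, α]; field_simp
  have hρΔ : (1 + 2 * B) * ρ ≤ Δ := by rw [hρα]; linarith
  have hρs : ρ ≤ s * R := mul_le_of_le_one_left (by positivity) hα1
  choose e heD he using fun τ : b → Fin G.N =>
    hsep.exists_refuting_direction hw hwD hρ.le hB hBρ hρΔ τ
  let κ := b ⊕ (b → Fin G.N)
  let v : κ → S.Θ := Sum.elim w e
  have hvD : ∀ k, v k ∈ D := fun k => by
    rcases k with k | τ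
    · exact hwD k
    · exact heD τ
  have hlt : ∀ θ ∈ D, ∀ i j, i ≠ j → Δ < |⟪(θ : EuclideanSpace ℝ (Fin d)), G.loc t i⟫_ℝ
      - ⟪(θ : EuclideanSpace ℝ (Fin d)), G.loc t j⟫_ℝ| := fun θ hθ i j hij => by
    by_contra hcon
    exact hsep.1 ⟨θ, ⟨θ, hθ, rfl⟩, j, i, hij.symm, by rw [Real.dist_eq]; exact not_lt.1 hcon⟩
  have hp : ∀ k, ∀ i j, i ≠ j → 2 * ρ < |⟪(v k : EuclideanSpace ℝ (Fin d)), G.loc t i⟫_ℝ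
      - ⟪(v k : EuclideanSpace ℝ (Fin d)), G.loc t j⟫_ℝ| := fun k i j hij => by
    have := hlt (v k) (hvD k) i j hij
    linarith
  have hone : ∀ k, IsConcentrated (u t : Measure S.Ω) G.m
      (fun i => sqDist (fun x : S.Ω =>
          ⟪(v k : EuclideanSpace ℝ (Fin d)), (x : EuclideanSpace ℝ (Fin d))⟫_ℝ)
        ⟪(v k : EuclideanSpace ℝ (Fin d)), G.loc t i⟫_ℝ)
      (fun i => {x | |⟪(v k : EuclideanSpace ℝ (Fin d)), (x : EuclideanSpace ℝ (Fin d))⟫_ℝ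
        - ⟪(v k : EuclideanSpace ℝ (Fin d)), G.loc t i⟫_ℝ| ≤ ρ})
      (ENNReal.ofReal (2 * s ^ 2 * K)) (ENNReal.ofReal (3 * K / (α ^ 2 * R ^ 2))) := by
    intro k
    obtain ⟨μ, hmove, A, hA⟩ := hμ (v k) (hvD k)
    have hKR : K / r₀ ^ 2 ≤ K / R ^ 2 := by gcongr
    refine IsConcentrated.of_map_eq (S.continuous_moveCoord t).measurable
      (S.continuous_inner_direction (v k)).measurable
      (congrArg FiniteMeasure.toMeasure hmove) (hp k)
      (IsConcentrated.recenter_ofReal (S.continuous_moveCoord t).measurable hK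
        (by positivity) (sq_nonneg s) hA (fun i z => ?_) hρ (hp k) ?_ ?_)
    · rw [← moveFunctional_projPhase, sqDist, edist_dist, ← ENNReal.ofReal_pow dist_nonneg,
        ← ENNReal.ofReal_mul (by positivity), hs2, dist_eq_norm]
      refine ENNReal.ofReal_le_ofReal ((le_of_eq ?_).trans (sq_moveFunctional_le (t : ℝ) _))
      rw [map_sub]
      rfl
    · have h1 : ρ ^ 2 * (K / r₀ ^ 2) ≤ (s * R) ^ 2 * (K / R ^ 2) := by gcongr
      have h2 : (s * R) ^ 2 * (K / R ^ 2) = s ^ 2 * K := by field_simp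
      linarith
    · have h1 : s ^ 2 * K / ρ ^ 2 = K / (α ^ 2 * R ^ 2) := by
        simp only [ρ]; field_simp
      have h2 : K / R ^ 2 ≤ K / (α ^ 2 * R ^ 2) := by
        refine div_le_div_of_nonneg_left hK (by positivity) ?_
        exact mul_le_of_le_one_left (by positivity) (pow_le_one₀ hα.le hα1)
      rw [h1, mul_div_assoc 3 K]
      linarith
  -- If the indices over the basis equal `j`, then `x` is `B * ρ`-close to particle `j`, and another
  -- index in any direction would contradict the separation by `Δ`. If they are not constant, the
  -- refuting direction of that assignment excludes `x`.
  have hcomb : ∀ (x : S.Ω) (i : κ → Fin G.N),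
      (∀ k, |⟪(v k : EuclideanSpace ℝ (Fin d)), (x : EuclideanSpace ℝ (Fin d))⟫_ℝ
        - ⟪(v k : EuclideanSpace ℝ (Fin d)), G.loc t (i k)⟫_ℝ| ≤ ρ) → ∃ j, ∀ k, i k = j := by
    intro x i hi
    have hib : ∀ k : b, |⟪(k : EuclideanSpace ℝ (Fin d)), (x : EuclideanSpace ℝ (Fin d))⟫_ℝ
        - ⟪(k : EuclideanSpace ℝ (Fin d)), G.loc t (i (Sum.inl k))⟫_ℝ| ≤ ρ := fun k => by
      have := hi (Sum.inl k)
      simp only [v, Sum.elim_inl, hw] at this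
      exact this
    by_cases hconst : ∃ j, ∀ k : b, i (Sum.inl k) = j
    · obtain ⟨j, hj⟩ := hconst
      refine ⟨j, fun k => ?_⟩
      by_contra hne
      have hx : ‖(x : EuclideanSpace ℝ (Fin d)) - G.loc t j‖ ≤ B * ρ := by
        refine hBρ ρ _ hρ.le fun k => ?_
        rw [inner_sub_right, ← hj k]
        exact hib k
      have h1 : |⟪(v k : EuclideanSpace ℝ (Fin d)), (x : EuclideanSpace ℝ (Fin d))⟫_ℝ
          - ⟪(v k : EuclideanSpace ℝ (Fin d)), G.loc t j⟫_ℝ| ≤ B * ρ := by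
        rw [← inner_sub_right]
        refine (abs_real_inner_le_norm _ _).trans ?_
        rw [S.norm_direction _ (v k).2, one_mul]
        exact hx
      have h2 := hlt (v k) (hvD k) _ _ hne
      have h3 := abs_sub_le ⟪(v k : EuclideanSpace ℝ (Fin d)), G.loc t (i k)⟫_ℝ
        ⟪(v k : EuclideanSpace ℝ (Fin d)), (x : EuclideanSpace ℝ (Fin d))⟫_ℝ
        ⟪(v k : EuclideanSpace ℝ (Fin d)), G.loc t j⟫_ℝ
      have h4 := hi k
      rw [abs_sub_comm] at h4
      nlinarith [mul_nonneg hB hρ.le]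
    · exact ((he (fun k => i (Sum.inl k)) hconst x hib _).not_ge
        (hi (Sum.inr fun k => i (Sum.inl k)))).elim
  have hcle' : ∀ x : EuclideanSpace ℝ (Fin d), ‖x‖ ^ 2 ≤
      c * ∑ k, (innerSL ℝ (v k : EuclideanSpace ℝ (Fin d))).toLinearMap x ^ 2 := fun x => by
    refine (hcle x).trans ?_
    gcongr
    rw [Fintype.sum_sum_type]
    refine le_add_of_le_of_nonneg (le_of_eq (Finset.sum_congr rfl fun k _ => ?_))
      (Finset.sum_nonneg fun _ _ => sq_nonneg _)
    simp [v, hw]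
  have hκ : Nonempty κ := ⟨Sum.inl (Classical.arbitrary b)⟩
  have hall := IsConcentrated.of_observables hone
    (fun k => (S.continuous_inner_direction (v k)).measurable) hcomb (c := ENNReal.ofReal c)
    ENNReal.ofReal_ne_top (fun i x => edist_sq_le_sum_sqDist hc hcle' Subtype.val x (G.loc t i))
  rw [ofReal_mul_card_mul _ _ hc.le, card_add_one_mul_ofReal] at hall
  unfold snapshotError
  rw [zeroExt_snapshot]
  refine (unbalancedWasserstein_zeroExt_le S.Ω.isCompact.measurableSet (by positivity)
    (by positivity) hall r).trans (ENNReal.ofReal_le_ofReal ?_)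
  rw [Fintype.card_fin, ← hs2]
  change c * n * (2 * s ^ 2 * K) + r ^ 2 / 2 * ((G.N + 1) * ((n + 1) *
    (3 * K / (α ^ 2 * R ^ 2)))) ≤ _
  have h1 : r ^ 2 / 2 ≤ R ^ 2 := by
    have : r ^ 2 ≤ R ^ 2 := by gcongr
    linarith [sq_nonneg r]
  have h2 : r ^ 2 / 2 * ((G.N + 1) * ((n + 1) * (3 * K / (α ^ 2 * R ^ 2)))) ≤
      s ^ 2 * ((G.N + 1) * (n + 1) * (3 / α ^ 2) * K) := by
    calc r ^ 2 / 2 * ((G.N + 1) * ((n + 1) * (3 * K / (α ^ 2 * R ^ 2))))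
        ≤ R ^ 2 * ((G.N + 1) * ((n + 1) * (3 * K / (α ^ 2 * R ^ 2)))) := by gcongr
      _ = 1 * ((G.N + 1) * (n + 1) * (3 / α ^ 2) * K) := by field_simp
      _ ≤ _ := by
        gcongr
        exact one_le_pow₀ hs1
  have h3 : 0 ≤ s ^ 2 * K := by positivity
  calc c * n * (2 * s ^ 2 * K) + r ^ 2 / 2 * ((G.N + 1) * ((n + 1) *
        (3 * K / (α ^ 2 * R ^ 2))))
      ≤ c * n * (2 * s ^ 2 * K) + s ^ 2 * ((G.N + 1) * (n + 1) * (3 / α ^ 2) * K)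
        + s ^ 2 * K := by linarith
    _ = _ := by ring

end GroundTruth


theorem exists_pos_le_of_finite {ι : Type*} [Finite ι] {f : ι → ℝ} (h : ∀ i, 0 < f i) :
    ∃ δ, 0 < δ ∧ ∀ i, δ ≤ f i := by
  rcases isEmpty_or_nonempty ι with hι | hι
  · exact ⟨1, one_pos, fun i => (hι.false i).elim⟩
  · obtain ⟨i, hi⟩ := Finite.exists_min f
    exact ⟨f i, h i, hi⟩

namespace GroundTruth

variable {S : Setting d H} (G : GroundTruth S)

/-! ### Uniform separation on compact sets -/

theorem moveFunctional_projPhase_ne {T : Finset S.Sig} {θ : S.Θ}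
    (h : ¬ HasCoincidence (G.projPos θ) (G.projVel θ) (Subtype.val '' (T : Set S.Sig)))
    {t : S.Sig} (ht : t ∈ T) {i j : Fin G.N} (hij : i ≠ j) :
    moveFunctional t (G.projPhase θ i) ≠ moveFunctional t (G.projPhase θ j) := by
  intro heq
  refine h ⟨t, ⟨t, ht, rfl⟩, i, j, hij, ?_⟩
  rw [projPos_add_smul, projPos_add_smul, ← moveFunctional_projPhase,
    ← moveFunctional_projPhase, heq]

theorem continuous_moveFunctional_projPhase (t : ℝ) (i : Fin G.N) :
    Continuous fun θ : S.Θ => moveFunctional t (G.projPhase θ i) := by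
  simp only [moveFunctional_projPhase]
  fun_prop

/-- A ghost following an assignment `τ` exists exactly if the vector of its prescribed places lies
in the closed subspace of all straight motions. The distance to that subspace is continuous in `θ`,
so it has a positive lower bound on `D`; there are only finitely many assignments. -/
theorem exists_uniform_timeSeparated (T : Finset S.Sig) {D : Set S.Θ}
    (hD : IsCompact D) (h : ∀ θ ∈ D,
      ¬ HasCoincidence (G.projPos θ) (G.projVel θ) (Subtype.val '' (T : Set S.Sig)) ∧
      ¬ HasGhost (G.projPos θ) (G.projVel θ) (Subtype.val '' (T : Set S.Sig))) :
    ∃ Δ : ℝ, 0 < Δ ∧ ∀ θ ∈ D, G.TimeSeparated T θ Δ := by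
  classical
  have hco : ∀ p : T × {q : Fin G.N × Fin G.N // q.1 ≠ q.2}, ∃ δ : ℝ, 0 < δ ∧ ∀ θ ∈ D,
      δ ≤ dist (moveFunctional (p.1 : S.Sig) (G.projPhase θ p.2.1.1))
        (moveFunctional (p.1 : S.Sig) (G.projPhase θ p.2.1.2)) := fun p => by
    refine hD.exists_forall_le' (Continuous.continuousOn ?_) fun θ hθ =>
      dist_pos.2 (G.moveFunctional_projPhase_ne (h θ hθ).1 p.1.2 p.2.2)
    exact (G.continuous_moveFunctional_projPhase _ _).dist
      (G.continuous_moveFunctional_projPhase _ _)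
  let L : EuclideanSpace ℝ (Fin 2) →ₗ[ℝ] (T → ℝ) :=
    LinearMap.pi fun t : T => moveFunctional (t : S.Sig)
  have hL : IsClosed (LinearMap.range L : Set (T → ℝ)) := Submodule.closed_of_finiteDimensional _
  have hgh : ∀ τ : {τ : T → Fin G.N // ∃ t t', τ t ≠ τ t'}, ∃ δ : ℝ, 0 < δ ∧ ∀ θ ∈ D,
      δ ≤ Metric.infDist (fun t : T => moveFunctional (t : S.Sig) (G.projPhase θ (τ.1 t)))
        (LinearMap.range L : Set (T → ℝ)) := fun τ => by
    refine hD.exists_forall_le' (Continuous.continuousOn ?_) fun θ hθ =>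
      (hL.notMem_iff_infDist_pos ⟨0, Submodule.zero_mem _⟩).1 ?_
    · exact (Metric.continuous_infDist_pt _).comp
        (continuous_pi fun t => G.continuous_moveFunctional_projPhase _ _)
    · rintro ⟨z, hz⟩
      have hz' : ∀ t : T, moveFunctional (t : S.Sig) z =
          moveFunctional (t : S.Sig) (G.projPhase θ (τ.1 t)) := fun t => congrFun hz t
      obtain ⟨t, t', htt'⟩ := τ.2
      -- `HasGhost` excludes true particles whereas a `Δ`-ghost excludes constant assignments.
      -- Without coincidences a true particle is followed only by a constant assignment, so the two
      -- agree.
      refine (h θ hθ).2 ⟨z 0, z 1, fun j hj => htt' ?_, ?_⟩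
      · have hzj : z = G.projPhase θ j := by
          ext i
          fin_cases i
          · exact congrArg Prod.fst hj
          · exact congrArg Prod.snd hj
        have hτ : ∀ t, τ.1 t = j := fun t => by
          by_contra hne
          exact G.moveFunctional_projPhase_ne (h θ hθ).1 t.2 hne (by rw [← hz' t, hzj])
        rw [hτ, hτ]
      · rintro _ ⟨t, ht, rfl⟩
        refine ⟨τ.1 ⟨t, ht⟩, ?_⟩
        rw [projPos_add_smul, ← moveFunctional_projPhase]
        exact hz' ⟨t, ht⟩
  choose δ₁ hδ₁ hco using hco
  choose δ₂ hδ₂ hgh using hgh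
  obtain ⟨a, ha, hale⟩ := exists_pos_le_of_finite hδ₁
  obtain ⟨b, hb, hble⟩ := exists_pos_le_of_finite hδ₂
  have hab : 0 < min a b := lt_min ha hb
  refine ⟨min a b / 2, by positivity, fun θ hθ => ⟨?_, ?_⟩⟩
  · rintro ⟨_, ⟨t, ht, rfl⟩, i, j, hij, hd⟩
    rw [projPos_add_smul, projPos_add_smul, ← moveFunctional_projPhase,
      ← moveFunctional_projPhase, dist_comm] at hd
    have h1 := hco (⟨t, ht⟩, ⟨(i, j), hij⟩) θ hθ
    have h2 := hale (⟨t, ht⟩, ⟨(i, j), hij⟩)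
    have h3 := min_le_left a b
    simp only at h1
    linarith
  · rintro ⟨y, w, i, ⟨_, ⟨t, ht, rfl⟩, _, ⟨t', ht', rfl⟩, hne⟩, hd⟩
    let τ : {τ : T → Fin G.N // ∃ t t', τ t ≠ τ t'} :=
      ⟨fun t => i (t : S.Sig), ⟨t, ht⟩, ⟨t', ht'⟩, hne⟩
    have h1 : Metric.infDist (fun t : T => moveFunctional (t : S.Sig) (G.projPhase θ (τ.1 t)))
        (LinearMap.range L : Set (T → ℝ)) ≤ min a b / 2 := by
      refine (Metric.infDist_le_dist_of_mem (LinearMap.mem_range_self L !₂[y, w])).trans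
        ((dist_pi_le_iff (by positivity)).2 fun t => ?_)
      have := hd t ⟨t, t.2, rfl⟩
      rw [projPos_add_smul, ← moveFunctional_projPhase, dist_comm] at this
      exact this
    have h2 := hgh τ θ hθ
    have h3 := hble τ
    have h4 := min_le_right a b
    linarith

/-- At a single time, a particle's place combined with a velocity that no particle has is a ghost.
-/
theorem two_le_card_of_not_hasGhost (hN : G.N ≠ 0) {T : Finset S.Sig} (hT : T.Nonempty) {θ : S.Θ}
    (h : ¬ HasGhost (G.projPos θ) (G.projVel θ) (Subtype.val '' (T : Set S.Sig))) :
    2 ≤ T.card := by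
  by_contra hcon
  have h1 : T.card = 1 := by have := hT.card_pos; omega
  obtain ⟨t, rfl⟩ := Finset.card_eq_one.1 h1
  let i₀ : Fin G.N := ⟨0, Nat.pos_of_ne_zero hN⟩
  obtain ⟨w, hw⟩ := (Set.finite_range (G.projVel θ)).exists_notMem
  refine h ⟨G.projPos θ i₀ + (t : ℝ) • G.projVel θ i₀ - (t : ℝ) • w, w, fun i hi => hw ?_, ?_⟩
  · exact ⟨i, (congrArg Prod.snd hi).symm⟩
  · rintro _ ⟨s, hs, rfl⟩
    rw [Finset.mem_coe, Finset.mem_singleton] at hs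
    subst hs
    exact ⟨i₀, by simp⟩

/-- Translates of `A` along a vector orthogonal to `D` have the same projections, so all would
coincide with the finite set `A`. -/
theorem span_eq_top_of_isDeterminedByProjections {F : Type*} [NormedAddCommGroup F]
    [InnerProductSpace ℝ F] [FiniteDimensional ℝ F] {A D : Set F} (hA : A.Finite)
    (hne : A.Nonempty) (h : IsDeterminedByProjections A D) : Submodule.span ℝ D = ⊤ := by
  by_contra hcon
  have hperp : (Submodule.span ℝ D)ᗮ ≠ ⊥ := fun h' => hcon (Submodule.orthogonal_eq_bot_iff.1 h')
  obtain ⟨n, hn, hn0⟩ := Submodule.exists_mem_ne_zero_of_ne_bot hperp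
  have hmem : ∀ k : ℕ, ∀ a ∈ A, a + (k : ℝ) • n ∈ A := by
    intro k a ha
    have hB := h ((fun a => a + (k : ℝ) • n) '' A) (hA.image _) fun θ hθ => by
      rw [Set.image_image]
      refine Set.image_congr fun a _ => ?_
      have : ⟪θ, n⟫_ℝ = 0 := hn θ (Submodule.subset_span hθ)
      simp only [inner_add_right, inner_smul_right, this, mul_zero, add_zero]
    rw [← hB]
    exact ⟨a, ha, rfl⟩
  obtain ⟨a, ha⟩ := hne
  refine Set.infinite_range_of_injective (f := fun k : ℕ => a + (k : ℝ) • n) (fun k l hkl => ?_)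
    (hA.subset ?_)
  · have h1 : (k : ℝ) • n = (l : ℝ) • n := add_left_cancel hkl
    exact_mod_cast smul_left_injective ℝ hn0 h1
  · rintro _ ⟨k, rfl⟩
    exact hmem k a ha

theorem continuous_loc (i : Fin G.N) : Continuous fun t : S.Sig => G.loc t i := by
  unfold loc; fun_prop

/-- `D` may be infinite, so minimizing over assignments as for times is unavailable. Instead a ghost
threshold is found locally in time and place, and compactness makes it uniform. -/
theorem exists_uniform_dirSeparated {D : Set S.Θ} (hD : IsCompact D)
    (hspan : Submodule.span ℝ (Subtype.val '' D) = ⊤) {Sbar : Set S.Sig} (hS : IsCompact Sbar)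
    (h : ∀ t ∈ Sbar,
      (∀ θ ∈ D, ∀ i j, i ≠ j →
        0 < dist (⟪(θ : EuclideanSpace ℝ (Fin d)), G.loc t i⟫_ℝ)
          (⟪(θ : EuclideanSpace ℝ (Fin d)), G.loc t j⟫_ℝ)) ∧
      IsDeterminedByProjections (Set.range (G.loc t)) (Subtype.val '' D)) :
    ∃ Δ : ℝ, 0 < Δ ∧ ∀ t ∈ Sbar, G.DirSeparated D t Δ := by
  classical
  have hco : ∀ p : {q : Fin G.N × Fin G.N // q.1 ≠ q.2}, ∃ δ : ℝ, 0 < δ ∧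
      ∀ z ∈ Sbar ×ˢ D, δ ≤ dist (⟪(z.2 : EuclideanSpace ℝ (Fin d)), G.loc z.1 p.1.1⟫_ℝ)
        (⟪(z.2 : EuclideanSpace ℝ (Fin d)), G.loc z.1 p.1.2⟫_ℝ) := fun p => by
    refine (hS.prod hD).exists_forall_le' (Continuous.continuousOn ?_) fun z hz =>
      (h z.1 hz.1).1 z.2 hz.2 _ _ p.2
    have h1 := (G.continuous_loc p.1.1).comp (continuous_fst (X := S.Sig) (Y := S.Θ))
    have h2 := (G.continuous_loc p.1.2).comp (continuous_fst (X := S.Sig) (Y := S.Θ))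
    have h3 := continuous_subtype_val.comp (continuous_snd (X := S.Sig) (Y := S.Θ))
    exact (h3.inner h1).dist (h3.inner h2)
  choose δ₁ hδ₁ hco using hco
  obtain ⟨g, hg, hgle⟩ := exists_pos_le_of_finite hδ₁
  have hgap : ∀ t ∈ Sbar, ∀ θ ∈ D, ∀ i j, i ≠ j →
      g ≤ dist (⟪(θ : EuclideanSpace ℝ (Fin d)), G.loc t i⟫_ℝ)
        (⟪(θ : EuclideanSpace ℝ (Fin d)), G.loc t j⟫_ℝ) := fun t ht θ hθ i j hij =>
    (hgle ⟨(i, j), hij⟩).trans (hco ⟨(i, j), hij⟩ (t, θ) ⟨ht, hθ⟩)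
  have hinner : ∀ (θ : S.Θ) (x : EuclideanSpace ℝ (Fin d)),
      |⟪(θ : EuclideanSpace ℝ (Fin d)), x⟫_ℝ| ≤ ‖x‖ := fun θ x => by
    refine (abs_real_inner_le_norm _ _).trans ?_
    rw [S.norm_direction θ θ.2, one_mul]
  -- ghost particles stay in a bounded set
  obtain ⟨b, hbf, w, hw, hwD, -, c, hc, hcle⟩ := exists_finite_spanning hspan
  obtain ⟨M, hM⟩ := S.Ω.isCompact.isBounded.exists_norm_le
  have hloc : ∀ (t : S.Sig) i, ‖G.loc t i‖ ≤ M := fun t i => hM _ ((G.particle i).2 t t.2)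
  let Y : ℝ := √(c * Fintype.card b * (1 + M) ^ 2)
  have hY : ∀ (t : S.Sig) (y : EuclideanSpace ℝ (Fin d)) (i : EuclideanSpace ℝ (Fin d) → Fin G.N),
      (∀ θ ∈ Subtype.val '' D, dist (⟪θ, y⟫_ℝ) (⟪θ, G.loc t (i θ)⟫_ℝ) ≤ 1) →
      y ∈ Metric.closedBall (0 : EuclideanSpace ℝ (Fin d)) Y := fun t y i hi => by
    rw [mem_closedBall_zero_iff]
    refine Real.le_sqrt_of_sq_le ((hcle y).trans ?_)
    rw [mul_assoc]
    gcongr ?_ * ?_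
    calc ∑ k : b, ⟪(k : EuclideanSpace ℝ (Fin d)), y⟫_ℝ ^ 2 ≤ ∑ _k : b, (1 + M) ^ 2 := by
          refine Finset.sum_le_sum fun k _ => ?_
          have h1 : |⟪(k : EuclideanSpace ℝ (Fin d)), y⟫_ℝ| ≤ 1 + M := by
            have h2 := hi k ⟨w k, hwD k, hw k⟩
            rw [Real.dist_eq] at h2
            have h3 := (hinner (w k) (G.loc t (i k))).trans (hloc t _)
            rw [hw] at h3
            have h4 := abs_sub_abs_le_abs_sub ⟪(k : EuclideanSpace ℝ (Fin d)), y⟫_ℝ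
              ⟪(k : EuclideanSpace ℝ (Fin d)), G.loc t (i k)⟫_ℝ
            linarith
          exact sq_le_sq' (abs_le.1 h1).1 (abs_le.1 h1).2
      _ = _ := by simp
  let Ghost : ℝ → S.Sig × EuclideanSpace ℝ (Fin d) → Prop := fun Δ p =>
    ∃ i : EuclideanSpace ℝ (Fin d) → Fin G.N,
      (∃ θ ∈ Subtype.val '' D, ∃ θ' ∈ Subtype.val '' D, i θ ≠ i θ') ∧
      ∀ θ ∈ Subtype.val '' D, dist (⟪θ, p.2⟫_ℝ) (⟪θ, G.loc p.1 (i θ)⟫_ℝ) ≤ Δ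
  have hGmono : ∀ {Δ Δ' p}, Δ ≤ Δ' → Ghost Δ p → Ghost Δ' p :=
    fun hΔ ⟨i, hi, hd⟩ => ⟨i, hi, fun θ hθ => (hd θ hθ).trans hΔ⟩
  have hcpt : IsCompact (Sbar ×ˢ Metric.closedBall (0 : EuclideanSpace ℝ (Fin d)) Y) :=
    hS.prod (isCompact_closedBall _ _)
  have hghost : ∃ Δ : ℝ, 0 < Δ ∧ ∀ p ∈ Sbar ×ˢ Metric.closedBall (0 : EuclideanSpace ℝ (Fin d)) Y,
      p.1 ∈ Sbar → ¬ Ghost Δ p := by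
    refine hcpt.induction_on (p := fun s => ∃ Δ : ℝ, 0 < Δ ∧ ∀ p ∈ s, p.1 ∈ Sbar → ¬ Ghost Δ p)
      ⟨1, one_pos, by simp⟩ ?_ ?_ ?_
    · rintro s s' hss ⟨Δ, hΔ, hs⟩
      exact ⟨Δ, hΔ, fun p hp => hs p (hss hp)⟩
    · rintro s s' ⟨Δ, hΔ, hs⟩ ⟨Δ', hΔ', hs'⟩
      refine ⟨min Δ Δ', lt_min hΔ hΔ', ?_⟩
      rintro p (hp | hp) hpS hG
      · exact hs p hp hpS (hGmono (min_le_left _ _) hG)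
      · exact hs' p hp hpS (hGmono (min_le_right _ _) hG)
    · rintro ⟨t₀, y₀⟩ ⟨ht₀, -⟩
      have hcl : ∀ j, Continuous fun p : S.Sig × EuclideanSpace ℝ (Fin d) => G.loc p.1 j :=
        fun j => (G.continuous_loc j).comp continuous_fst
      -- Near a true particle `j` the gap `g` forces the index `j` in every direction, so the index
      -- function is constant.
      by_cases hy : y₀ ∈ Set.range (G.loc t₀)
      · obtain ⟨j, rfl⟩ := hy
        have hnear : ∀ᶠ p : S.Sig × EuclideanSpace ℝ (Fin d) in nhds (t₀, G.loc t₀ j),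
            dist p.2 (G.loc p.1 j) < g / 4 := by
          have hcont : Continuous fun p : S.Sig × EuclideanSpace ℝ (Fin d) =>
              dist p.2 (G.loc p.1 j) := continuous_snd.dist (hcl j)
          refine hcont.continuousAt.eventually_lt continuousAt_const ?_
          simp only [dist_self]
          positivity
        refine ⟨_, mem_nhdsWithin_of_mem_nhds hnear, g / 4, by positivity, ?_⟩
        rintro p hp hpS ⟨i, ⟨_, ⟨θ, hθ, rfl⟩, _, ⟨θ', hθ', rfl⟩, hne⟩, hd⟩
        have hij : ∀ θ ∈ D, i (θ : EuclideanSpace ℝ (Fin d)) = j := fun θ hθ => by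
          by_contra hij
          have h1 := hgap p.1 hpS θ hθ _ _ hij
          have h2 := hd θ ⟨θ, hθ, rfl⟩
          have h3 : dist (⟪(θ : EuclideanSpace ℝ (Fin d)), p.2⟫_ℝ)
              (⟪(θ : EuclideanSpace ℝ (Fin d)), G.loc p.1 j⟫_ℝ) ≤ dist p.2 (G.loc p.1 j) := by
            rw [Real.dist_eq, ← inner_sub_right, dist_eq_norm]
            exact hinner θ _
          have h4 : dist p.2 (G.loc p.1 j) < g / 4 := hp
          have h5 := dist_triangle_left (⟪(θ : EuclideanSpace ℝ (Fin d)), G.loc p.1 (i θ)⟫_ℝ)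
            (⟪(θ : EuclideanSpace ℝ (Fin d)), G.loc p.1 j⟫_ℝ)
            (⟪(θ : EuclideanSpace ℝ (Fin d)), p.2⟫_ℝ)
          linarith
        exact hne ((hij θ hθ).trans (hij θ' hθ').symm)
      -- Elsewhere some direction separates `y₀` from all particles, since otherwise adding `y₀` to
      -- the configuration would not change its projections. This separation persists nearby.
      · have hex : ∃ θ ∈ D, ∀ j, 0 < dist (⟪(θ : EuclideanSpace ℝ (Fin d)), y₀⟫_ℝ)
            (⟪(θ : EuclideanSpace ℝ (Fin d)), G.loc t₀ j⟫_ℝ) := by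
          by_contra hcon
          push Not at hcon
          refine hy ?_
          rw [← (h t₀ ht₀).2 (insert y₀ (Set.range (G.loc t₀)))
            ((Set.finite_range _).insert _) ?_]
          · exact Set.mem_insert _ _
          · rintro _ ⟨θ, hθ, rfl⟩
            rw [Set.image_insert_eq]
            refine Set.insert_eq_of_mem ?_
            obtain ⟨j, hj⟩ := hcon θ hθ
            exact ⟨G.loc t₀ j, ⟨j, rfl⟩, (dist_le_zero.1 hj).symm⟩
        obtain ⟨θ, hθ, hpos⟩ := hex
        obtain ⟨η, hη, hηle⟩ := exists_pos_le_of_finite hpos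
        have hnear : ∀ᶠ p : S.Sig × EuclideanSpace ℝ (Fin d) in nhds (t₀, y₀), ∀ j,
            η / 2 < dist (⟪(θ : EuclideanSpace ℝ (Fin d)), p.2⟫_ℝ)
              (⟪(θ : EuclideanSpace ℝ (Fin d)), G.loc p.1 j⟫_ℝ) := by
          refine Filter.eventually_all.2 fun j => ?_
          have hcont : Continuous fun p : S.Sig × EuclideanSpace ℝ (Fin d) =>
              dist (⟪(θ : EuclideanSpace ℝ (Fin d)), p.2⟫_ℝ)
                (⟪(θ : EuclideanSpace ℝ (Fin d)), G.loc p.1 j⟫_ℝ) :=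
            (continuous_const.inner continuous_snd).dist (continuous_const.inner (hcl j))
          refine continuousAt_const.eventually_lt hcont.continuousAt ?_
          have := hηle j
          simp only
          linarith
        refine ⟨_, mem_nhdsWithin_of_mem_nhds hnear, η / 2, by positivity, ?_⟩
        rintro p hp - ⟨i, -, hd⟩
        exact (hd θ ⟨θ, hθ, rfl⟩).not_gt (hp _)
  obtain ⟨Δ, hΔ, hnot⟩ := hghost
  -- The bound `1` keeps ghosts in the ball of radius `Y`, and `g / 2` excludes coincidences.
  refine ⟨min (min Δ 1) (g / 2), by positivity, fun t ht => ⟨?_, ?_⟩⟩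
  · rintro ⟨_, ⟨θ, hθ, rfl⟩, i, j, hij, hd⟩
    have h1 := hgap t ht θ hθ j i hij.symm
    have h2 := min_le_right (min Δ 1) (g / 2)
    linarith
  · rintro ⟨y, i, hi, hd⟩
    have h1 : ∀ θ ∈ Subtype.val '' D, dist (⟪θ, y⟫_ℝ) (⟪θ, G.loc t (i θ)⟫_ℝ) ≤ min Δ 1 :=
      fun θ hθ => (hd θ hθ).trans (min_le_left _ _)
    exact hnot (t, y) ⟨ht, hY t y i fun θ hθ => (h1 θ hθ).trans (min_le_right _ _)⟩ ht
      ⟨i, hi, fun θ hθ => (h1 θ hθ).trans (min_le_left _ _)⟩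

end GroundTruth


/-! ### Assembly of the qualitative and quantitative estimates -/

namespace Setting

/-- In every direction and for finitely many times there is a measure on the projected phase space
that matches the snapshots `u` (provided that there are at least two times). -/
def HasSlices (S : Setting d H) (u : S.Sig → FiniteMeasure S.Ω) : Prop :=
  ∀ t₁ t₂ : S.Sig, t₁ ≠ t₂ → ∀ (T : Finset S.Sig) (θ : S.Θ),
    ∃ μ : FiniteMeasure S.Gam, ∀ t ∈ T, S.move t μ = S.radon θ (u t)

theorem ProductAdmissible.hasSlices {S : Setting d H} {u : S.Sig → FiniteMeasure S.Ω}
    {γ : S.Θ → FiniteMeasure S.Gam} (h : S.ProductAdmissible u γ) : S.HasSlices u :=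
  fun _ _ _ _ θ => ⟨γ θ, fun t _ => h t θ⟩

theorem MixedAdmissible.hasSlices {S : Setting d H} {u : S.Sig → FiniteMeasure S.Ω}
    {γ : FiniteMeasure (S.Θ × S.Gam)} (h : S.MixedAdmissible u γ) : S.HasSlices u :=
  fun _ _ ht T θ => h.exists_move_eq ht T θ

end Setting

theorem isConcentrated_of_isEmpty {X ι : Type*} [MeasurableSpace X] [Fintype ι] [IsEmpty ι]
    (μ : FiniteMeasure X) (m : ι → ℝ≥0) (D : ι → X → ℝ≥0∞) {K : ℝ} (hK : (μ.mass : ℝ) ≤ K) :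
    IsConcentrated (μ : Measure X) m D (fun _ => ∅) (ENNReal.ofReal K) (ENNReal.ofReal K) where
  measurableSet i := isEmptyElim i
  disjoint i := isEmptyElim i
  sum_lintegral_le := by simp
  compl_le := by
    rw [Set.iUnion_of_empty, Set.compl_empty, ← FiniteMeasure.ennreal_mass,
      ← ENNReal.ofReal_coe_nnreal]
    exact ENNReal.ofReal_le_ofReal hK
  le_mass_add i := isEmptyElim i
  mass_le_add i := isEmptyElim i

namespace GroundTruth

variable {S : Setting d H} (G : GroundTruth S)

theorem radiusTheta_le {T : Finset S.Sig} (hT : T.Nonempty) {Δ : ℝ} (hΔ : 0 ≤ Δ) :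
    0 ≤ radiusTheta T hT 1 Δ ∧ radiusTheta T hT 1 Δ ≤ min 1 (Δ / 3) := by
  have h1 : 1 ≤ √(1 + T.sup' hT fun t => (t : ℝ) ^ 2) := by
    obtain ⟨t, ht⟩ := hT
    have := Finset.le_sup' (fun t : S.Sig => (t : ℝ) ^ 2) ht
    exact Real.one_le_sqrt.2 (by linarith [sq_nonneg (t : ℝ)])
  have h2 : 0 ≤ min 1 (Δ / 3) := le_min zero_le_one (by positivity)
  exact ⟨div_nonneg h2 (by positivity), div_le_self h2 h1⟩

theorem snapshotError_zero (u : S.Sig → FiniteMeasure S.Ω) (t : S.Sig) :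
    G.snapshotError 0 u t = 0 := unbalancedWasserstein_zero_left

theorem projectionError_zero (γ : S.Θ → FiniteMeasure S.Gam) (θ : S.Θ) :
    G.projectionError 0 γ θ = 0 := unbalancedWasserstein_zero_left

variable [CompleteSpace H]

theorem exists_snapshot_bound_observed {T : Finset S.Sig} (hTS : T ⊆ S.times)
    (hrec : ∀ t ∈ T, IsReconstructible (S.obsAdj t) (G.snapshot t)) :
    ∃ C : ℝ, 0 < C ∧ ∀ (f : S.Sig → H) (u : S.Sig → FiniteMeasure S.Ω) (q : ℝ),
      G.IsNearOptimal f u q → ∀ t ∈ T,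
      G.snapshotError 1 u t ≤ ENNReal.ofReal (C * √(G.noise f)) := by
  choose C hC hbound using fun t : T => G.exists_snapshot_bound (hTS t.2) (hrec t t.2)
  refine ⟨∑ t, C t + 1, add_pos_of_nonneg_of_pos (Finset.sum_nonneg fun t _ => (hC t).le) one_pos,
    fun f u q hu t ht => ((hbound ⟨t, ht⟩ f u q hu).1).trans (ENNReal.ofReal_le_ofReal ?_)⟩
  gcongr
  have := Finset.single_le_sum (fun t _ => (hC t).le) (Finset.mem_univ (⟨t, ht⟩ : T))
  linarith

/-- The constant `C₂` enters as a parameter after `C`, which keeps the dependence on the times apart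
from that on the directions. -/
theorem exists_projection_bound {T : Finset S.Sig} (hT : 2 ≤ T.card) (hTS : T ⊆ S.times)
    (hrec : ∀ t ∈ T, IsReconstructible (S.obsAdj t) (G.snapshot t)) :
    ∃ C : ℝ, 0 < C ∧ ∀ (f : S.Sig → H) (u : S.Sig → FiniteMeasure S.Ω) (q : ℝ),
      G.IsNearOptimal f u q →
      (∀ (γ : S.Θ → FiniteMeasure S.Gam) (θ : S.Θ), (∀ t ∈ T, S.move t (γ θ) = S.radon θ (u t)) →
        ∀ Δ r : ℝ, 0 < Δ → 0 ≤ r → r ≤ min 1 (Δ / 3) → G.TimeSeparated T θ Δ →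
        G.projectionError r γ θ ≤ ENNReal.ofReal (C * √(G.noise f))) ∧
      (S.HasSlices u → ∀ D : Set S.Θ, ∀ C₂ : ℝ,
        (∀ (u : S.Sig → FiniteMeasure S.Ω) (t : S.Sig) (Δ K r : ℝ), 0 < Δ → 0 ≤ K →
          0 ≤ r → r ≤ radiusTime 1 Δ t → G.DirSeparated D t Δ →
          (∀ θ ∈ D, ∃ μ : FiniteMeasure S.Gam, S.move t μ = S.radon θ (u t) ∧
            ∃ A, IsConcentrated (μ : Measure S.Gam) G.m
              (fun i z => edist (z : EuclideanSpace ℝ (Fin 2)) (G.projPhase θ i) ^ 2) A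
              (ENNReal.ofReal K) (ENNReal.ofReal (K / min 1 (Δ / 3) ^ 2))) →
          G.snapshotError r u t ≤ ENNReal.ofReal (C₂ * (1 + (t : ℝ) ^ 2) * K)) → 0 < C₂ →
        ∀ (t : S.Sig) (Δ r : ℝ), 0 < Δ → 0 ≤ r → r ≤ radiusTime 1 Δ t → G.DirSeparated D t Δ →
          (∀ θ ∈ D, G.TimeSeparated T θ Δ) →
          G.snapshotError r u t ≤ ENNReal.ofReal (C * C₂ * (1 + (t : ℝ) ^ 2) * √(G.noise f))) := by
  classical
  obtain ⟨t₁, -, t₂, -, ht⟩ := Finset.one_lt_card.1 (show 1 < T.card by omega)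
  obtain ⟨C, hC, hbound⟩ := G.exists_projection_isConcentrated hT hTS hrec
  refine ⟨(G.N + 2) * C, by positivity, fun f u q hu => ⟨?_, ?_⟩⟩
  · intro γ θ hγ Δ r hΔ hr hrΔ hsep
    obtain ⟨A, hA⟩ := hbound f u q hu θ Δ hΔ hsep (γ θ) hγ
    rw [mul_assoc]
    refine G.projectionError_le_of_isConcentrated (lt_min one_pos (by positivity : 0 < Δ / 3))
      (by positivity) hr hrΔ (A := A) ?_
    rwa [mul_div_right_comm]
  · intro hsl D C₂ hC₂ hC₂0 t Δ r hΔ hr hrt hsep hsepD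
    refine (hC₂ u t Δ (C * √(G.noise f)) r hΔ (by positivity) hr hrt hsep fun θ hθ => ?_).trans
      (ENNReal.ofReal_le_ofReal ?_)
    -- One measure has to match at the times in `T`, for its concentration, and at `t`, to pass this
    -- on to the snapshot.
    · obtain ⟨μ, hμ⟩ := hsl t₁ t₂ ht (insert t T) θ
      refine ⟨μ, hμ t (Finset.mem_insert_self _ _), ?_⟩
      obtain ⟨A, hA⟩ := hbound f u q hu θ Δ hΔ (hsepD θ hθ) μ fun s hs =>
        hμ s (Finset.mem_insert_of_mem hs)
      refine ⟨A, ?_⟩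
      rwa [mul_div_right_comm]
    · have h1 : 0 ≤ C * √(G.noise f) * C₂ * (1 + (t : ℝ) ^ 2) := by positivity
      have h2 : (1 : ℝ) ≤ G.N + 2 := by have : (0 : ℝ) ≤ G.N := Nat.cast_nonneg _; linarith
      calc C₂ * (1 + (t : ℝ) ^ 2) * (C * √(G.noise f))
          = 1 * (C * √(G.noise f) * C₂ * (1 + (t : ℝ) ^ 2)) := by ring
        _ ≤ (G.N + 2) * (C * √(G.noise f) * C₂ * (1 + (t : ℝ) ^ 2)) := by gcongr
        _ = _ := by ring

theorem mass_le_of_isNearOptimal {f : S.Sig → H} {u : S.Sig → FiniteMeasure S.Ω} {q : ℝ}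
    (h : G.IsNearOptimal f u q) (hN : G.N = 0) (t : S.Sig) : ((u t).mass : ℝ) ≤ √(G.noise f) := by
  have : IsEmpty (Fin G.N) := by rw [hN]; infer_instance
  have h0 : G.lam = 0 := by unfold lam; simp
  have h1 := h.mass_add_le t
  have h2 : (G.lam.mass : ℝ) = 0 := by rw [h0]; simp
  linarith [h.nonneg]

/-- The qualitative estimate of the position-velocity projections. -/
theorem exists_projection_bound_of_isCompact {T : Finset S.Sig} (hT : T.Nonempty)
    (hTS : T ⊆ S.times) (hrec : ∀ t ∈ T, IsReconstructible (S.obsAdj t) (G.snapshot t))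
    {D : Set S.Θ} (hD : IsCompact D) (hsep : ∀ θ ∈ D,
      ¬ HasCoincidence (G.projPos θ) (G.projVel θ) (Subtype.val '' (T : Set S.Sig)) ∧
      ¬ HasGhost (G.projPos θ) (G.projVel θ) (Subtype.val '' (T : Set S.Sig))) :
    ∃ R C : ℝ, 0 < R ∧ 0 < C ∧ ∀ (f : S.Sig → H) (u : S.Sig → FiniteMeasure S.Ω) (q : ℝ),
      G.IsNearOptimal f u q → ∀ (γ : S.Θ → FiniteMeasure S.Gam), ∀ θ ∈ D,
      (∀ t ∈ T, S.move t (γ θ) = S.radon θ (u t)) → ∀ r, 0 ≤ r → r ≤ R →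
      G.projectionError r γ θ ≤ ENNReal.ofReal (C * √(G.noise f)) := by
  -- Without particles there are no ghosts even for a single time, so two times cannot be
  -- guaranteed; the mass bound suffices instead.
  by_cases hN : G.N = 0
  · obtain ⟨t, ht⟩ := hT
    refine ⟨1, G.N + 2, one_pos, by positivity, fun f u q hu γ θ _ hγ r hr hr1 => ?_⟩
    have : IsEmpty (Fin G.N) := by rw [hN]; infer_instance
    have hmass : ((γ θ).mass : ℝ) ≤ √(G.noise f) := by
      have h1 := congrArg FiniteMeasure.mass (hγ t ht)
      rw [Setting.mass_move, Setting.mass_radon] at h1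
      rw [h1]
      exact G.mass_le_of_isNearOptimal hu hN t
    refine G.projectionError_le_of_isConcentrated one_pos (Real.sqrt_nonneg _) hr hr1
      (A := fun _ => ∅) ?_
    rw [one_pow, div_one]
    exact isConcentrated_of_isEmpty _ _ _ hmass
  rcases D.eq_empty_or_nonempty with rfl | ⟨θ₀, hθ₀⟩
  · exact ⟨1, 1, one_pos, one_pos, by simp⟩
  obtain ⟨Δ, hΔ, hΔsep⟩ := G.exists_uniform_timeSeparated T hD hsep
  obtain ⟨C, hC, hbound⟩ := G.exists_projection_bound
    (G.two_le_card_of_not_hasGhost hN hT (hsep θ₀ hθ₀).2) hTS hrec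
  exact ⟨min 1 (Δ / 3), C, by positivity, hC, fun f u q hu γ θ hθ hγ r hr hrR =>
    (hbound f u q hu).1 γ θ hγ Δ r hΔ hr hrR (hΔsep θ hθ)⟩

/-- The qualitative estimate of the snapshots. -/
theorem exists_snapshot_bound_of_isCompact {T : Finset S.Sig} (hT : T.Nonempty)
    (hTS : T ⊆ S.times) (hrec : ∀ t ∈ T, IsReconstructible (S.obsAdj t) (G.snapshot t))
    {D : Set S.Θ} (hD : IsCompact D) (hsep : ∀ θ ∈ D,
      ¬ HasCoincidence (G.projPos θ) (G.projVel θ) (Subtype.val '' (T : Set S.Sig)) ∧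
      ¬ HasGhost (G.projPos θ) (G.projVel θ) (Subtype.val '' (T : Set S.Sig)))
    {Sbar : Set S.Sig} (hS : IsCompact Sbar) (hSsep : ∀ t ∈ Sbar,
      (∀ θ ∈ D, ∀ i j, i ≠ j →
        0 < dist (⟪(θ : EuclideanSpace ℝ (Fin d)), G.loc t i⟫_ℝ)
          (⟪(θ : EuclideanSpace ℝ (Fin d)), G.loc t j⟫_ℝ)) ∧
      IsDeterminedByProjections (Set.range (G.loc t)) (Subtype.val '' D)) :
    ∃ R C : ℝ, 0 < R ∧ 0 < C ∧ ∀ (f : S.Sig → H) (u : S.Sig → FiniteMeasure S.Ω) (q : ℝ),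
      G.IsNearOptimal f u q → S.HasSlices u → ∀ t ∈ Sbar, ∀ r, 0 ≤ r → r ≤ R →
      G.snapshotError r u t ≤ ENNReal.ofReal (C * √(G.noise f)) := by
  by_cases hN : G.N = 0
  · refine ⟨1, 2, one_pos, two_pos, fun f u q hu _ t _ r hr hr1 => ?_⟩
    have : IsEmpty (Fin G.N) := by rw [hN]; infer_instance
    unfold snapshotError
    rw [zeroExt_snapshot]
    refine (unbalancedWasserstein_zeroExt_le S.Ω.isCompact.measurableSet (Real.sqrt_nonneg _)
      (Real.sqrt_nonneg _) (isConcentrated_of_isEmpty (u t) G.m _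
        (G.mass_le_of_isNearOptimal hu hN t)) r).trans (ENNReal.ofReal_le_ofReal ?_)
    rw [Fintype.card_fin, hN, Nat.cast_zero, zero_add, one_mul]
    have h1 : r ^ 2 ≤ 1 := pow_le_one₀ hr hr1
    have h2 := Real.sqrt_nonneg (G.noise f)
    nlinarith
  rcases Sbar.eq_empty_or_nonempty with rfl | ⟨t₀, ht₀⟩
  · exact ⟨1, 1, one_pos, one_pos, by simp⟩
  have hne : (Set.range (G.loc t₀)).Nonempty := ⟨_, ⟨0, Nat.pos_of_ne_zero hN⟩, rfl⟩
  have hspan : Submodule.span ℝ (Subtype.val '' D) = ⊤ :=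
    span_eq_top_of_isDeterminedByProjections (Set.finite_range _) hne (hSsep t₀ ht₀).2
  have hDne : D.Nonempty := by
    obtain ⟨b, -, w, -, hwD, ⟨k⟩, -⟩ := exists_finite_spanning hspan
    exact ⟨w k, hwD k⟩
  obtain ⟨θ₀, hθ₀⟩ := hDne
  obtain ⟨Δ₁, hΔ₁, hsep₁⟩ := G.exists_uniform_timeSeparated T hD hsep
  obtain ⟨Δ₂, hΔ₂, hsep₂⟩ := G.exists_uniform_dirSeparated hD hspan hS hSsep
  obtain ⟨C₂, hC₂, hbound₂⟩ := G.exists_snapshot_bound_of_projections hspan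
  obtain ⟨C, hC, hbound⟩ := G.exists_projection_bound
    (G.two_le_card_of_not_hasGhost hN hT (hsep θ₀ hθ₀).2) hTS hrec
  obtain ⟨M, hM⟩ := S.Sig.isCompact.isBounded.exists_norm_le
  have htM : ∀ t : S.Sig, (t : ℝ) ^ 2 ≤ M ^ 2 := fun t =>
    sq_le_sq' (abs_le.1 (hM t t.2)).1 (abs_le.1 (hM t t.2)).2
  have hΔ : 0 < min Δ₁ Δ₂ := lt_min hΔ₁ hΔ₂
  -- The bound `M` on all times makes radius and constant independent of `t`.
  refine ⟨radiusTime 1 (min Δ₁ Δ₂) M, C * C₂ * (1 + M ^ 2), lt_min one_pos (by positivity),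
    by positivity, fun f u q hu hsl t ht r hr hrR => ?_⟩
  refine ((hbound f u q hu).2 hsl D C₂ hbound₂ hC₂ t (min Δ₁ Δ₂) r hΔ hr (hrR.trans ?_)
    ((hsep₂ t ht).mono (min_le_right _ _))
    fun θ hθ => (hsep₁ θ hθ).mono (min_le_left _ _)).trans (ENNReal.ofReal_le_ofReal ?_)
  · unfold radiusTime
    have := htM t
    gcongr
  · have := htM t
    gcongr

/-- The quantitative estimates, stated for near optimal snapshots and for slices that match them. -/
theorem exists_quantitative_bounds : ∃ C₂ : Set S.Θ → ℝ, (∀ D, 0 < C₂ D) ∧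
    ∀ (T : Finset S.Sig) (hT : T.Nonempty), T ⊆ S.times →
    (∀ t ∈ T, IsReconstructible (S.obsAdj t) (G.snapshot t)) →
    ∃ C₁ : ℝ, 0 < C₁ ∧ ∀ (f : S.Sig → H) (u : S.Sig → FiniteMeasure S.Ω) (q : ℝ),
      G.IsNearOptimal f u q →
      (∀ t ∈ T, G.snapshotError 1 u t ≤ ENNReal.ofReal (C₁ * √(G.noise f))) ∧
      (2 ≤ T.card → ∀ (γ : S.Θ → FiniteMeasure S.Gam) (θ : S.Θ),
        (∀ t ∈ T, S.move t (γ θ) = S.radon θ (u t)) → ∀ Δ : ℝ, 0 ≤ Δ → G.TimeSeparated T θ Δ →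
        G.projectionError (radiusTheta T hT 1 Δ) γ θ ≤
          ENNReal.ofReal (C₁ / radiusTheta T hT 1 Δ ^ 2 * √(G.noise f))) ∧
      (S.HasSlices u → 2 ≤ T.card → ∀ D : Set S.Θ, Submodule.span ℝ (Subtype.val '' D) = ⊤ →
        ∀ Δ : S.Θ → ℝ, (∀ θ ∈ D, 0 ≤ Δ θ ∧ G.TimeSeparated T θ (Δ θ)) →
        ∀ (t : S.Sig) (Δt : ℝ), 0 ≤ Δt → (∀ θ ∈ D, Δt ≤ Δ θ) → G.DirSeparated D t Δt →
        G.snapshotError (radiusTime 1 Δt t) u t ≤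
          ENNReal.ofReal (C₁ * C₂ D * ((t : ℝ) ^ 2 + 1 / radiusTime 1 Δt t ^ 4) *
            √(G.noise f))) := by
  classical
  -- Fixed before `T` is introduced, with the default `1` for directions that do not span.
  let C₂ : Set S.Θ → ℝ := fun D =>
    if h : Submodule.span ℝ (Subtype.val '' D) = ⊤ then
      (G.exists_snapshot_bound_of_projections h).choose else 1
  have hC₂ : ∀ D, 0 < C₂ D := fun D => by
    by_cases h : Submodule.span ℝ (Subtype.val '' D) = ⊤
    · simp only [C₂, dif_pos h]
      exact (G.exists_snapshot_bound_of_projections h).choose_spec.1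
    · simp only [C₂, dif_neg h]
      exact one_pos
  refine ⟨C₂, hC₂, fun T hT hTS hrec => ?_⟩
  obtain ⟨C, hC, hsnap⟩ := G.exists_snapshot_bound_observed hTS hrec
  by_cases hcard : 2 ≤ T.card
  swap
  · exact ⟨C, hC, fun f u q hu => ⟨fun t ht => hsnap f u q hu t ht, fun h => (hcard h).elim,
      fun _ h => (hcard h).elim⟩⟩
  obtain ⟨C', hC', hproj⟩ := G.exists_projection_bound hcard hTS hrec
  refine ⟨C + C', by positivity, fun f u q hu => ⟨?_, ?_, ?_⟩⟩
  · intro t ht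
    refine (hsnap f u q hu t ht).trans (ENNReal.ofReal_le_ofReal ?_)
    gcongr
    linarith
  · intro _ γ θ hγ Δ hΔ hsep
    obtain ⟨hr0, hr⟩ := radiusTheta_le hT hΔ
    set r := radiusTheta T hT 1 Δ
    rcases hr0.eq_or_lt with h0 | hpos
    · rw [← h0, projectionError_zero]
      exact zero_le
    have hΔ0 : 0 < Δ := by
      have := hpos.trans_le (hr.trans (min_le_right _ _))
      linarith
    refine ((hproj f u q hu).1 γ θ hγ Δ r hΔ0 hr0 hr hsep).trans (ENNReal.ofReal_le_ofReal ?_)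
    gcongr
    -- The bound obtained is `C' * √δ`; dividing by `r ^ 2 ≤ 1` only weakens it.
    have hr2 : r ^ 2 ≤ 1 := pow_le_one₀ hr0 (hr.trans (min_le_left _ _))
    rw [le_div_iff₀ (by positivity)]
    nlinarith
  · intro hsl _ D hD Δ hΔ t Δt hΔt hle hsep
    have hr1 : radiusTime 1 Δt t ≤ 1 := min_le_left _ _
    have hr0 : 0 ≤ radiusTime 1 Δt t := le_min zero_le_one (by positivity)
    rcases hΔt.eq_or_lt with h0 | hpos
    · have h1 : radiusTime 1 Δt t = 0 := by simp [radiusTime, ← h0]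
      rw [h1, snapshotError_zero]
      exact zero_le
    have hrpos : 0 < radiusTime 1 Δt t := lt_min one_pos (by positivity)
    have hC₂D : C₂ D = (G.exists_snapshot_bound_of_projections hD).choose := dif_pos hD
    have hspec := (G.exists_snapshot_bound_of_projections hD).choose_spec.2
    rw [← hC₂D] at hspec
    refine ((hproj f u q hu).2 hsl D (C₂ D) hspec (hC₂ D) t Δt _ hpos hr0 le_rfl hsep
      fun θ hθ => (hΔ θ hθ).2.mono (hle θ hθ)).trans (ENNReal.ofReal_le_ofReal ?_)
    have h1 : 1 ≤ 1 / radiusTime 1 Δt t ^ 4 := by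
      rw [le_div_iff₀ (by positivity), one_mul]
      exact pow_le_one₀ hr0 hr1
    have h2 := (hC₂ D).le
    gcongr ?_ * _ * ?_ * _
    · linarith
    · linarith

end GroundTruth

end ParticleTracking

theorem mainTheorem1 {d : ℕ} {H : Type*} [NormedAddCommGroup H] [InnerProductSpace ℝ H]
    [CompleteSpace H] (S : Setting d H) (G : GroundTruth S) :
    -- in the mixed model the slices of a solution exist
    (∀ (α : ℝ) (f : S.Sig → H) (u : S.Sig → FiniteMeasure S.Ω)
      (γ : FiniteMeasure (S.Θ × S.Gam)), S.IsMixedSolution α f u γ →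
        ∃ g : S.Θ → FiniteMeasure S.Gam, IsFiberProduct S.HΘ g γ) ∧
    -- the qualitative error estimate
    (∀ (T' : Finset S.Sig), T'.Nonempty → T' ⊆ S.times →
      (∀ t ∈ T', IsReconstructible (S.obsAdj t) (G.snapshot t)) →
      ∀ Θbar : Set S.Θ, IsCompact Θbar →
      (∀ θ ∈ Θbar,
        ¬ HasCoincidence (G.projPos θ) (G.projVel θ) (Subtype.val '' (T' : Set S.Sig)) ∧
        ¬ HasGhost (G.projPos θ) (G.projVel θ) (Subtype.val '' (T' : Set S.Sig))) →
      ∀ Sbar : Set S.Sig, IsCompact Sbar →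
      (∀ t ∈ Sbar,
        (∀ θ ∈ Θbar, ∀ i j, i ≠ j →
          0 < dist (⟪(θ : EuclideanSpace ℝ (Fin d)), G.loc t i⟫_ℝ)
            (⟪(θ : EuclideanSpace ℝ (Fin d)), G.loc t j⟫_ℝ)) ∧
        IsDeterminedByProjections (Set.range (G.loc t)) (Subtype.val '' Θbar)) →
      ∃ R C : ℝ, 0 < R ∧ 0 < C ∧ ∀ f : S.Sig → H,
        (∀ θ₀ u γ, S.IsProductSolution √(G.noise f) f θ₀ u γ →
          (∀ t ∈ Sbar, G.snapshotError R u t ≤ ENNReal.ofReal (C * √(G.noise f))) ∧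
          (∀ θ ∈ Θbar, G.projectionError R γ θ ≤ ENNReal.ofReal (C * √(G.noise f)))) ∧
        (∀ u γ, S.IsMixedSolution √(G.noise f) f u γ →
          (∀ t ∈ Sbar, G.snapshotError R u t ≤ ENNReal.ofReal (C * √(G.noise f))) ∧
          (∀ g, IsFiberProduct S.HΘ g γ → ∀ᵐ θ ∂S.HΘ, θ ∈ Θbar →
            G.projectionError R g θ ≤ ENNReal.ofReal (C * √(G.noise f))))) ∧
    -- the quantitative error estimate; `C₂` depends on the directions `Θ'` but not on the times `T'`
    (∃ C₂ : Set S.Θ → ℝ, (∀ D, 0 < C₂ D) ∧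
      ∀ (T' : Finset S.Sig) (hT' : T'.Nonempty), T' ⊆ S.times →
      (∀ t ∈ T', IsReconstructible (S.obsAdj t) (G.snapshot t)) →
      ∃ R C₁ : ℝ, 0 < R ∧ 0 < C₁ ∧ ∀ f : S.Sig → H,
        (∀ θ₀ u γ, S.IsProductSolution √(G.noise f) f θ₀ u γ →
          (∀ t ∈ T', G.snapshotError R u t ≤ ENNReal.ofReal (C₁ * √(G.noise f))) ∧
          (2 ≤ T'.card → ∀ θ, ∀ Δ : ℝ, 0 ≤ Δ → G.TimeSeparated T' θ Δ →
            G.projectionError (radiusTheta T' hT' R Δ) γ θ ≤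
              ENNReal.ofReal (C₁ / radiusTheta T' hT' R Δ ^ 2 * √(G.noise f))) ∧
          (2 ≤ T'.card → ∀ Θ' : Set S.Θ, Submodule.span ℝ (Subtype.val '' Θ') = ⊤ →
            ∀ Δ : S.Θ → ℝ, (∀ θ ∈ Θ', 0 ≤ Δ θ ∧ G.TimeSeparated T' θ (Δ θ)) →
            ∀ (t : S.Sig) (Δt : ℝ), 0 ≤ Δt → (∀ θ ∈ Θ', Δt ≤ Δ θ) → G.DirSeparated Θ' t Δt →
            G.snapshotError (radiusTime R Δt t) u t ≤
              ENNReal.ofReal (C₁ * C₂ Θ' * ((t : ℝ) ^ 2 + 1 / radiusTime R Δt t ^ 4) *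
                √(G.noise f)))) ∧
        (∀ u γ, S.IsMixedSolution √(G.noise f) f u γ →
          (∀ t ∈ T', G.snapshotError R u t ≤ ENNReal.ofReal (C₁ * √(G.noise f))) ∧
          (2 ≤ T'.card → ∀ g, IsFiberProduct S.HΘ g γ → ∀ᵐ θ ∂S.HΘ,
            ∀ Δ : ℝ, 0 ≤ Δ → G.TimeSeparated T' θ Δ →
            G.projectionError (radiusTheta T' hT' R Δ) g θ ≤
              ENNReal.ofReal (C₁ / radiusTheta T' hT' R Δ ^ 2 * √(G.noise f))) ∧
          (2 ≤ T'.card → ∀ Θ' : Set S.Θ, Submodule.span ℝ (Subtype.val '' Θ') = ⊤ →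
            ∀ Δ : S.Θ → ℝ, (∀ θ ∈ Θ', 0 ≤ Δ θ ∧ G.TimeSeparated T' θ (Δ θ)) →
            ∀ (t : S.Sig) (Δt : ℝ), 0 ≤ Δt → (∀ θ ∈ Θ', Δt ≤ Δ θ) → G.DirSeparated Θ' t Δt →
            G.snapshotError (radiusTime R Δt t) u t ≤
              ENNReal.ofReal (C₁ * C₂ Θ' * ((t : ℝ) ^ 2 + 1 / radiusTime R Δt t ^ 4) *
                √(G.noise f))))) := by
  refine ⟨fun α f u γ h => h.1.exists_isFiberProduct, ?_, ?_⟩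
  · intro T' hT' hTS hrec Θbar hΘbar hsep Sbar hSbar hSsep
    obtain ⟨R₁, C₁, hR₁, hC₁, hproj⟩ :=
      G.exists_projection_bound_of_isCompact hT' hTS hrec hΘbar hsep
    obtain ⟨R₂, C₂, hR₂, hC₂, hsnap⟩ :=
      G.exists_snapshot_bound_of_isCompact hT' hTS hrec hΘbar hsep hSbar hSsep
    have hR : 0 < min R₁ R₂ := lt_min hR₁ hR₂
    have hle₁ : ∀ f, ENNReal.ofReal (C₁ * √(G.noise f)) ≤
        ENNReal.ofReal ((C₁ + C₂) * √(G.noise f)) := fun f =>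
      ENNReal.ofReal_le_ofReal (by gcongr; linarith)
    have hle₂ : ∀ f, ENNReal.ofReal (C₂ * √(G.noise f)) ≤
        ENNReal.ofReal ((C₁ + C₂) * √(G.noise f)) := fun f =>
      ENNReal.ofReal_le_ofReal (by gcongr; linarith)
    refine ⟨min R₁ R₂, C₁ + C₂, hR, by positivity, fun f => ⟨?_, ?_⟩⟩
    · intro θ₀ u γ h
      obtain ⟨q, hq⟩ := G.exists_isNearOptimal_of_product h
      exact ⟨fun t ht => (hsnap f u q hq h.1.hasSlices t ht _ hR.le (min_le_right _ _)).trans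
          (hle₂ f),
        fun θ hθ => (hproj f u q hq γ θ hθ (fun t _ => h.1 t θ) _ hR.le (min_le_left _ _)).trans
          (hle₁ f)⟩
    · intro u γ h
      obtain ⟨q, hq⟩ := G.exists_isNearOptimal_of_mixed h
      refine ⟨fun t ht => (hsnap f u q hq h.1.hasSlices t ht _ hR.le (min_le_right _ _)).trans
          (hle₂ f), fun g hg => ?_⟩
      -- Only finitely many times are matched, so a single null set suffices.
      filter_upwards [(Finset.eventually_all T').2 fun t _ => h.1.ae_move_eq hg t] with θ hθ hmem
      exact (hproj f u q hq g θ hmem hθ _ hR.le (min_le_left _ _)).trans (hle₁ f)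
  · obtain ⟨C₂, hC₂, hbound⟩ := G.exists_quantitative_bounds
    refine ⟨C₂, hC₂, fun T' hT' hTS hrec => ?_⟩
    obtain ⟨C₁, hC₁, hb⟩ := hbound T' hT' hTS hrec
    refine ⟨1, C₁, one_pos, hC₁, fun f => ⟨?_, ?_⟩⟩
    · intro θ₀ u γ h
      obtain ⟨q, hq⟩ := G.exists_isNearOptimal_of_product h
      obtain ⟨h1, h2, h3⟩ := hb f u q hq
      exact ⟨h1, fun hcard θ => h2 hcard γ θ fun t _ => h.1 t θ, h3 h.1.hasSlices⟩
    · intro u γ h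
      obtain ⟨q, hq⟩ := G.exists_isNearOptimal_of_mixed h
      obtain ⟨h1, h2, h3⟩ := hb f u q hq
      refine ⟨h1, fun hcard g hg => ?_, h3 h.1.hasSlices⟩
      -- The null set comes from the matching alone, so it does not depend on `Δ`.
      filter_upwards [(Finset.eventually_all T').2 fun t _ => h.1.ae_move_eq hg t] with θ hθ
      exact h2 hcard g θ hθ
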